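/- Let $\Bbbk$ be an algebraically closed field and let $R$ be a finite-dimensional Gorenstein $\Bbbk$-algebra, i.e. a finite-dimensional associative $\Bbbk$-algebra which has finite injective dimension as a left and as a right module over itself. Let $\operatorname{GP}(R)$ be the category of finitely generated $R$-modules $X$ with $\operatorname{Ext}^i_R(X,R)=0$ for all $i>0$. Let $\operatorname{GP}_{\mathcal P}(R)$ be any Frobenius exact structure on $\operatorname{GP}(R)$, i.e. any Quillen exact structure on the additive category $\operatorname{GP}(R)$ which has enough projective and enough injective objects and whose class $\mathcal P$ of projective objects equals its class of injective objects. Let $\underline{\operatorname{GP}}_{\mathcal P}(R)=\operatorname{GP}(R)/\mathcal P$ be its stable category, with the cosyzygy functor $\Sigma$ as suspension. The quiver of a $\Bbbk$-linear category $\mathcal A$ has the isomorphism classes $[X]$ of indecomposable objects of $\mathcal A$ as vertices, and an arrow $[X]\to[Y]$ if and only if $\operatorname{rad}_{\mathcal A}(X,Y)/\operatorname{rad}^2_{\mathcal A}(X,Y)\neq 0$. The quiver underlying the Auslander–Reiten quiver of $\underline{\operatorname{GP}}_{\mathcal P}(R)$ is the quiver of the category $\underline{\operatorname{GP}}_{\mathcal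 P}(R)$. (a) The Auslander–Reiten quiver of $\underline{\operatorname{GP}}_{\mathcal P}(R)$ has no loops. (b) Suppose that $\underline{\operatorname{GP}}_{\mathcal P}(R)$ is $2$-Calabi–Yau, i.e. that $\Sigma^2$ is a Serre functor: $\operatorname{Hom}(X,Y)\cong \operatorname{Hom}_{\Bbbk}(\operatorname{Hom}(Y,\Sigma^2X),\Bbbk)$ naturally in $X$ and $Y$. Then the quiver of every cluster-tilting subcategory $\mathcal T$ of $\underline{\operatorname{GP}}_{\mathcal P}(R)$ has neither loops nor $2$-cycles, and the quiver of every cluster-tilting object $T$ of $\underline{\operatorname{GP}}_{\mathcal P}(R)$, that is the quiver of the category $\operatorname{add}T$, has neither loops nor $2$-cycles. Here a full subcategory $\mathcal T$ is cluster-tilting if $\operatorname{Hom}(T,\Sigma T')=0$ for all $T,T'\in\mathcal T$, every object $X$ with $\operatorname{Hom}(T,\Sigma X)=0$ for all $T\in\mathcal T$ lies in $\mathcal T$, and $\mathcal T$ is functorially finite (every object has a left and a right $\mathcal T$-approximation). An object $T$ is cluster-tilting if $\operatorname{Hom}(T,\Sigma T)=0$ and every object $X$ with $\operatorname{Hom}(T,\Sigma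 X)=0$ lies in $\operatorname{add}T$, the class of direct summands of finite direct sums of copies of $T$. -/

import Mathlib

open CategoryTheory CategoryTheory.Limits

universe w v u

noncomputable section

/-! ## Exact categories (Quillen) -/

section Exact

variable {E : Type u} [Category.{v} E] [Preadditive E]

/-- For a class `S` of short sequences: `i` is the first map of a member of `S`. -/
def IsInflationOf (S : ShortComplex E → Prop) {X Y : E} (i : X ⟶ Y) : Prop :=
  ∃ (Z : E) (p : Y ⟶ Z) (h : i ≫ p = 0), S (ShortComplex.mk i p h)

/-- For a class `S` of short sequences: `p` is the second map of a member of `S`. -/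
def IsDeflationOf (S : ShortComplex E → Prop) {Y Z : E} (p : Y ⟶ Z) : Prop :=
  ∃ (X : E) (i : X ⟶ Y) (h : i ≫ p = 0), S (ShortComplex.mk i p h)

variable (E) in
/-- A (Quillen) exact structure on the additive category `E`: a class of kernel-cokernel pairs
(the conflations), closed under isomorphism, such that identities are inflations and deflations,
inflations and deflations are closed under composition, inflations are stable under push-out
along arbitrary morphisms and deflations are stable under pull-back along arbitrary morphisms. -/
structure ExactStructure [HasFiniteBiproducts E] where
  conflation : ShortComplex E → Prop
  conflation_of_iso : ∀ {S T : ShortComplex E}, (S ≅ T) → conflation S → conflation T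
  isKernel : ∀ {S : ShortComplex E}, conflation S → Nonempty (IsLimit (KernelFork.ofι S.f S.zero))
  isCokernel : ∀ {S : ShortComplex E}, conflation S →
    Nonempty (IsColimit (CokernelCofork.ofπ S.g S.zero))
  inflation_id : ∀ X : E, IsInflationOf conflation (𝟙 X)
  deflation_id : ∀ X : E, IsDeflationOf conflation (𝟙 X)
  inflation_comp : ∀ {X Y Z : E} (i : X ⟶ Y) (j : Y ⟶ Z), IsInflationOf conflation i →
    IsInflationOf conflation j → IsInflationOf conflation (i ≫ j)
  deflation_comp : ∀ {X Y Z : E} (p : X ⟶ Y) (q : Y ⟶ Z), IsDeflationOf conflation p →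
    IsDeflationOf conflation q → IsDeflationOf conflation (p ≫ q)
  exists_pushout : ∀ {X Y X' : E} (i : X ⟶ Y) (f : X ⟶ X'), IsInflationOf conflation i →
    ∃ (Y' : E) (f' : Y ⟶ Y') (i' : X' ⟶ Y'), IsPushout i f f' i' ∧ IsInflationOf conflation i'
  exists_pullback : ∀ {Y Z Z' : E} (p : Y ⟶ Z) (f : Z' ⟶ Z), IsDeflationOf conflation p →
    ∃ (Y' : E) (f' : Y' ⟶ Y) (p' : Y' ⟶ Z'), IsPullback f' p' p f ∧ IsDeflationOf conflation p'

namespace ExactStructure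

variable [HasFiniteBiproducts E] (𝓢 : ExactStructure E)

def IsInflation {X Y : E} (i : X ⟶ Y) : Prop := IsInflationOf 𝓢.conflation i

def IsDeflation {Y Z : E} (p : Y ⟶ Z) : Prop := IsDeflationOf 𝓢.conflation p

/-- The projective objects of the exact category. -/
def IsProj (P : E) : Prop :=
  ∀ ⦃Y Z : E⦄ (p : Y ⟶ Z), 𝓢.IsDeflation p → ∀ f : P ⟶ Z, ∃ g : P ⟶ Y, g ≫ p = f

/-- The injective objects of the exact category. -/
def IsInj (I : E) : Prop :=
  ∀ ⦃X Y : E⦄ (i : X ⟶ Y), 𝓢.IsInflation i → ∀ f : X ⟶ I, ∃ g : Y ⟶ I, i ≫ g = f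

end ExactStructure

variable (E) in
/-- A Frobenius exact structure: an exact structure with enough projectives and enough injectives
in which the projective and the injective objects coincide. -/
structure FrobeniusStructure [HasFiniteBiproducts E] extends ExactStructure E where
  enough_proj : ∀ X : E, ∃ (P : E) (p : P ⟶ X), toExactStructure.IsProj P ∧
    toExactStructure.IsDeflation p
  enough_inj : ∀ X : E, ∃ (I : E) (i : X ⟶ I), toExactStructure.IsInj I ∧
    toExactStructure.IsInflation i
  proj_iff_inj : ∀ X : E, toExactStructure.IsProj X ↔ toExactStructure.IsInj X

/-! ## The stable category of a Frobenius exact category, with its suspension -/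

namespace FrobeniusStructure

variable [HasFiniteBiproducts E] (𝓕 : FrobeniusStructure E)

/-- The morphisms of the ideal by which the stable category is formed: those that factor through
a projective object. -/
def Negligible {X Y : E} (f : X ⟶ Y) : Prop :=
  ∃ (P : E) (a : X ⟶ P) (b : P ⟶ Y), 𝓕.IsProj P ∧ a ≫ b = f

/-- Two parallel morphisms are identified when their difference factors through a projective. -/
def stableRel : HomRel E := fun _ _ f g => 𝓕.Negligible (f - g)

lemma isProj_biprod [HasBinaryBiproducts E] {P Q : E} (hP : 𝓕.IsProj P) (hQ : 𝓕.IsProj Q) :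
    𝓕.IsProj (P ⊞ Q) := by
  intro Y Z p hp f
  obtain ⟨g, hg⟩ := hP p hp (biprod.inl ≫ f)
  obtain ⟨h, hh⟩ := hQ p hp (biprod.inr ≫ f)
  exact ⟨biprod.desc g h, by ext <;> simp [hg, hh]⟩

lemma negligible_add {X Y : E} {f g : X ⟶ Y} (hf : 𝓕.Negligible f) (hg : 𝓕.Negligible g) :
    𝓕.Negligible (f + g) := by
  obtain ⟨P, a, b, hP, rfl⟩ := hf
  obtain ⟨Q, c, d, hQ, rfl⟩ := hg
  have : HasBinaryBiproducts E := hasBinaryBiproducts_of_finite_biproducts E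
  exact ⟨P ⊞ Q, biprod.lift a c, biprod.desc b d, 𝓕.isProj_biprod hP hQ, by simp⟩

lemma negligible_neg {X Y : E} {f : X ⟶ Y} (hf : 𝓕.Negligible f) : 𝓕.Negligible (-f) := by
  obtain ⟨P, a, b, hP, rfl⟩ := hf
  exact ⟨P, -a, b, hP, by simp⟩

lemma negligible_zero (X Y : E) : 𝓕.Negligible (0 : X ⟶ Y) := by
  obtain ⟨P, p, hP, -⟩ := 𝓕.enough_proj Y
  exact ⟨P, 0, p, hP, by simp⟩

lemma negligible_smul {k : Type w} [Semiring k] [Linear k E] (a : k) {X Y : E} {f : X ⟶ Y}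
    (hf : 𝓕.Negligible f) : 𝓕.Negligible (a • f) := by
  obtain ⟨P, c, d, hP, rfl⟩ := hf
  exact ⟨P, a • c, d, hP, by simp⟩

instance : Congruence 𝓕.stableRel where
  equivalence :=
    { refl := fun f => by simpa [stableRel] using 𝓕.negligible_zero _ _
      symm := fun {f g} h => by simpa [stableRel] using 𝓕.negligible_neg h
      trans := fun {f g h} h₁ h₂ => by simpa [stableRel] using 𝓕.negligible_add h₁ h₂ }
  comp_left := by
    intro X Y Z f g g' h
    obtain ⟨P, a, b, hP, hab⟩ := h
    exact ⟨P, f ≫ a, b, hP, by simp [hab]⟩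
  comp_right := by
    intro X Y Z f f' g h
    obtain ⟨P, a, b, hP, hab⟩ := h
    exact ⟨P, a, b ≫ g, hP, by rw [← Category.assoc, hab, Preadditive.sub_comp]⟩

/-- The stable category: the additive quotient of `E` by the projective objects. -/
abbrev Stable : Type u := CategoryTheory.Quotient 𝓕.stableRel

lemma stableRel_add ⦃X Y : E⦄ (f₁ f₂ g₁ g₂ : X ⟶ Y) (hf : 𝓕.stableRel f₁ f₂)
    (hg : 𝓕.stableRel g₁ g₂) : 𝓕.stableRel (f₁ + g₁) (f₂ + g₂) := by
  have := 𝓕.negligible_add hf hg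
  rwa [← add_sub_add_comm] at this

instance : Preadditive 𝓕.Stable := CategoryTheory.Quotient.preadditive _ 𝓕.stableRel_add

instance : (CategoryTheory.Quotient.functor 𝓕.stableRel).Additive :=
  CategoryTheory.Quotient.functor_additive _ 𝓕.stableRel_add

instance (k : Type w) [Semiring k] [Linear k E] : Linear k 𝓕.Stable :=
  CategoryTheory.Quotient.linear k 𝓕.stableRel (fun a _ _ _ _ h => by
    have := 𝓕.negligible_smul a h
    rwa [smul_sub] at this)

/-- The injective object `I X` in a chosen conflation `X ↣ I X ↠ Σ X`. -/
def hull (X : E) : E := (𝓕.enough_inj X).choose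

def toHull (X : E) : X ⟶ 𝓕.hull X := (𝓕.enough_inj X).choose_spec.choose

lemma isInj_hull (X : E) : 𝓕.IsInj (𝓕.hull X) := (𝓕.enough_inj X).choose_spec.choose_spec.1

lemma isInflation_toHull (X : E) : 𝓕.IsInflation (𝓕.toHull X) :=
  (𝓕.enough_inj X).choose_spec.choose_spec.2

/-- The cosyzygy `Σ X` in a chosen conflation `X ↣ I X ↠ Σ X`. -/
def cosyzygy (X : E) : E := (𝓕.isInflation_toHull X).choose

def toCosyzygy (X : E) : 𝓕.hull X ⟶ 𝓕.cosyzygy X := (𝓕.isInflation_toHull X).choose_spec.choose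

lemma toHull_toCosyzygy (X : E) : 𝓕.toHull X ≫ 𝓕.toCosyzygy X = 0 :=
  (𝓕.isInflation_toHull X).choose_spec.choose_spec.choose

lemma conflation_cosyzygy (X : E) :
    𝓕.conflation (ShortComplex.mk (𝓕.toHull X) (𝓕.toCosyzygy X) (𝓕.toHull_toCosyzygy X)) :=
  (𝓕.isInflation_toHull X).choose_spec.choose_spec.choose_spec

lemma toCosyzygy_desc {X Y : E} (f : 𝓕.hull X ⟶ Y) (hf : 𝓕.toHull X ≫ f = 0) :
    ∃ g : 𝓕.cosyzygy X ⟶ Y, 𝓕.toCosyzygy X ≫ g = f := by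
  obtain ⟨hc⟩ := 𝓕.isCokernel (𝓕.conflation_cosyzygy X)
  exact ⟨hc.desc (CokernelCofork.ofπ f hf), hc.fac _ WalkingParallelPair.one⟩

lemma toCosyzygy_cancel {X Y : E} {f g : 𝓕.cosyzygy X ⟶ Y}
    (h : 𝓕.toCosyzygy X ≫ f = 𝓕.toCosyzygy X ≫ g) : f = g := by
  obtain ⟨hc⟩ := 𝓕.isCokernel (𝓕.conflation_cosyzygy X)
  exact Cofork.IsColimit.hom_ext hc h

/-- `g : Σ X ⟶ Σ Y` is induced by `f : X ⟶ Y`, through some map `I X ⟶ I Y`. -/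
def IsCosyzygyMap {X Y : E} (f : X ⟶ Y) (g : 𝓕.cosyzygy X ⟶ 𝓕.cosyzygy Y) : Prop :=
  ∃ e : 𝓕.hull X ⟶ 𝓕.hull Y, 𝓕.toHull X ≫ e = f ≫ 𝓕.toHull Y ∧
    𝓕.toCosyzygy X ≫ g = e ≫ 𝓕.toCosyzygy Y

lemma exists_isCosyzygyMap {X Y : E} (f : X ⟶ Y) : ∃ g, 𝓕.IsCosyzygyMap f g := by
  obtain ⟨e, he⟩ := 𝓕.isInj_hull Y _ (𝓕.isInflation_toHull X) (f ≫ 𝓕.toHull Y)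
  obtain ⟨g, hg⟩ := 𝓕.toCosyzygy_desc (e ≫ 𝓕.toCosyzygy Y)
    (by rw [← Category.assoc, he, Category.assoc, toHull_toCosyzygy, comp_zero])
  exact ⟨g, e, he, hg⟩

lemma IsCosyzygyMap.negligible {X Y : E} {f : X ⟶ Y} {g : 𝓕.cosyzygy X ⟶ 𝓕.cosyzygy Y}
    (h : 𝓕.IsCosyzygyMap f g) (hf : 𝓕.Negligible f) : 𝓕.Negligible g := by
  obtain ⟨e, he, hg⟩ := h
  obtain ⟨P, a, b, hP, rfl⟩ := hf
  obtain ⟨a', ha'⟩ := (𝓕.proj_iff_inj P).1 hP _ (𝓕.isInflation_toHull X) a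
  obtain ⟨c, hc⟩ := 𝓕.toCosyzygy_desc (e - a' ≫ b ≫ 𝓕.toHull Y) (by
    rw [Preadditive.comp_sub, he, ← ha']; simp)
  refine ⟨𝓕.hull Y, c, 𝓕.toCosyzygy Y, (𝓕.proj_iff_inj _).2 (𝓕.isInj_hull Y), ?_⟩
  apply 𝓕.toCosyzygy_cancel
  rw [← Category.assoc, hc, hg]
  simp [toHull_toCosyzygy]

lemma IsCosyzygyMap.sub {X Y : E} {f f' : X ⟶ Y} {g g' : 𝓕.cosyzygy X ⟶ 𝓕.cosyzygy Y}
    (h : 𝓕.IsCosyzygyMap f g) (h' : 𝓕.IsCosyzygyMap f' g') :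
    𝓕.IsCosyzygyMap (f - f') (g - g') := by
  obtain ⟨e, he, hg⟩ := h
  obtain ⟨e', he', hg'⟩ := h'
  exact ⟨e - e', by simp [he, he'], by simp [hg, hg']⟩

lemma IsCosyzygyMap.comp {X Y Z : E} {f : X ⟶ Y} {f' : Y ⟶ Z} {g : 𝓕.cosyzygy X ⟶ 𝓕.cosyzygy Y}
    {g' : 𝓕.cosyzygy Y ⟶ 𝓕.cosyzygy Z} (h : 𝓕.IsCosyzygyMap f g) (h' : 𝓕.IsCosyzygyMap f' g') :
    𝓕.IsCosyzygyMap (f ≫ f') (g ≫ g') := by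
  obtain ⟨e, he, hg⟩ := h
  obtain ⟨e', he', hg'⟩ := h'
  exact ⟨e ≫ e', by simp [reassoc_of% he, he'], by simp [reassoc_of% hg, hg']⟩

lemma isCosyzygyMap_id (X : E) : 𝓕.IsCosyzygyMap (𝟙 X) (𝟙 _) := ⟨𝟙 _, by simp, by simp⟩

/-- A chosen map `Σ X ⟶ Σ Y` induced by `f : X ⟶ Y`. -/
def cosyzygyMap {X Y : E} (f : X ⟶ Y) : 𝓕.cosyzygy X ⟶ 𝓕.cosyzygy Y :=
  (𝓕.exists_isCosyzygyMap f).choose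

lemma isCosyzygyMap_cosyzygyMap {X Y : E} (f : X ⟶ Y) :
    𝓕.IsCosyzygyMap f (𝓕.cosyzygyMap f) := (𝓕.exists_isCosyzygyMap f).choose_spec

lemma IsCosyzygyMap.stableRel {X Y : E} {f f' : X ⟶ Y} {g g' : 𝓕.cosyzygy X ⟶ 𝓕.cosyzygy Y}
    (h : 𝓕.IsCosyzygyMap f g) (h' : 𝓕.IsCosyzygyMap f' g') (hf : 𝓕.stableRel f f') :
    𝓕.stableRel g g' :=
  IsCosyzygyMap.negligible 𝓕 (IsCosyzygyMap.sub 𝓕 h h') hf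

lemma stableRel_refl {X Y : E} (f : X ⟶ Y) : 𝓕.stableRel f f :=
  by simpa [FrobeniusStructure.stableRel] using 𝓕.negligible_zero X Y

/-- The suspension of the stable category: the cosyzygy functor `X ↦ Σ X`. -/
def suspension : 𝓕.Stable ⥤ 𝓕.Stable :=
  CategoryTheory.Quotient.lift 𝓕.stableRel
    { obj := fun X => (CategoryTheory.Quotient.functor 𝓕.stableRel).obj (𝓕.cosyzygy X)
      map := fun f => (CategoryTheory.Quotient.functor 𝓕.stableRel).map (𝓕.cosyzygyMap f)
      map_id := fun X => by
        rw [← (CategoryTheory.Quotient.functor 𝓕.stableRel).map_id]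
        exact CategoryTheory.Quotient.sound _ (IsCosyzygyMap.stableRel 𝓕 (𝓕.isCosyzygyMap_cosyzygyMap _)
          (𝓕.isCosyzygyMap_id X) (𝓕.stableRel_refl _))
      map_comp := fun f g => by
        rw [← (CategoryTheory.Quotient.functor 𝓕.stableRel).map_comp]
        exact CategoryTheory.Quotient.sound _ (IsCosyzygyMap.stableRel 𝓕 (𝓕.isCosyzygyMap_cosyzygyMap _)
          (IsCosyzygyMap.comp 𝓕 (𝓕.isCosyzygyMap_cosyzygyMap f) (𝓕.isCosyzygyMap_cosyzygyMap g))
          (𝓕.stableRel_refl _)) }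
    (fun _ _ _ _ h => CategoryTheory.Quotient.sound _ (IsCosyzygyMap.stableRel 𝓕
      (𝓕.isCosyzygyMap_cosyzygyMap _) (𝓕.isCosyzygyMap_cosyzygyMap _) h))

end FrobeniusStructure

end Exact

/-! ## Radical and quiver of an additive category -/

section KrullSchmidt

variable (C : Type u) [Category.{v} C] [Preadditive C]

variable {C} in
/-- `f` lies in the radical `rad(X, Y)` of the category. -/
def IsRadicalHom {X Y : C} (f : X ⟶ Y) : Prop := ∀ g : Y ⟶ X, IsIso (𝟙 X - f ≫ g)

variable {C} in
/-- `f` lies in `rad²(X, Y)`. -/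
def IsRadicalSqHom {X Y : C} (f : X ⟶ Y) : Prop :=
  ∃ (Z : C) (g : X ⟶ Z) (h : Z ⟶ Y), IsRadicalHom g ∧ IsRadicalHom h ∧ g ≫ h = f

/-- The indecomposable objects: nonzero and not a direct sum of two nonzero objects. -/
def isIndecomposable : ObjectProperty C := fun X =>
  ¬ IsZero X ∧ ∀ ⦃Y Z : C⦄ (b : BinaryBicone Y Z), b.IsBilimit → (b.pt ≅ X) → IsZero Y ∨ IsZero Z

/-- Isomorphism classes of indecomposable objects. -/
abbrev IndecClass : Type u :=
  _root_.Quotient (isIsomorphicSetoid (isIndecomposable C).FullSubcategory)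

/-- The quiver (without multiple arrows) of `C`: its vertices are the isomorphism classes of
indecomposable objects, and there is an arrow `[X] → [Y]` iff `rad(X, Y) / rad²(X, Y) ≠ 0`. When `C`
is triangulated with a Serre functor, this is the quiver underlying the Auslander-Reiten quiver
(which carries in addition the multiplicities of the arrows and the translation on the vertices). -/
def categoryQuiver : Digraph (IndecClass C) where
  Adj x y := ∃ X Y : (isIndecomposable C).FullSubcategory, ⟦X⟧ = x ∧ ⟦Y⟧ = y ∧
    ∃ f : X.obj ⟶ Y.obj, IsRadicalHom f ∧ ¬ IsRadicalSqHom f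

end KrullSchmidt

def Digraph.NoLoops {V : Type u} (Q : Digraph V) : Prop := ∀ x, ¬ Q.Adj x x

def Digraph.NoTwoCycles {V : Type u} (Q : Digraph V) : Prop := ∀ x y, ¬ (Q.Adj x y ∧ Q.Adj y x)

/-! ## Calabi-Yau property and cluster-tilting -/

section ClusterTilting

variable {C : Type u} [Category.{v} C] [Preadditive C]

/-- `S` is a Serre functor: an auto-equivalence with `k`-linear isomorphisms
`Hom(X, Y) ≅ D Hom(Y, S X)` natural in `X` and `Y`, where `D` is the `k`-dual. -/
def IsSerreFunctor (k : Type w) [Field k] [Linear k C] (S : C ⥤ C) : Prop :=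
  S.IsEquivalence ∧ ∃ η : ∀ X Y : C, (X ⟶ Y) ≃ₗ[k] Module.Dual k (Y ⟶ S.obj X),
    (∀ (X Y Y' : C) (f : X ⟶ Y) (g : Y ⟶ Y') (h : Y' ⟶ S.obj X),
      η X Y' (f ≫ g) h = η X Y f (g ≫ h)) ∧
    (∀ (X' X Y : C) (e : X' ⟶ X) (f : X ⟶ Y) (h : Y ⟶ S.obj X'),
      η X' Y (e ≫ f) h = η X Y f (h ≫ S.map e))

/-- A category with suspension `T` is 2-Calabi-Yau if `T²` is a Serre functor. -/
def IsTwoCalabiYau (k : Type w) [Field k] [Linear k C] (T : C ⥤ C) : Prop :=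
  IsSerreFunctor k (T ⋙ T)

/-- `X` has a right `𝒯`-approximation and a left `𝒯`-approximation, for every `X`. -/
def IsFunctoriallyFinite (𝒯 : ObjectProperty C) : Prop :=
  (∀ X : C, ∃ (M : C) (f : M ⟶ X), 𝒯 M ∧ ∀ (N : C) (h : N ⟶ X), 𝒯 N → ∃ g : N ⟶ M, g ≫ f = h) ∧
  (∀ X : C, ∃ (M : C) (f : X ⟶ M), 𝒯 M ∧ ∀ (N : C) (h : X ⟶ N), 𝒯 N → ∃ g : M ⟶ N, f ≫ g = h)

/-- `𝒯` is a cluster-tilting (full) subcategory of the 2-Calabi-Yau category `C` with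
suspension `T`. -/
structure IsClusterTiltingSubcategory (T : C ⥤ C) (𝒯 : ObjectProperty C) : Prop where
  rigid : ∀ ⦃X Y : C⦄, 𝒯 X → 𝒯 Y → ∀ f : X ⟶ T.obj Y, f = 0
  maximal : ∀ X : C, (∀ Y : C, 𝒯 Y → ∀ f : Y ⟶ T.obj X, f = 0) → 𝒯 X
  functoriallyFinite : IsFunctoriallyFinite 𝒯

/-- `add M`: the direct summands of finite direct sums of copies of `M`. -/
def addClosure (M : C) : ObjectProperty C := fun X =>
  ∃ (n : ℕ) (b : Bicone (fun _ : Fin n => M)), Nonempty b.IsBilimit ∧ Nonempty (Retract X b.pt)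

/-- `M` is a cluster-tilting object of the 2-Calabi-Yau category `C` with suspension `T`. -/
structure IsClusterTiltingObject (T : C ⥤ C) (M : C) : Prop where
  rigid : ∀ f : M ⟶ T.obj M, f = 0
  maximal : ∀ X : C, (∀ f : M ⟶ T.obj X, f = 0) → addClosure M X

/-- The quiver of a full subcategory. -/
abbrev subcategoryQuiver (𝒯 : ObjectProperty C) : Digraph (IndecClass 𝒯.FullSubcategory) :=
  categoryQuiver 𝒯.FullSubcategory

/-- The quiver of an object `M`: the quiver of the category `add M`. Its vertices are the
isomorphism classes of indecomposable direct summands of `M`. -/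
abbrev objectQuiver (M : C) : Digraph (IndecClass (addClosure M).FullSubcategory) :=
  subcategoryQuiver (addClosure M)

end ClusterTilting

/-! ## Gorenstein rings and Gorenstein projective modules -/

section Gorenstein

/-- A (not necessarily commutative) Gorenstein ring, also called Iwanaga-Gorenstein: two-sided
noetherian and of finite injective dimension as a left and as a right module over itself. -/
structure IsGorensteinRing (R : Type u) [Ring R] : Prop where
  noetherian_left : IsNoetherianRing R
  noetherian_right : IsNoetherianRing Rᵐᵒᵖ
  injdim_left : ∃ n : ℕ, HasInjectiveDimensionLE (ModuleCat.of R R) n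
  injdim_right : ∃ n : ℕ, HasInjectiveDimensionLE (ModuleCat.of Rᵐᵒᵖ Rᵐᵒᵖ) n

/-- Finitely generated modules `M` with `Ext^i(M, R) = 0` for all `i > 0`. -/
def isGorensteinProjective (R : Type u) [Ring R] : ObjectProperty (ModuleCat.{u} R) := fun M =>
  Module.Finite R M ∧ ∀ i : ℕ, 0 < i → Subsingleton (Abelian.Ext M (ModuleCat.of R R) i)

/-- The category of Gorenstein projective modules. -/
abbrev GP (R : Type u) [Ring R] : Type (u + 1) := (isGorensteinProjective R).FullSubcategory

variable {R : Type u} [Ring R]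

lemma isGorensteinProjective_zero : isGorensteinProjective R (ModuleCat.of R PUnit) :=
  ⟨inferInstance, fun i _ => ⟨fun a b => by
    have h : (𝟙 (ModuleCat.of R PUnit.{u + 1})) = 0 := by ext x
    rw [← Abelian.Ext.mk₀_id_comp a, ← Abelian.Ext.mk₀_id_comp b, h]; simp⟩⟩

lemma isGorensteinProjective_biprod {M N : ModuleCat.{u} R} (hM : isGorensteinProjective R M)
    (hN : isGorensteinProjective R N) : isGorensteinProjective R (M ⊞ N) := by
  refine ⟨?_, fun i hi => ⟨fun a b => ?_⟩⟩
  · have := hM.1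
    have := hN.1
    exact Module.Finite.equiv (ModuleCat.biprodIsoProd M N).symm.toLinearEquiv
  · have := hM.2 i hi
    have := hN.2 i hi
    exact Abelian.Ext.biprod_ext (Subsingleton.elim _ _) (Subsingleton.elim _ _)

instance : HasZeroObject (GP R) :=
  ⟨⟨⟨_, isGorensteinProjective_zero⟩, by
    rw [IsZero.iff_id_eq_zero]
    ext x⟩⟩

instance : HasBinaryBiproducts (GP R) :=
  ⟨fun M N => HasBinaryBiproduct.mk
    { bicone :=
        { pt := ⟨M.obj ⊞ N.obj, isGorensteinProjective_biprod M.property N.property⟩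
          fst := ObjectProperty.homMk biprod.fst
          snd := ObjectProperty.homMk biprod.snd
          inl := ObjectProperty.homMk biprod.inl
          inr := ObjectProperty.homMk biprod.inr
          inl_fst := by ext1; simp
          inl_snd := by ext1; simp
          inr_fst := by ext1; simp
          inr_snd := by ext1; simp }
      isBilimit := isBinaryBilimitOfTotal _ (by ext1; exact biprod.total) }⟩

instance : HasFiniteBiproducts (GP R) :=
  have : HasTerminal (GP R) := inferInstance
  have : HasFiniteProducts (GP R) := hasFiniteProducts_of_has_binary_and_terminal
  HasFiniteBiproducts.of_hasFiniteProducts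

end Gorenstein

end

noncomputable section

/-! The argument follows the trace proof of the no-loop theorem. A trace on a class of objects is a
family of additive, cyclic functionals on endomorphism rings. It extends from a class `P` to objects
with a two-term presentation by `P`, as the alternating trace of a lift
(`ObjectTrace.exists_extension`). Since `R` is Gorenstein, every finitely generated module has a
finite resolution by Gorenstein projectives that stays exact under `Hom(G, -)` for `G` Gorenstein
projective, so a trace on `GP(R)` extends to all kernels `ker f^i` of a nilpotent `f : X ⟶ X`. As
`f` maps `ker f^(i+1)` into `ker f^i`, cyclicity equates the traces of `f` on consecutive kernels,
and the last one is zero. Hence traces on `GP(R)` kill nilpotents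
(`IsGorensteinRing.trace_eq_zero`). The same holds for a cluster-tilting subcategory, whose preimage
in `GP(R)` presents every Gorenstein projective in one step; and nilpotent stable endomorphisms lift
to nilpotent ones by Fitting's lemma.

Loops: if `f` is in the radical but not in its square, a functional on `End X` that kills the square
of the radical and has value `1` at `f` is cyclic. Decomposing objects into copies of `X` and a rest
extends it to a trace on the whole class, although `f` is nilpotent (`isRadicalSqIn_of_endo`).

Two-cycles: let `b : X ⟶ Y` and `a : Y ⟶ X` be outside the square of the radical, detected by
functionals `α` and `β`. One wants functionals on `End X` and `End Y` whose values on paths of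
length two are given by `α ⊗ β` and `β ⊗ α`. They are well defined if relations `w ≫ e = 0` on a
sink map `e : E ⟶ X` do not meet `α ⊗ β`. This is where the 2-Calabi-Yau property enters: the two
exchange triangles show that such a `w : X ⟶ E` factors as a radical map `X ⟶ B` with `B` in the
subcategory, followed by a map already killed by `e` (`IsSink.exists_radical_factor`). The resulting
trace is `1` on the nilpotent `b ≫ a` (`isRadicalSqIn_or_of_two_cycle`). -/

/-! ## Triangles in the stable category of a Frobenius category -/

/-- `A ⟶ B ⟶ D ⟶ S A` behaves like a distinguished triangle, as far as it is needed here. -/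
structure IsExactTriangle {C : Type u} [Category.{v} C] [Preadditive C] (S : C ⥤ C) {A B D : C}
    (j : A ⟶ B) (q : B ⟶ D) (δ : D ⟶ S.obj A) : Prop where
  comp_mid : j ≫ q = 0
  comp_right : q ≫ δ = 0
  comp_susp : δ ≫ S.map j = 0
  exact_mid : ∀ {W : C} (f : W ⟶ B), f ≫ q = 0 → ∃ g, g ≫ j = f
  exact_right : ∀ {W : C} (f : W ⟶ D), f ≫ δ = 0 → ∃ g, g ≫ q = f
  exact_susp : ∀ {W : C} (f : W ⟶ S.obj A), f ≫ S.map j = 0 → ∃ g, g ≫ δ = f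
  coexact_mid : ∀ {W : C} (f : B ⟶ W), j ≫ f = 0 → ∃ g, q ≫ g = f

section Exact

variable {E : Type u} [Category.{v} E] [Preadditive E] [HasFiniteBiproducts E]

namespace ExactStructure

variable (𝓢 : ExactStructure E) {A B C : E} {i : A ⟶ B} {p : B ⟶ C} {h : i ≫ p = 0}

lemma exists_lift (hc : 𝓢.conflation (ShortComplex.mk i p h)) {W : E} (f : W ⟶ B)
    (hf : f ≫ p = 0) : ∃ g : W ⟶ A, g ≫ i = f := by
  obtain ⟨hl⟩ := 𝓢.isKernel hc
  exact ⟨hl.lift (KernelFork.ofι f hf), hl.fac _ WalkingParallelPair.zero⟩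

lemma mono_of_conflation (hc : 𝓢.conflation (ShortComplex.mk i p h)) : Mono i := by
  obtain ⟨hl⟩ := 𝓢.isKernel hc
  exact ⟨fun _ _ e => Fork.IsLimit.hom_ext hl e⟩

lemma exists_desc (hc : 𝓢.conflation (ShortComplex.mk i p h)) {W : E} (f : B ⟶ W)
    (hf : i ≫ f = 0) : ∃ g : C ⟶ W, p ≫ g = f := by
  obtain ⟨hl⟩ := 𝓢.isCokernel hc
  exact ⟨hl.desc (CokernelCofork.ofπ f hf), hl.fac _ WalkingParallelPair.one⟩

lemma epi_of_conflation (hc : 𝓢.conflation (ShortComplex.mk i p h)) : Epi p := by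
  obtain ⟨hl⟩ := 𝓢.isCokernel hc
  exact ⟨fun _ _ e => Cofork.IsColimit.hom_ext hl e⟩

/-- Conflations can be pulled back, with the same kernel. -/
lemma exists_pullback_conflation (hc : 𝓢.conflation (ShortComplex.mk i p h)) {W : E}
    (f : W ⟶ C) : ∃ (W' : E) (i' : A ⟶ W') (p' : W' ⟶ W) (g : W' ⟶ B) (h' : i' ≫ p' = 0),
      𝓢.conflation (ShortComplex.mk i' p' h') ∧ i' ≫ g = i ∧ g ≫ p = p' ≫ f := by
  obtain ⟨W', g, p', hpb, A', i', h', hc'⟩ := 𝓢.exists_pullback p f ⟨A, i, h, hc⟩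
  obtain ⟨r, hr⟩ := 𝓢.exists_lift hc (i' ≫ g) (by
    rw [Category.assoc, hpb.w, ← Category.assoc, h', zero_comp])
  -- The pull-back comes with an unspecified kernel `A'`; the lift `s` of `t` is inverse to `r`,
  -- which allows `A'` to be replaced by `A`.
  let t : A ⟶ W' := hpb.lift i 0 (by simp [h])
  have ht : t ≫ g = i := hpb.lift_fst _ _ _
  have ht' : t ≫ p' = 0 := hpb.lift_snd _ _ _
  obtain ⟨s, hs⟩ := 𝓢.exists_lift hc' t ht'
  have := 𝓢.mono_of_conflation hc
  have := 𝓢.mono_of_conflation hc'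
  have hrt : r ≫ t = i' := by
    apply hpb.hom_ext
    · rw [Category.assoc, ht, hr]
    · rw [Category.assoc, ht', comp_zero, h']
  have hsr : s ≫ r = 𝟙 A := by
    rw [← cancel_mono i, Category.assoc, hr, ← Category.assoc, hs, ht, Category.id_comp]
  have hrs : r ≫ s = 𝟙 A' := by
    rw [← cancel_mono i', Category.assoc, hs, hrt, Category.id_comp]
  refine ⟨W', t, p', g, ht', ?_, ht, hpb.w⟩
  let e : A' ≅ A := ⟨r, s, hrs, hsr⟩
  exact 𝓢.conflation_of_iso (ShortComplex.isoMk (S₁ := ShortComplex.mk i' p' h')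
    (S₂ := ShortComplex.mk t p' ht') e (Iso.refl _) (Iso.refl _) (by simp [e, hrt])
    (by simp)) hc'

lemma isDeflation_of_iso {X Y : E} (f : X ⟶ Y) [IsIso f] : 𝓢.IsDeflation f := by
  obtain ⟨K, i, h, hc⟩ := 𝓢.deflation_id X
  have hi : i = 0 := by simpa using h
  subst hi
  exact ⟨K, 0, zero_comp, 𝓢.conflation_of_iso (ShortComplex.isoMk
    (S₁ := ShortComplex.mk 0 (𝟙 X) h) (S₂ := ShortComplex.mk 0 f zero_comp)
    (Iso.refl K) (Iso.refl X) (asIso f) (by simp) (by simp)) hc⟩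

lemma isDeflation_zero (X : E) {O : E} (hO : IsZero O) : 𝓢.IsDeflation (0 : X ⟶ O) := by
  obtain ⟨Z, p, h, hc⟩ := 𝓢.inflation_id X
  have hp : p = 0 := by simpa using h
  subst hp
  have := 𝓢.epi_of_conflation hc
  have hZ : IsZero Z := by
    rw [IsZero.iff_id_eq_zero, ← cancel_epi (0 : X ⟶ Z)]
    simp
  exact ⟨X, 𝟙 X, comp_zero, 𝓢.conflation_of_iso (ShortComplex.isoMk
    (S₁ := ShortComplex.mk (𝟙 X) 0 h) (S₂ := ShortComplex.mk (𝟙 X) 0 comp_zero)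
    (Iso.refl X) (Iso.refl X) (hZ.iso hO) (by simp) (by simp)) hc⟩

lemma isDeflation_of_isPullback {Y Z Z' Y' : E} {p : Y ⟶ Z} {f : Z' ⟶ Z} {f' : Y' ⟶ Y}
    {p' : Y' ⟶ Z'} (hpb : IsPullback f' p' p f) (hp : 𝓢.IsDeflation p) : 𝓢.IsDeflation p' := by
  obtain ⟨Y'', f'', p'', hpb', hp''⟩ := 𝓢.exists_pullback p f hp
  have : p' = (hpb.isoIsPullback _ _ hpb').hom ≫ p'' := by simp
  rw [this]
  exact 𝓢.deflation_comp _ _ (𝓢.isDeflation_of_iso _) hp''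

variable [HasZeroObject E] [HasBinaryBiproducts E]

lemma isDeflation_snd (X Y : E) : 𝓢.IsDeflation (biprod.snd : X ⊞ Y ⟶ Y) :=
  𝓢.isDeflation_of_isPullback (IsPullback.of_has_biproduct X Y) (𝓢.isDeflation_zero X (isZero_zero E))

/-- The map is `1 ⊕ p`, a pull-back of `p`, followed by a shear automorphism and a projection. It
serves to turn an approximation into a deflation by adding a projective cover term. -/
lemma isDeflation_desc {X Y Z : E} (f : X ⟶ Z) {p : Y ⟶ Z} (hp : 𝓢.IsDeflation p) :
    𝓢.IsDeflation (biprod.desc f p) := by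
  have h₁ : 𝓢.IsDeflation (biprod.map (𝟙 X) p) := by
    have hpb : IsPullback (biprod.snd : X ⊞ Y ⟶ Y) (biprod.map (𝟙 X) p) p biprod.snd := by
      refine ⟨⟨by simp⟩, ⟨PullbackCone.IsLimit.mk _
        (fun s => biprod.lift (s.snd ≫ biprod.fst) s.fst) ?_ ?_ ?_⟩⟩
      · intro s; simp
      · intro s
        ext
        · simp
        · simpa using s.condition
      · intro s m h₁ h₂
        ext
        · have := h₂ =≫ biprod.fst
          simpa using this
        · simpa using h₁
    exact 𝓢.isDeflation_of_isPullback hpb hp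
  let e : X ⊞ Z ⟶ X ⊞ Z := biprod.lift biprod.fst (biprod.desc f (𝟙 Z))
  let e' : X ⊞ Z ⟶ X ⊞ Z := biprod.lift biprod.fst (biprod.desc (-f) (𝟙 Z))
  have : IsIso e := ⟨e', by ext <;> simp [e, e'], by ext <;> simp [e, e']⟩
  have h₂ : biprod.desc f p = biprod.map (𝟙 X) p ≫ e ≫ biprod.snd := by ext <;> simp [e]
  rw [h₂]
  exact 𝓢.deflation_comp _ _ h₁ (𝓢.deflation_comp _ _ (𝓢.isDeflation_of_iso e)
    (𝓢.isDeflation_snd X Z))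

end ExactStructure

namespace FrobeniusStructure

variable (𝓕 : FrobeniusStructure E)

/-- The projection to the stable category. -/
abbrev toStable : E ⥤ 𝓕.Stable := CategoryTheory.Quotient.functor 𝓕.stableRel

lemma toStable_map_eq_iff {X Y : E} (f g : X ⟶ Y) :
    𝓕.toStable.map f = 𝓕.toStable.map g ↔ 𝓕.Negligible (f - g) :=
  CategoryTheory.Quotient.functor_map_eq_iff _ f g

lemma toStable_map_eq_zero_iff {X Y : E} (f : X ⟶ Y) :
    𝓕.toStable.map f = 0 ↔ 𝓕.Negligible f := by
  rw [← 𝓕.toStable.map_zero, toStable_map_eq_iff, sub_zero]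

lemma toStable_comp_eq_zero_iff {X Y Z : E} (f : X ⟶ Y) (g : Y ⟶ Z) :
    𝓕.toStable.map f ≫ 𝓕.toStable.map g = 0 ↔ 𝓕.Negligible (f ≫ g) := by
  rw [← Functor.map_comp, toStable_map_eq_zero_iff]

lemma toStable_comp_eq_iff {X Y Z : E} (f : X ⟶ Y) (g : Y ⟶ Z) (l : X ⟶ Z) :
    𝓕.toStable.map f ≫ 𝓕.toStable.map g = 𝓕.toStable.map l ↔ 𝓕.Negligible (f ≫ g - l) := by
  rw [← Functor.map_comp, toStable_map_eq_iff]

lemma Negligible.exists_lift {X Y Z : E} {f : X ⟶ Z} (hf : 𝓕.Negligible f) {p : Y ⟶ Z}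
    (hp : 𝓕.IsDeflation p) : ∃ g : X ⟶ Y, g ≫ p = f := by
  obtain ⟨P, a, b, hP, rfl⟩ := hf
  obtain ⟨g, rfl⟩ := hP p hp b
  exact ⟨a ≫ g, by simp⟩

/-- A lift along a deflation which exists stably exists. -/
lemma exists_lift_of_stable {X Y Z : E} (f : X ⟶ Z) {p : Y ⟶ Z} (hp : 𝓕.IsDeflation p)
    (g : 𝓕.toStable.obj X ⟶ 𝓕.toStable.obj Y) (hg : g ≫ 𝓕.toStable.map p = 𝓕.toStable.map f) :
    ∃ g' : X ⟶ Y, g' ≫ p = f := by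
  obtain ⟨g, rfl⟩ := 𝓕.toStable.map_surjective g
  rw [← Functor.map_comp, toStable_map_eq_iff] at hg
  obtain ⟨l, hl⟩ := Negligible.exists_lift 𝓕 hg hp
  exact ⟨g - l, by simp [hl]⟩

lemma isDeflation_toCosyzygy (X : E) : 𝓕.IsDeflation (𝓕.toCosyzygy X) :=
  ⟨_, _, _, 𝓕.conflation_cosyzygy X⟩

lemma negligible_of_factor_hull {X Y W : E} (a : X ⟶ 𝓕.hull W) (b : 𝓕.hull W ⟶ Y) :
    𝓕.Negligible (a ≫ b) :=
  ⟨_, a, b, (𝓕.proj_iff_inj _).2 (𝓕.isInj_hull W), rfl⟩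

lemma isCosyzygyMap_of_map_eq {X Y : E} (f : X ⟶ Y) : ∃ e : 𝓕.hull X ⟶ 𝓕.hull Y,
    𝓕.toHull X ≫ e = f ≫ 𝓕.toHull Y ∧
      𝓕.toCosyzygy X ≫ 𝓕.cosyzygyMap f = e ≫ 𝓕.toCosyzygy Y :=
  𝓕.isCosyzygyMap_cosyzygyMap f

lemma isCosyzygyMap_add {X Y : E} (f g : X ⟶ Y) :
    𝓕.toStable.map (𝓕.cosyzygyMap (f + g)) =
      𝓕.toStable.map (𝓕.cosyzygyMap f) + 𝓕.toStable.map (𝓕.cosyzygyMap g) := by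
  rw [← Functor.map_add]
  apply CategoryTheory.Quotient.sound
  refine IsCosyzygyMap.stableRel 𝓕 (𝓕.isCosyzygyMap_cosyzygyMap _) ?_ (𝓕.stableRel_refl _)
  obtain ⟨e, he, h⟩ := 𝓕.isCosyzygyMap_cosyzygyMap f
  obtain ⟨e', he', h'⟩ := 𝓕.isCosyzygyMap_cosyzygyMap g
  exact ⟨e + e', by simp [he, he'], by simp [h, h']⟩

instance : 𝓕.suspension.Additive where
  map_add {X Y f g} := by
    obtain ⟨f, rfl⟩ := 𝓕.toStable.map_surjective f
    obtain ⟨g, rfl⟩ := 𝓕.toStable.map_surjective g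
    exact 𝓕.isCosyzygyMap_add f g

variable {𝓕} {A B C : E} {i : A ⟶ B} {p : B ⟶ C} {h : i ≫ p = 0}

/-- A conflation, with a connecting map obtained by comparing it with `A ↣ I A ↠ Σ A`, is a
triangle of the stable category. -/
lemma isExactTriangle_of_conflation (hc : 𝓕.conflation (ShortComplex.mk i p h))
    {b : B ⟶ 𝓕.hull A} {c : C ⟶ 𝓕.cosyzygy A} (hb : i ≫ b = 𝓕.toHull A)
    (hbc : p ≫ c = b ≫ 𝓕.toCosyzygy A) :
    IsExactTriangle 𝓕.suspension (𝓕.toStable.map i) (𝓕.toStable.map p) (𝓕.toStable.map c) where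
  comp_mid := by rw [← Functor.map_comp, h, Functor.map_zero]
  comp_right := by
    refine (𝓕.toStable_comp_eq_zero_iff p c).2 ?_
    rw [hbc]
    exact 𝓕.negligible_of_factor_hull _ _
  comp_susp := by
    refine (𝓕.toStable_comp_eq_zero_iff c (𝓕.cosyzygyMap i)).2 ?_
    obtain ⟨e, he, h'⟩ := 𝓕.isCosyzygyMap_of_map_eq i
    obtain ⟨t, ht⟩ := 𝓕.exists_desc hc (b ≫ e - 𝓕.toHull B) (by
      rw [Preadditive.comp_sub, ← Category.assoc, hb, he, sub_self])
    have := 𝓕.epi_of_conflation hc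
    have : c ≫ 𝓕.cosyzygyMap i = t ≫ 𝓕.toCosyzygy B := by
      rw [← cancel_epi p, reassoc_of% hbc, h', reassoc_of% ht, Preadditive.sub_comp,
        toHull_toCosyzygy, sub_zero, Category.assoc]
    rw [this]
    exact 𝓕.negligible_of_factor_hull _ _
  exact_mid := by
    intro W f hf
    obtain ⟨f, rfl⟩ := 𝓕.toStable.map_surjective f
    rw [← Functor.map_comp, toStable_map_eq_zero_iff] at hf
    obtain ⟨P, a, d, hP, had⟩ := hf
    obtain ⟨l, rfl⟩ := hP p ⟨_, _, _, hc⟩ d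
    obtain ⟨g, hg⟩ := 𝓕.exists_lift hc (f - a ≫ l) (by
      rw [Preadditive.sub_comp, ← had, Category.assoc, sub_self])
    refine ⟨𝓕.toStable.map g, ?_⟩
    rw [← Functor.map_comp, toStable_map_eq_iff, hg, sub_sub_cancel_left]
    exact 𝓕.negligible_neg ⟨P, a, l, hP, rfl⟩
  exact_right := by
    intro W f hf
    obtain ⟨f, rfl⟩ := 𝓕.toStable.map_surjective f
    replace hf := (𝓕.toStable_comp_eq_zero_iff f c).1 hf
    obtain ⟨f', hf'⟩ := Negligible.exists_lift 𝓕 hf (𝓕.isDeflation_toCosyzygy A)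
    obtain ⟨W', i', p', g, h', hc', hg, hgp⟩ := 𝓕.exists_pullback_conflation hc f
    -- The pulled back conflation over `f` splits: `r` is a retraction of `i'`. The section `s` of
    -- `p'` then gives the lift `s ≫ g` of `f`.
    obtain ⟨r, hr⟩ := 𝓕.exists_lift (𝓕.conflation_cosyzygy A) (g ≫ b - p' ≫ f') (by
      rw [Preadditive.sub_comp, Category.assoc, Category.assoc, hf', ← hbc, reassoc_of% hgp,
        sub_self])
    have := 𝓕.mono_of_conflation (𝓕.conflation_cosyzygy A)
    have := 𝓕.epi_of_conflation hc'
    have hir : i' ≫ r = 𝟙 A := by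
      rw [← cancel_mono (𝓕.toHull A), Category.assoc, hr, Preadditive.comp_sub, reassoc_of% h',
        reassoc_of% hg, hb]
      simp
    obtain ⟨s, hs⟩ := 𝓕.exists_desc hc' (𝟙 W' - r ≫ i') (by
      rw [Preadditive.comp_sub, reassoc_of% hir]; simp)
    have hsp : s ≫ p' = 𝟙 W.as := by
      rw [← cancel_epi p', reassoc_of% hs]
      simp [h']
    refine ⟨𝓕.toStable.map (s ≫ g), ?_⟩
    rw [← Functor.map_comp, Category.assoc, hgp, reassoc_of% hsp]
  exact_susp := by
    intro W f hf
    obtain ⟨f, rfl⟩ :=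
      𝓕.toStable.map_surjective (X := W.as) (Y := 𝓕.cosyzygy A) f
    replace hf := (𝓕.toStable_comp_eq_zero_iff f (𝓕.cosyzygyMap i)).1 hf
    obtain ⟨t, ht⟩ := Negligible.exists_lift 𝓕 hf (𝓕.isDeflation_toCosyzygy B)
    obtain ⟨e, he, h'⟩ := 𝓕.isCosyzygyMap_of_map_eq i
    obtain ⟨V, a, v, y, hav, hcV, hay, hyv⟩ :=
      𝓕.exists_pullback_conflation (𝓕.conflation_cosyzygy A) f
    have := 𝓕.mono_of_conflation (𝓕.conflation_cosyzygy B)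
    have := 𝓕.epi_of_conflation hcV
    -- The map `l` extends `i` from `A` to the pull-back `V`, so it induces `g` on cokernels. Below,
    -- `m` shows that `g ≫ c` and `f` differ by a map through the injective hull of `A`.
    obtain ⟨l, hl⟩ := 𝓕.exists_lift (𝓕.conflation_cosyzygy B) (y ≫ e - v ≫ t) (by
      rw [Preadditive.sub_comp, Category.assoc, Category.assoc, ht, ← h', reassoc_of% hyv,
        sub_self])
    have hal : a ≫ l = i := by
      rw [← cancel_mono (𝓕.toHull B), Category.assoc, hl, Preadditive.comp_sub, reassoc_of% hay,
        reassoc_of% hav, he]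
      simp
    obtain ⟨g, hg⟩ := 𝓕.exists_desc hcV (l ≫ p) (by rw [reassoc_of% hal, h])
    obtain ⟨m, hm⟩ := 𝓕.exists_desc hcV (l ≫ b - y) (by
      rw [Preadditive.comp_sub, reassoc_of% hal, hb, hay, sub_self])
    refine ⟨𝓕.toStable.map g, ?_⟩
    refine (𝓕.toStable_comp_eq_iff g c f).2 ?_
    have : g ≫ c - f = m ≫ 𝓕.toCosyzygy A := by
      rw [← cancel_epi v, reassoc_of% hm, Preadditive.comp_sub, reassoc_of% hg, hbc,
        Preadditive.sub_comp, ← hyv, Category.assoc]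
    rw [this]
    exact 𝓕.negligible_of_factor_hull _ _
  coexact_mid := by
    intro W f hf
    obtain ⟨f, rfl⟩ := 𝓕.toStable.map_surjective f
    rw [← Functor.map_comp, toStable_map_eq_zero_iff] at hf
    obtain ⟨P, a, d, hP, had⟩ := hf
    obtain ⟨a', ha'⟩ := (𝓕.proj_iff_inj P).1 hP i ⟨_, _, _, hc⟩ a
    obtain ⟨g, hg⟩ := 𝓕.exists_desc hc (f - a' ≫ d) (by
      rw [Preadditive.comp_sub, reassoc_of% ha', had, sub_self])
    refine ⟨𝓕.toStable.map g, ?_⟩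
    rw [← Functor.map_comp, toStable_map_eq_iff, hg, sub_sub_cancel_left]
    exact 𝓕.negligible_neg ⟨P, a', d, hP, rfl⟩

lemma exists_connecting (hc : 𝓕.conflation (ShortComplex.mk i p h)) :
    ∃ c : C ⟶ 𝓕.cosyzygy A, IsExactTriangle 𝓕.suspension (𝓕.toStable.map i) (𝓕.toStable.map p)
      (𝓕.toStable.map c) := by
  obtain ⟨b, hb⟩ := 𝓕.isInj_hull A i ⟨_, _, _, hc⟩ (𝓕.toHull A)
  obtain ⟨c, hbc⟩ := 𝓕.exists_desc hc (b ≫ 𝓕.toCosyzygy A) (by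
    rw [reassoc_of% hb, toHull_toCosyzygy])
  exact ⟨c, isExactTriangle_of_conflation hc hb hbc⟩

variable (𝓕)

/-- Pulling back the chosen conflation on `A` along a representative of `δ` gives a conflation whose
connecting map is `δ`. -/
lemma exists_isExactTriangle {A D : 𝓕.Stable} (δ : D ⟶ 𝓕.suspension.obj A) :
    ∃ (B : 𝓕.Stable) (j : A ⟶ B) (q : B ⟶ D), IsExactTriangle 𝓕.suspension j q δ := by
  obtain ⟨c, rfl⟩ := (𝓕.toStable.map_surjective (X := D.as) (Y := 𝓕.cosyzygy A.as)) δ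
  obtain ⟨B, i, p, b, h, hc, hb, hbc⟩ :=
    𝓕.exists_pullback_conflation (𝓕.conflation_cosyzygy A.as) c
  exact ⟨_, _, _, isExactTriangle_of_conflation hc hb hbc.symm⟩

end FrobeniusStructure

end Exact

/-! ## Fitting idempotents in finite-dimensional algebras -/

section Fitting

-- Write the minimal polynomial of `a` as `X^m q` with `X ∤ q` and choose `r X^(m+1) + s q = 1`.
-- Then `e = r(a) a^(m+1)` is the projection onto the part where `a` is invertible, with `b = r(a)
-- a^m` as inverse there.
open Polynomial in
lemma exists_fitting_idempotent (k : Type w) [Field k] {A : Type v} [Ring A] [Algebra k A]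
    [FiniteDimensional k A] (a : A) : ∃ (e b : A) (n : ℕ), IsIdempotentElem e ∧ Commute a b ∧
    e = a * b ∧ a ^ (n + 1) * (1 - e) = 0 := by
  have hint : IsIntegral k a := Algebra.IsIntegral.isIntegral a
  have h0 := minpoly.ne_zero hint
  obtain ⟨q, hq, hq'⟩ := exists_eq_pow_rootMultiplicity_mul_and_not_dvd (minpoly k a) h0 0
  set m := rootMultiplicity 0 (minpoly k a)
  rw [C_0, sub_zero] at hq hq'
  have hcop : IsCoprime (X ^ (m + 1) : k[X]) q :=
    ((Polynomial.prime_X.coprime_iff_not_dvd).2 hq').pow_left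
  obtain ⟨r, s, hrs⟩ := hcop
  have hz : aeval a (X ^ m * q) = 0 := by rw [← hq, minpoly.aeval]
  have he : aeval a (r * X ^ (m + 1)) = a * aeval a (r * X ^ m) := by
    rw [show r * X ^ (m + 1) = X * (r * X ^ m) by ring, map_mul, aeval_X]
  have h1 : 1 - aeval a (r * X ^ (m + 1)) = aeval a (s * q) := by
    have := congrArg (aeval a) hrs
    rw [map_add, map_one] at this
    rw [← this, add_sub_cancel_left]
  refine ⟨aeval a (r * X ^ (m + 1)), aeval a (r * X ^ m), m, ?_, ?_, he, ?_⟩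
  · have : aeval a (r * X ^ (m + 1)) * (1 - aeval a (r * X ^ (m + 1))) = 0 := by
      rw [h1, ← map_mul, show r * X ^ (m + 1) * (s * q) = (r * X * s) * (X ^ m * q) by ring,
        map_mul, hz, mul_zero]
    rw [mul_sub, mul_one, sub_eq_zero] at this
    exact this.symm
  · have := Polynomial.commute_X (r * X ^ m)
    have := this.map (aeval a)
    rwa [aeval_X] at this
  · rw [h1, ← aeval_X (R := k) a, ← map_pow]
    simp only [aeval_X]
    rw [← map_mul, show X ^ (m + 1) * (s * q) = (X * s) * (X ^ m * q) by ring, map_mul, hz,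
        mul_zero]

/-- Idempotents lift along homomorphisms from finite-dimensional algebras. -/
lemma exists_idempotent_lift (k : Type w) [Field k] {A : Type v} [Ring A] [Algebra k A]
    [FiniteDimensional k A] {B : Type*} [Ring B] (π : A →+* B) (a : A) (ha : IsIdempotentElem (π a)) :
    ∃ e : A, IsIdempotentElem e ∧ π e = π a := by
  obtain ⟨e, b, n, he, hab, rfl, hn⟩ := exists_fitting_idempotent k a
  refine ⟨a * b, he, ?_⟩
  -- Powers of the idempotent `π a` are `π a` itself, so the relation reads `π a = π a * π (a * b)`,
  -- which is `π (a * b)`.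
  have h := congrArg π hn
  rw [map_mul, map_pow, ha.pow_succ_eq, map_sub, map_one, map_zero, mul_sub, mul_one, sub_eq_zero,
    map_mul, ← mul_assoc, ha.eq, ← map_mul] at h
  exact h.symm

/-- Nilpotent elements lift along homomorphisms from finite-dimensional algebras. -/
lemma exists_nilpotent_lift (k : Type w) [Field k] {A : Type v} [Ring A] [Algebra k A]
    [FiniteDimensional k A] {B : Type*} [Ring B] (π : A →+* B) (a : A) (ha : IsNilpotent (π a)) :
    ∃ a' : A, IsNilpotent a' ∧ π a' = π a := by
  obtain ⟨e, b, n, he, hab, rfl, hn⟩ := exists_fitting_idempotent k a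
  have hc : Commute a (1 - a * b) :=
    (Commute.one_right a).sub_right ((Commute.refl a).mul_right hab)
  refine ⟨a * (1 - a * b), ⟨n + 1, ?_⟩, ?_⟩
  · rw [hc.mul_pow, he.one_sub.pow_succ_eq, hn]
  · obtain ⟨m, hm⟩ := ha
    -- The idempotent `a * b` equals its own powers, and these contain a power of `a` that `π`
    -- kills.
    have : π (a * b) = 0 := by
      rw [← he.pow_succ_eq m, hab.mul_pow, map_mul, map_pow, pow_succ, hm, zero_mul, zero_mul]
    rw [map_mul, map_sub, this]
    simp

/-- A finite-dimensional algebra without nontrivial idempotents over an algebraically closed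
field is local with residue field `k`. -/
lemma exists_isNilpotent_sub_algebraMap (k : Type w) [Field k] {A : Type v} [Ring A] [Algebra k A]
    [FiniteDimensional k A] [IsAlgClosed k] [Nontrivial A]
    (hA : ∀ e : A, IsIdempotentElem e → e = 0 ∨ e = 1) (a : A) :
    ∃ c : k, IsNilpotent (a - algebraMap k A c) := by
  obtain ⟨c, hc⟩ := spectrum.nonempty_of_isAlgClosed_of_finiteDimensional k a
  refine ⟨c, ?_⟩
  obtain ⟨e, b, n, he, hab, rfl, hn⟩ := exists_fitting_idempotent k (a - algebraMap k A c)
  rcases hA _ he with h | h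
  · rw [h, sub_zero, mul_one] at hn
    exact ⟨_, hn⟩
  · refine absurd ?_ hc
    have : IsUnit (a - algebraMap k A c) := ⟨⟨_, b, h, hab.eq ▸ h⟩, rfl⟩
    rw [spectrum.mem_resolventSet_iff, ← neg_sub]
    exact this.neg

end Fitting

lemma Submodule.exists_functional {k : Type w} [Field k] {V : Type v} [AddCommGroup V] [Module k V]
    (S : Submodule k V) {x : V} (hx : x ∉ S) : ∃ φ : V →ₗ[k] k, φ x = 1 ∧ ∀ s ∈ S, φ s = 0 := by
  obtain ⟨φ, h₁, h₂⟩ := Submodule.exists_dual_map_eq_bot_of_notMem hx inferInstance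
  refine ⟨(φ x)⁻¹ • φ, by simp [h₁], fun s hs => ?_⟩
  have : φ s ∈ S.map φ := ⟨s, hs, rfl⟩
  rw [h₂, Submodule.mem_bot] at this
  simp [this]

/-! ## The radical -/

section Radical

variable {C : Type u} [Category.{v} C] [Preadditive C]

lemma isIso_one_sub_comp_swap {X Y : C} (f : X ⟶ Y) (g : Y ⟶ X) [IsIso (𝟙 X - f ≫ g)] :
    IsIso (𝟙 Y - g ≫ f) := by
  obtain ⟨r, h₁, h₂⟩ := (inferInstance : IsIso (𝟙 X - f ≫ g)).out
  simp only [Preadditive.sub_comp, Preadditive.comp_sub, Category.id_comp, Category.comp_id,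
    Category.assoc, sub_eq_iff_eq_add] at h₁ h₂
  -- The usual inverse: if `r = (1 - fg)⁻¹`, then `(1 - gf)⁻¹ = 1 + g r f`.
  refine ⟨𝟙 Y + g ≫ r ≫ f, ?_, ?_⟩
  · have h := g ≫= h₁ =≫ f
    simp only [Preadditive.add_comp, Preadditive.comp_add, Category.id_comp, Category.assoc] at h
    simp only [Preadditive.sub_comp, Preadditive.comp_add, Category.id_comp, Category.comp_id,
      Category.assoc]
    rw [← sub_eq_zero] at h ⊢
    rw [← h]
    abel
  · have h := g ≫= h₂ =≫ f
    simp only [Preadditive.add_comp, Preadditive.comp_add, Category.id_comp, Category.assoc] at h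
    simp only [Preadditive.add_comp, Preadditive.comp_sub, Category.id_comp, Category.comp_id,
      Category.assoc]
    rw [← sub_eq_zero] at h ⊢
    rw [← h]
    abel

namespace IsRadicalHom

variable {X Y Z : C}

lemma comp_right {f : X ⟶ Y} (hf : IsRadicalHom f) (g : Y ⟶ Z) : IsRadicalHom (f ≫ g) := by
  intro h
  have := hf (g ≫ h)
  rwa [Category.assoc]

lemma comp_left {g : Y ⟶ Z} (hg : IsRadicalHom g) (f : X ⟶ Y) : IsRadicalHom (f ≫ g) := by
  intro h
  have := hg (h ≫ f)
  have : IsIso (𝟙 Y - (g ≫ h) ≫ f) := by rwa [Category.assoc]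
  have := isIso_one_sub_comp_swap (g ≫ h) f
  rwa [Category.assoc]

lemma add {f g : X ⟶ Y} (hf : IsRadicalHom f) (hg : IsRadicalHom g) : IsRadicalHom (f + g) := by
  intro h
  have h1 := hf h
  obtain ⟨r, -, h₂⟩ := h1.out
  have h3 := hg (h ≫ r)
  have : 𝟙 X - (f + g) ≫ h = (𝟙 X - g ≫ h ≫ r) ≫ (𝟙 X - f ≫ h) := by
    rw [Preadditive.sub_comp, Category.assoc, Category.assoc, h₂, Preadditive.add_comp]
    simp only [Category.id_comp, Category.comp_id]
    abel
  rw [this]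
  infer_instance

lemma zero : IsRadicalHom (0 : X ⟶ Y) := by
  intro h
  rw [zero_comp, sub_zero]
  infer_instance

end IsRadicalHom

variable (k : Type w) [Field k] [Linear k C]

/-- The radical as a subspace. -/
def radicalSubmodule (X Y : C) : Submodule k (X ⟶ Y) where
  carrier := {f | IsRadicalHom f}
  add_mem' := IsRadicalHom.add
  zero_mem' := IsRadicalHom.zero
  smul_mem' c f hf := by
    have : c • f = f ≫ (c • 𝟙 Y) := by simp
    exact this ▸ IsRadicalHom.comp_right hf _

/-- A class of objects closed under sums and direct summands. -/
structure IsAdditiveClass [HasBinaryBiproducts C] (𝒯 : ObjectProperty C) : Prop where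
  biprod : ∀ {X Y : C}, 𝒯 X → 𝒯 Y → 𝒯 (X ⊞ Y)
  retract : ∀ {X Y : C} (i : X ⟶ Y) (p : Y ⟶ X), i ≫ p = 𝟙 X → 𝒯 Y → 𝒯 X

/-- `f` lies in the square of the radical of the full subcategory `𝒯`. -/
def IsRadicalSqIn (𝒯 : ObjectProperty C) {X Y : C} (f : X ⟶ Y) : Prop :=
  ∃ (Z : C) (g : X ⟶ Z) (h : Z ⟶ Y), 𝒯 Z ∧ IsRadicalHom g ∧ IsRadicalHom h ∧ g ≫ h = f

variable {𝒯 : ObjectProperty C}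

lemma IsRadicalSqIn.isRadicalHom {X Y : C} {f : X ⟶ Y} (hf : IsRadicalSqIn 𝒯 f) :
    IsRadicalHom f := by
  obtain ⟨Z, g, h, -, hg, -, rfl⟩ := hf
  exact hg.comp_right h

/-- The square of the radical as a subspace. -/
def radicalSqSubmodule [HasBinaryBiproducts C] (h𝒯 : IsAdditiveClass 𝒯) {X : C} (hX : 𝒯 X)
    (Y : C) : Submodule k (X ⟶ Y) where
  carrier := {f | IsRadicalSqIn 𝒯 f}
  add_mem' := by
    rintro _ _ ⟨Z, g, h, hZ, hg, hh, rfl⟩ ⟨Z', g', h', hZ', hg', hh', rfl⟩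
    refine ⟨Z ⊞ Z', biprod.lift g g', biprod.desc h h', h𝒯.biprod hZ hZ', ?_, ?_, by simp⟩
    · rw [biprod.lift_eq]
      exact (hg.comp_right _).add (hg'.comp_right _)
    · rw [biprod.desc_eq]
      exact (hh.comp_left _).add (hh'.comp_left _)
  zero_mem' := ⟨X, 0, 0, hX, .zero, .zero, by simp⟩
  smul_mem' := by
    rintro c _ ⟨Z, g, h, hZ, hg, hh, rfl⟩
    exact ⟨Z, g, c • h, hZ, hg, (radicalSubmodule k Z Y).smul_mem c hh, by simp⟩

/-! ## Local objects -/

/-- A nonzero object all of whose endomorphisms are scalars up to nilpotents. -/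
def IsLocalObject (X : C) : Prop :=
  ¬ IsZero X ∧ ∀ f : X ⟶ X, ∃ c : k, IsNilpotent (End.of (f - c • 𝟙 X))

variable {k}

namespace IsLocalObject

variable {X : C}

lemma id_ne_zero (hX : IsLocalObject k X) : 𝟙 X ≠ 0 := fun h =>
  hX.1 ((IsZero.iff_id_eq_zero X).2 h)

lemma isIso_or_isNilpotent (hX : IsLocalObject k X) (f : X ⟶ X) :
    IsIso f ∨ IsNilpotent (End.of f) := by
  obtain ⟨c, hc⟩ := hX.2 f
  by_cases h0 : c = 0
  · right
    simpa [h0] using hc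
  · left
    rw [← isUnit_iff_isIso]
    have h1 : IsUnit (End.of (c • 𝟙 X)) := by
      rw [isUnit_iff_isIso]
      exact ⟨c⁻¹ • 𝟙 X, by simp [smul_smul, h0], by simp [smul_smul, h0]⟩
    have h2 : Commute (End.of (f - c • 𝟙 X)) (End.of (c • 𝟙 X)) := by
      simp [Commute, SemiconjBy, End.mul_def]
    have := hc.isUnit_add_left_of_commute h1 h2
    rwa [show End.of (c • 𝟙 X) + End.of (f - c • 𝟙 X) = End.of f from
      add_sub_cancel (c • 𝟙 X) f] at this

lemma isIso_of_not_isIso_one_sub (hX : IsLocalObject k X) (f : X ⟶ X)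
    (hf : ¬ IsIso (𝟙 X - f)) : IsIso f := by
  have h := (hX.isIso_or_isNilpotent _).resolve_left hf
  have h1 := h.isUnit_one_sub
  rw [show (1 : End X) - End.of (𝟙 X - f) = f from sub_sub_cancel (𝟙 X) f] at h1
  exact (isUnit_iff_isIso f).1 h1

lemma exists_retraction (hX : IsLocalObject k X) {Q : C} (g : X ⟶ Q) (hg : ¬ IsRadicalHom g) :
    ∃ s : Q ⟶ X, g ≫ s = 𝟙 X := by
  rw [IsRadicalHom, not_forall] at hg
  obtain ⟨h, hh⟩ := hg
  have := hX.isIso_of_not_isIso_one_sub _ hh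
  exact ⟨h ≫ inv (g ≫ h), by rw [← Category.assoc, IsIso.hom_inv_id]⟩

lemma exists_section (hX : IsLocalObject k X) {Q : C} (g : Q ⟶ X) (hg : ¬ IsRadicalHom g) :
    ∃ s : X ⟶ Q, s ≫ g = 𝟙 X := by
  rw [IsRadicalHom, not_forall] at hg
  obtain ⟨h, hh⟩ := hg
  have hh' : ¬ IsIso (𝟙 X - h ≫ g) := fun _ => hh (isIso_one_sub_comp_swap h g)
  have := hX.isIso_of_not_isIso_one_sub _ hh'
  exact ⟨inv (h ≫ g) ≫ h, by rw [Category.assoc, IsIso.inv_hom_id]⟩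

lemma not_isRadicalHom_id (hX : IsLocalObject k X) : ¬ IsRadicalHom (𝟙 X) := by
  intro h
  have := h (𝟙 X)
  rw [Category.id_comp, sub_self] at this
  exact hX.id_ne_zero (by rw [← IsIso.hom_inv_id (0 : X ⟶ X), zero_comp])

lemma isRadicalHom_iff_isNilpotent (hX : IsLocalObject k X) (f : X ⟶ X) :
    IsRadicalHom f ↔ IsNilpotent (End.of f) := by
  have : Nontrivial (End X) := ⟨𝟙 X, 0, hX.id_ne_zero⟩
  constructor
  · intro h
    refine (hX.isIso_or_isNilpotent f).resolve_left fun hf => hX.not_isRadicalHom_id ?_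
    rw [← IsIso.hom_inv_id f]
    exact h.comp_right _
  · intro h
    by_contra hf
    obtain ⟨s, hs⟩ := hX.exists_retraction f hf
    obtain ⟨n, hn⟩ := h
    have : ∀ m : ℕ, End.of s ^ m * End.of f ^ m = 1 := by
      intro m
      induction m with
      | zero => simp
      | succ m ih =>
        have h1 : End.of s * End.of f = 1 := hs
        rw [pow_succ, pow_succ', mul_assoc, ← mul_assoc (End.of s), h1, one_mul, ih]
    have := this n
    rw [hn, mul_zero] at this
    exact zero_ne_one this

lemma exists_isRadicalHom_sub (hX : IsLocalObject k X) (f : X ⟶ X) :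
    ∃ c : k, IsRadicalHom (f - c • 𝟙 X) := by
  obtain ⟨c, hc⟩ := hX.2 f
  exact ⟨c, (hX.isRadicalHom_iff_isNilpotent _).2 hc⟩

lemma eq_zero_of_isRadicalHom_smul (hX : IsLocalObject k X) {c : k}
    (h : IsRadicalHom (c • 𝟙 X)) : c = 0 := by
  by_contra hc
  apply hX.not_isRadicalHom_id
  have := (radicalSubmodule k X X).smul_mem c⁻¹ h
  rwa [smul_smul, inv_mul_cancel₀ hc, one_smul] at this

/-- Between an object and a local object without non-radical maps one way there are none the
other way. -/
lemma isRadicalHom_from (hX : IsLocalObject k X) {Q : C} (h : ∀ f : X ⟶ Q, IsRadicalHom f)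
    (g : Q ⟶ X) : IsRadicalHom g := by
  by_contra hg
  obtain ⟨s, hs⟩ := hX.exists_section g hg
  exact hX.not_isRadicalHom_id (hs ▸ (h s).comp_right g)

/-- Splitting off a local summand makes the endomorphism ring smaller. -/
lemma exists_complement [IsIdempotentComplete C] [∀ X Y : C, FiniteDimensional k (X ⟶ Y)]
    (hX : IsLocalObject k X) {Q : C} (a : X ⟶ Q) (b : Q ⟶ X) (hab : a ≫ b = 𝟙 X) :
    ∃ (Y : C) (i : Y ⟶ Q) (p : Q ⟶ Y), i ≫ p = 𝟙 Y ∧ b ≫ a + p ≫ i = 𝟙 Q ∧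
      Module.finrank k (Y ⟶ Y) < Module.finrank k (Q ⟶ Q) := by
  obtain ⟨Y, i, p, h₁, h₂⟩ := IsIdempotentComplete.idempotents_split Q (𝟙 Q - b ≫ a) (by
    simp [reassoc_of% hab])
  refine ⟨Y, i, p, h₁, by rw [h₂]; abel, ?_⟩
  have hap : a ≫ p = 0 := by
    have : a ≫ p ≫ i ≫ p = 0 := by
      rw [reassoc_of% h₂]
      simp [reassoc_of% hab]
    rwa [h₁, Category.comp_id] at this
  let φ : (Y ⟶ Y) →ₗ[k] (Q ⟶ Q) :=
    Linear.leftComp k Q p ∘ₗ Linear.rightComp k Y i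
  have hφ : ∀ f, φ f = p ≫ f ≫ i := fun f => rfl
  have hinj : Function.Injective φ := by
    intro f g h
    rw [hφ, hφ] at h
    have := i ≫= h =≫ p
    simpa [reassoc_of% h₁, h₁] using this
  -- With equal dimensions the identity of `Q` would factor through `p`, but `a ≫ p = 0` while `a`
  -- is a nonzero split mono.
  refine lt_of_le_of_ne (LinearMap.finrank_le_finrank_of_injective hinj) fun h => ?_
  obtain ⟨f, hf⟩ := (LinearMap.injective_iff_surjective_of_finrank_eq_finrank h).1 hinj (𝟙 Q)
  rw [hφ] at hf
  apply hX.id_ne_zero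
  rw [← hab, ← Category.comp_id a, ← hf, reassoc_of% hap]
  simp

end IsLocalObject

/-- An indecomposable object of an idempotent complete Hom-finite category is local. -/
lemma isLocalObject_of_idempotents [IsAlgClosed k] {X : C} [FiniteDimensional k (X ⟶ X)]
    (h0 : ¬ IsZero X) (hX : ∀ e : X ⟶ X, e ≫ e = e → e = 0 ∨ e = 𝟙 X) : IsLocalObject k X := by
  refine ⟨h0, fun f => ?_⟩
  have : Nontrivial (End X) := ⟨𝟙 X, 0, fun h => h0 ((IsZero.iff_id_eq_zero X).2 h)⟩
  have : FiniteDimensional k (End X) := ‹FiniteDimensional k (X ⟶ X)›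
  obtain ⟨c, hc⟩ := exists_isNilpotent_sub_algebraMap k (A := End X) (fun e he => hX e he) f
  exact ⟨c, by rwa [Algebra.algebraMap_eq_smul_one] at hc⟩

lemma isIndecomposable_idempotent [IsIdempotentComplete C] {X : C} (hX : isIndecomposable C X)
    (e : X ⟶ X) (he : e ≫ e = e) : e = 0 ∨ e = 𝟙 X := by
  obtain ⟨Y, i, p, h₁, h₂⟩ := IsIdempotentComplete.idempotents_split X e he
  obtain ⟨Z, j, q, h₃, h₄⟩ := IsIdempotentComplete.idempotents_split X (𝟙 X - e)
    (Idempotents.idem_of_id_sub_idem e he)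
  have hiq : i ≫ q = 0 := by
    have : i ≫ p ≫ i ≫ q ≫ j ≫ q = 0 := by
      rw [reassoc_of% h₂, reassoc_of% h₄]
      simp [reassoc_of% he]
    rwa [reassoc_of% h₁, h₃, Category.comp_id] at this
  have hjp : j ≫ p = 0 := by
    have : j ≫ q ≫ j ≫ p ≫ i ≫ p = 0 := by
      rw [reassoc_of% h₂, reassoc_of% h₄]
      simp [reassoc_of% he]
    rwa [reassoc_of% h₃, h₁, Category.comp_id] at this
  let b : BinaryBicone Y Z := ⟨X, p, q, i, j, h₁, hiq, hjp, h₃⟩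
  rcases hX.2 b (isBinaryBilimitOfTotal b (by simp [b, h₂, h₄])) (Iso.refl X) with h | h
  · left
    rw [← h₂, h.eq_zero_of_tgt p, zero_comp]
  · right
    have := h₄
    rw [h.eq_zero_of_tgt q, zero_comp] at this
    exact (sub_eq_zero.1 this.symm).symm

end Radical

/-! ## Traces -/

section Traces

variable {C : Type u} [Category.{v} C] [Preadditive C]

/-- A trace on a class of objects, with values in an abelian group. -/
structure ObjectTrace (P : ObjectProperty C) (A : Type w) [AddCommGroup A] where
  tr : ∀ X : C, P X → (X ⟶ X) → A
  map_add : ∀ (X : C) (hX : P X) (f g : X ⟶ X), tr X hX (f + g) = tr X hX f + tr X hX g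
  comm : ∀ (X Y : C) (hX : P X) (hY : P Y) (f : X ⟶ Y) (g : Y ⟶ X),
    tr X hX (f ≫ g) = tr Y hY (g ≫ f)

namespace ObjectTrace

variable {P : ObjectProperty C} {A : Type w} [AddCommGroup A] (t : ObjectTrace P A)

lemma map_zero (X : C) (hX : P X) : t.tr X hX 0 = 0 := by
  simpa using t.map_add X hX 0 0

lemma map_sub (X : C) (hX : P X) (f g : X ⟶ X) :
    t.tr X hX (f - g) = t.tr X hX f - t.tr X hX g := by
  rw [eq_sub_iff_add_eq, ← t.map_add, sub_add_cancel]

/-- The inverse image of a trace under an additive functor. -/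
def comap {D : Type*} [Category* D] [Preadditive D] (F : D ⥤ C) [F.Additive] :
    ObjectTrace (P.inverseImage F) A where
  tr X hX f := t.tr (F.obj X) hX (F.map f)
  map_add X hX f g := by rw [F.map_add]; exact t.map_add _ hX _ _
  comm X Y hX hY f g := by rw [F.map_comp, F.map_comp]; exact t.comm _ _ hX hY _ _

end ObjectTrace

/-! ### Extension of traces to objects with a short resolution -/

/-- A relatively exact presentation `K ⟶ T ⟶ M` of `M` with `P K` and `Q T`. -/
structure Presentation (Q P : ObjectProperty C) (M : C) where
  K : C
  T : C
  i : K ⟶ T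
  p : T ⟶ M
  hK : P K
  hT : Q T
  zero : i ≫ p = 0
  mono : Mono i
  exact : ∀ {W : C} (f : W ⟶ T), f ≫ p = 0 → ∃ g, g ≫ i = f
  lift : ∀ {T' : C} (_ : Q T') (f : T' ⟶ M), ∃ g, g ≫ p = f

/-- The objects with a relatively exact presentation. -/
def isPresented (Q P : ObjectProperty C) : ObjectProperty C := fun M => Nonempty (Presentation Q P M)

namespace Presentation

variable {Q P : ObjectProperty C} {L M N : C}

/-- `(f₀, f₁)` is a map of presentations over `f`. -/
structure IsLift (X : Presentation Q P M) (Y : Presentation Q P N) (f : M ⟶ N)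
    (f₀ : X.T ⟶ Y.T) (f₁ : X.K ⟶ Y.K) : Prop where
  mid : f₀ ≫ Y.p = X.p ≫ f
  left : f₁ ≫ Y.i = X.i ≫ f₀

lemma exists_isLift (X : Presentation Q P M) (Y : Presentation Q P N) (f : M ⟶ N) :
    ∃ f₀ f₁, IsLift X Y f f₀ f₁ := by
  obtain ⟨f₀, h₀⟩ := Y.lift X.hT (X.p ≫ f)
  obtain ⟨f₁, h₁⟩ := Y.exact (X.i ≫ f₀) (by rw [Category.assoc, h₀, reassoc_of% X.zero, zero_comp])
  exact ⟨f₀, f₁, h₀, h₁⟩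

lemma IsLift.comp {X : Presentation Q P L} {Y : Presentation Q P M} {Z : Presentation Q P N}
    {f : L ⟶ M} {g : M ⟶ N} {f₀ f₁ g₀ g₁} (hf : IsLift X Y f f₀ f₁) (hg : IsLift Y Z g g₀ g₁) :
    IsLift X Z (f ≫ g) (f₀ ≫ g₀) (f₁ ≫ g₁) :=
  ⟨by rw [Category.assoc, hg.mid, reassoc_of% hf.mid],
    by rw [Category.assoc, hg.left, reassoc_of% hf.left]⟩

lemma IsLift.add {X : Presentation Q P M} {Y : Presentation Q P N} {f g : M ⟶ N} {f₀ f₁ g₀ g₁}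
    (hf : IsLift X Y f f₀ f₁) (hg : IsLift X Y g g₀ g₁) :
    IsLift X Y (f + g) (f₀ + g₀) (f₁ + g₁) :=
  ⟨by simp [hf.mid, hg.mid], by simp [hf.left, hg.left]⟩

variable {A : Type w} [AddCommGroup A] (hQP : Q ≤ P) (t : ObjectTrace P A)

/-- Two lifts of `f` differ by a homotopy `s : T ⟶ K`; the differences are `s ≫ i` and `i ≫ s`,
which have equal traces. -/
lemma IsLift.tr_eq {X : Presentation Q P M} {f : M ⟶ M} {f₀ f₁ g₀ g₁}
    (hf : IsLift X X f f₀ f₁) (hg : IsLift X X f g₀ g₁) :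
    t.tr X.T (hQP _ X.hT) f₀ - t.tr X.K X.hK f₁ =
      t.tr X.T (hQP _ X.hT) g₀ - t.tr X.K X.hK g₁ := by
  obtain ⟨s, hs⟩ := X.exact (f₀ - g₀) (by rw [Preadditive.sub_comp, hf.mid, hg.mid, sub_self])
  have := X.mono
  have hs' : X.i ≫ s = f₁ - g₁ := by
    rw [← cancel_mono X.i, Category.assoc, hs, Preadditive.sub_comp, Preadditive.comp_sub,
      hf.left, hg.left]
  have h := t.comm _ _ (hQP _ X.hT) X.hK s X.i
  rw [hs, hs', t.map_sub, t.map_sub] at h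
  rw [sub_eq_sub_iff_sub_eq_sub, h]

variable (X : Presentation Q P M)

/-- The trace of an endomorphism, computed on a presentation. -/
def tr (f : M ⟶ M) : A :=
  t.tr X.T (hQP _ X.hT) (X.exists_isLift X f).choose -
    t.tr X.K X.hK (X.exists_isLift X f).choose_spec.choose

lemma tr_eq {f : M ⟶ M} {f₀ f₁} (hf : IsLift X X f f₀ f₁) :
    X.tr hQP t f = t.tr X.T (hQP _ X.hT) f₀ - t.tr X.K X.hK f₁ :=
  IsLift.tr_eq hQP t (X.exists_isLift X f).choose_spec.choose_spec hf

end Presentation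

/-- The extended trace is the trace on `T` minus the trace on `K`. Cyclicity is inherited because
lifts compose. On an object of `Q` the presentation splits, and the lift below is zero on `K`. -/
lemma ObjectTrace.exists_extension {Q P : ObjectProperty C} (hQP : Q ≤ P) {A : Type w}
    [AddCommGroup A] (t : ObjectTrace P A) : ∃ t' : ObjectTrace (isPresented Q P) A,
      ∀ (M : C) (hM : isPresented Q P M) (hQ : Q M) (f : M ⟶ M),
        t'.tr M hM f = t.tr M (hQP _ hQ) f := by
  refine ⟨⟨fun M hM f => hM.some.tr hQP t f, ?_, ?_⟩, ?_⟩
  · intro M hM f g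
    obtain ⟨f₀, f₁, hf⟩ := hM.some.exists_isLift hM.some f
    obtain ⟨g₀, g₁, hg⟩ := hM.some.exists_isLift hM.some g
    rw [Presentation.tr_eq hQP t _ hf, Presentation.tr_eq hQP t _ hg,
      Presentation.tr_eq hQP t _ (hf.add hg), t.map_add, t.map_add, add_sub_add_comm]
  · intro M N hM hN f g
    obtain ⟨f₀, f₁, hf⟩ := hM.some.exists_isLift hN.some f
    obtain ⟨g₀, g₁, hg⟩ := hN.some.exists_isLift hM.some g
    rw [Presentation.tr_eq hQP t _ (hf.comp hg), Presentation.tr_eq hQP t _ (hg.comp hf),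
      t.comm _ _ (hQP _ hM.some.hT) (hQP _ hN.some.hT), t.comm _ _ hM.some.hK hN.some.hK]
  · intro M hM hQ f
    obtain ⟨s, hs⟩ := hM.some.lift hQ (𝟙 M)
    have hf : Presentation.IsLift hM.some hM.some f (hM.some.p ≫ f ≫ s) 0 :=
      ⟨by simp [hs], by simp [reassoc_of% hM.some.zero]⟩
    refine (Presentation.tr_eq hQP t _ hf).trans ?_
    rw [t.map_zero, sub_zero, t.comm _ _ (hQP _ hM.some.hT) (hQP _ hQ), Category.assoc, hs, Category.comp_id]

/-! ### Traces from local data -/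

/-- A decomposition of the identity of `Q` into maps through the objects `G a` and one map through
an object in the class `null`. -/
structure Frame (null : ObjectProperty C) {ι : Type} (G : ι → C) (Q : C) where
  n : ℕ
  idx : Fin n → ι
  u : ∀ j, G (idx j) ⟶ Q
  v : ∀ j, Q ⟶ G (idx j)
  W : C
  hW : null W
  p : Q ⟶ W
  i : W ⟶ Q
  eq : ∑ j, v j ≫ u j + p ≫ i = 𝟙 Q

section Frame

variable {null : ObjectProperty C} {ι : Type} {G : ι → C} {A : Type w} [AddCommGroup A]

lemma Frame.map_comp_eq {Q X Y : C} (F : Frame null G Q) (μ : (X ⟶ Y) →+ A) (f : X ⟶ Q)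
    (g : Q ⟶ Y) (h : μ ((f ≫ F.p) ≫ F.i ≫ g) = 0) :
    μ (f ≫ g) = ∑ j, μ ((f ≫ F.v j) ≫ F.u j ≫ g) := by
  have : f ≫ g = f ≫ (∑ j, F.v j ≫ F.u j + F.p ≫ F.i) ≫ g := by
    rw [F.eq, Category.id_comp]
  rw [this, Preadditive.add_comp, Preadditive.comp_add, Preadditive.sum_comp, Preadditive.comp_sum,
    map_add, map_sum]
  simp only [Category.assoc] at h ⊢
  rw [h, add_zero]

/-- Local traces on the objects `G a` which vanish on maps through null objects extend to all
objects with a frame. -/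
lemma exists_trace_of_frames {P : ObjectProperty C} (hF : ∀ Q, P Q → Nonempty (Frame null G Q))
    (μ : ∀ a, (G a ⟶ G a) →+ A)
    (hμ : ∀ a b (f : G a ⟶ G b) (g : G b ⟶ G a), μ a (f ≫ g) = μ b (g ≫ f))
    (hnull : ∀ a W, null W → ∀ (f : G a ⟶ W) (g : W ⟶ G a), μ a (f ≫ g) = 0) :
    ∃ t : ObjectTrace P A, ∀ a (ha : P (G a)) (f : G a ⟶ G a), t.tr _ ha f = μ a f := by
  -- The trace of `f` is the sum of the traces of its diagonal entries in a frame. Inserting another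
  -- frame in the middle gives a double sum, the null term being invisible to `μ`.
  refine ⟨⟨fun Q hQ f => ∑ j, μ _ ((hF Q hQ).some.u j ≫ f ≫ (hF Q hQ).some.v j), ?_, ?_⟩, ?_⟩
  · intro Q hQ f g
    simp only [Preadditive.add_comp, Preadditive.comp_add, map_add, Finset.sum_add_distrib]
  · intro Q Q' hQ hQ' f g
    have key : ∀ {Q Q' : C} (F : Frame null G Q) (F' : Frame null G Q') (f : Q ⟶ Q') (g : Q' ⟶ Q)
        (j), μ _ (F.u j ≫ (f ≫ g) ≫ F.v j) =
          ∑ j', μ _ ((F.u j ≫ f ≫ F'.v j') ≫ F'.u j' ≫ g ≫ F.v j) := by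
      intro Q Q' F F' f g j
      have := F'.map_comp_eq (μ (F.idx j)) (F.u j ≫ f) (g ≫ F.v j) (hnull _ _ F'.hW _ _)
      simpa only [Category.assoc] using this
    simp only [key (hF Q hQ).some (hF Q' hQ').some, key (hF Q' hQ').some (hF Q hQ).some]
    rw [Finset.sum_comm]
    refine Finset.sum_congr rfl fun _ _ => Finset.sum_congr rfl fun _ _ => hμ _ _ _ _
  · intro a ha f
    change ∑ j, μ _ ((hF _ ha).some.u j ≫ f ≫ (hF _ ha).some.v j) = μ a f
    have := (hF _ ha).some.map_comp_eq (μ a) f (𝟙 _) (hnull _ _ (hF _ ha).some.hW _ _)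
    rw [Category.comp_id] at this
    rw [this]
    refine Finset.sum_congr rfl fun j _ => ?_
    rw [Category.comp_id, hμ]

end Frame

variable (k : Type w) [Field k] [Linear k C] [HasBinaryBiproducts C] [IsIdempotentComplete C]
  [∀ X Y : C, FiniteDimensional k (X ⟶ Y)]

/-- The objects of `𝒯` receiving only radical maps from the objects `G a`. -/
def isFreeOf (𝒯 : ObjectProperty C) {ι : Type} (G : ι → C) : ObjectProperty C := fun W =>
  𝒯 W ∧ ∀ a (f : G a ⟶ W), IsRadicalHom f

variable {𝒯 : ObjectProperty C} {k}

/-- Copies of the objects `G a` are split off as long as some non-radical map `G a ⟶ Q` exists; the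
dimension of the endomorphism ring drops each time. -/
lemma exists_frame (h𝒯 : IsAdditiveClass 𝒯) {ι : Type} {G : ι → C}
    (hG : ∀ a, IsLocalObject k (G a)) (Q : C) (hQ : 𝒯 Q) :
    Nonempty (Frame (isFreeOf 𝒯 G) G Q) := by
  induction hn : Module.finrank k (Q ⟶ Q) using Nat.strong_induction_on generalizing Q with
  | _ n ih =>
  subst hn
  by_cases hfree : ∀ a (f : G a ⟶ Q), IsRadicalHom f
  · exact ⟨⟨0, Fin.elim0, fun j => j.elim0, fun j => j.elim0, Q, ⟨hQ, hfree⟩, 𝟙 Q, 𝟙 Q, by simp⟩⟩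
  · push Not at hfree
    obtain ⟨a, f, hf⟩ := hfree
    obtain ⟨s, hs⟩ := (hG a).exists_retraction f hf
    obtain ⟨Y, i, p, h₁, h₂, hlt⟩ := (hG a).exists_complement f s hs
    obtain ⟨F⟩ := ih _ hlt Y (h𝒯.retract i p h₁ hQ) rfl
    refine ⟨⟨F.n + 1, Fin.cons a F.idx, Fin.cons f fun j => F.u j ≫ i,
      Fin.cons s fun j => p ≫ F.v j, F.W, F.hW, p ≫ F.p, F.i ≫ i, ?_⟩⟩
    rw [Fin.sum_univ_succ]
    have : p ≫ (∑ j, F.v j ≫ F.u j + F.p ≫ F.i) ≫ i = p ≫ i := by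
      rw [F.eq, Category.id_comp]
    rw [Preadditive.add_comp, Preadditive.comp_add, Preadditive.sum_comp,
      Preadditive.comp_sum] at this
    simp only [Category.assoc] at this
    rw [← h₂, ← this]
    rw [add_assoc]
    exact congrArg (s ≫ f + ·) (congrArg₂ (· + ·)
      (Finset.sum_congr rfl fun j _ => Category.assoc p (F.v j) (F.u j ≫ i))
      (Category.assoc p F.p (F.i ≫ i)))

end Traces

/-! ### Vanishing of traces on nilpotent endomorphisms and the absence of loops -/

/-- All traces on the class `𝒯` with values in `k` vanish on nilpotent endomorphisms. -/
def TracesKillNilpotents (k : Type w) [Field k] {C : Type u} [Category.{v} C] [Preadditive C]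
    (𝒯 : ObjectProperty C) : Prop :=
  ∀ (t : ObjectTrace 𝒯 k) (X : C) (hX : 𝒯 X) (f : X ⟶ X), IsNilpotent (End.of f) → t.tr X hX f = 0

section NoLoops

variable {k : Type w} [Field k] {C : Type u} [Category.{v} C] [Preadditive C] [Linear k C]
  [HasBinaryBiproducts C] [IsIdempotentComplete C] [∀ X Y : C, FiniteDimensional k (X ⟶ Y)]
  {𝒯 : ObjectProperty C}

/-- If traces on `𝒯` kill nilpotent endomorphisms, then the quiver of `𝒯` has no loops. -/
theorem isRadicalSqIn_of_endo (h𝒯 : IsAdditiveClass 𝒯) (hk : TracesKillNilpotents k 𝒯) {X : C}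
    (hX : 𝒯 X) (hX' : IsLocalObject k X) (f : X ⟶ X) (hf : IsRadicalHom f) :
    IsRadicalSqIn 𝒯 f := by
  by_contra hsq
  let S := radicalSqSubmodule k h𝒯 hX X
  have hS : f ∉ S ⊔ k ∙ 𝟙 X := by
    intro h
    obtain ⟨s, hs, y, hy, hsy⟩ := Submodule.mem_sup.1 h
    obtain ⟨c, rfl⟩ := Submodule.mem_span_singleton.1 hy
    have hs' : IsRadicalSqIn 𝒯 s := hs
    have : IsRadicalHom (c • 𝟙 X) := by
      rw [show c • 𝟙 X = f - s by rw [← hsy, add_sub_cancel_left]]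
      exact (radicalSubmodule k X X).sub_mem hf hs'.isRadicalHom
    have hc := hX'.eq_zero_of_isRadicalHom_smul this
    apply hsq
    rw [← hsy, hc, zero_smul, add_zero]
    exact hs'
  obtain ⟨φ, hφ₁, hφ₀⟩ := Submodule.exists_functional _ hS
  have hφsq : ∀ g : X ⟶ X, IsRadicalSqIn 𝒯 g → φ g = 0 := fun g hg =>
    hφ₀ g (Submodule.mem_sup_left hg)
  obtain ⟨t, ht⟩ := exists_trace_of_frames (P := 𝒯) (A := k) (G := fun _ : Unit => X)
    (exists_frame (k := k) h𝒯 fun _ => hX') (fun _ => φ.toAddMonoidHom) (by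
      rintro ⟨⟩ ⟨⟩ g h
      -- Modulo the radical `g` and `h` are scalars, hence `g ≫ h` and `h ≫ g` agree up to the
      -- square of the radical.
      obtain ⟨c, hc⟩ := hX'.exists_isRadicalHom_sub g
      obtain ⟨d, hd⟩ := hX'.exists_isRadicalHom_sub h
      have h₁ := hφsq _ ⟨X, _, _, hX, hc, hd, rfl⟩
      have h₂ := hφsq _ ⟨X, _, _, hX, hd, hc, rfl⟩
      simp only [Preadditive.sub_comp, Preadditive.comp_sub, Linear.smul_comp, Linear.comp_smul,
        Category.id_comp, Category.comp_id, map_sub, map_smul, smul_eq_mul] at h₁ h₂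
      change φ (g ≫ h) = φ (h ≫ g)
      linear_combination h₁ - h₂) (by
      rintro ⟨⟩ W ⟨hW, hW'⟩ g h
      exact hφsq _ ⟨W, g, h, hW, hW' () g, hX'.isRadicalHom_from (hW' ()) h, rfl⟩)
  have := hk t X hX f ((hX'.isRadicalHom_iff_isNilpotent f).1 hf)
  rw [ht ()] at this
  exact one_ne_zero (hφ₁.symm.trans this)

end NoLoops

/-! ## Two-cycles in the quiver of a cluster-tilting subcategory -/

section TwoCalabiYau

variable {C : Type u} [Category.{v} C]

lemma CategoryTheory.Functor.isEquivalence_of_isEquivalence_comp_self (S : C ⥤ C)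
    [(S ⋙ S).IsEquivalence] : S.IsEquivalence := by
  have hf : S.Faithful := Functor.Faithful.of_comp S S
  exact
    { faithful := hf
      full := ⟨fun {X Y} g => by
        obtain ⟨f, hf'⟩ := (S ⋙ S).map_surjective (S.map g)
        exact ⟨f, S.map_injective hf'⟩⟩
      essSurj := ⟨fun Y => ⟨S.obj ((S ⋙ S).objPreimage Y), ⟨(S ⋙ S).objObjPreimageIso Y⟩⟩⟩ }

variable [Preadditive C]

/-- The trace forms of a Serre functor `S ⋙ S`. -/
structure SerreTrace (k : Type w) [Field k] [Linear k C] (S : C ⥤ C) where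
  τ : ∀ X : C, (X ⟶ S.obj (S.obj X)) →ₗ[k] k
  cyc : ∀ {X Y : C} (e : X ⟶ Y) (h : Y ⟶ S.obj (S.obj X)),
    τ X (e ≫ h) = τ Y (h ≫ S.map (S.map e))
  eq_zero_left : ∀ {X Y : C} (f : X ⟶ Y), (∀ h : Y ⟶ S.obj (S.obj X), τ X (f ≫ h) = 0) → f = 0
  eq_zero_right : ∀ {X Y : C} (h : Y ⟶ S.obj (S.obj X)), (∀ f : X ⟶ Y, τ X (f ≫ h) = 0) → h = 0
  exists_repr : ∀ {X Y : C} (φ : (X ⟶ Y) →ₗ[k] k), ∃ h : Y ⟶ S.obj (S.obj X), ∀ f, τ X (f ≫ h) = φ f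

/-- Naturality reduces the duality isomorphisms to the single functionals `η X X (𝟙 X)`, and becomes
cyclicity. Nondegeneracy and representability on the other side use finite dimension. -/
lemma IsTwoCalabiYau.exists_serreTrace {k : Type w} [Field k] [Linear k C]
    [∀ X Y : C, FiniteDimensional k (X ⟶ Y)] {S : C ⥤ C} (h : IsTwoCalabiYau k S) :
    Nonempty (SerreTrace k S) := by
  obtain ⟨-, η, h₁, h₂⟩ := h
  have key : ∀ (X Y : C) (f : X ⟶ Y) (h : Y ⟶ S.obj (S.obj X)),
      η X Y f h = η X X (𝟙 X) (f ≫ h) := by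
    intro X Y f h
    have := h₁ X X Y (𝟙 X) f h
    rwa [Category.id_comp] at this
  refine ⟨⟨fun X => η X X (𝟙 X), ?_, ?_, ?_, ?_⟩⟩
  · intro X Y e h
    have := h₂ X Y Y e (𝟙 Y) h
    rw [Category.comp_id] at this
    exact (key X Y e h).symm.trans this
  · intro X Y f hf
    apply (η X Y).injective
    rw [map_zero]
    ext h
    exact (key X Y f h).trans (hf h)
  · intro X Y h hh
    by_contra h0
    obtain ⟨φ, hφ⟩ := Module.Projective.exists_dual_ne_zero k h0
    obtain ⟨f, rfl⟩ := (η X Y).surjective φ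
    exact hφ ((key X Y f h).trans (hh f))
  · intro X Y φ
    obtain ⟨h, hh⟩ := (Module.evalEquiv k (Y ⟶ S.obj (S.obj X))).surjective
      (φ ∘ₗ (η X Y).symm.toLinearMap)
    refine ⟨h, fun f => ?_⟩
    have := LinearMap.congr_fun hh (η X Y f)
    simp only [Module.evalEquiv_apply, Module.Dual.eval_apply, LinearMap.comp_apply,
      LinearEquiv.coe_coe, LinearEquiv.symm_apply_apply] at this
    exact (key X Y f h).symm.trans this

lemma IsClusterTiltingSubcategory.isAdditiveClass [HasBinaryBiproducts C] {S : C ⥤ C} [S.Additive]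
    {𝒯 : ObjectProperty C} (h : IsClusterTiltingSubcategory S 𝒯) : IsAdditiveClass 𝒯 where
  biprod {X Y} hX hY := by
    refine h.maximal _ fun T hT f => ?_
    have h₁ := h.rigid hT hX (f ≫ S.map biprod.fst)
    have h₂ := h.rigid hT hY (f ≫ S.map biprod.snd)
    rw [← Category.comp_id f, ← S.map_id, ← biprod.total, S.map_add, S.map_comp, S.map_comp,
      Preadditive.comp_add, reassoc_of% h₁, reassoc_of% h₂]
    simp
  retract {X Y} i p hip hY := by
    refine h.maximal _ fun T hT f => ?_
    have h₁ := h.rigid hT hY (f ≫ S.map i)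
    rw [← Category.comp_id f, ← S.map_id, ← hip, S.map_comp, reassoc_of% h₁, zero_comp]

/-! ### Sink maps -/

/-- `e` is right almost split in `𝒯` (not necessarily minimal). -/
structure IsSink (𝒯 : ObjectProperty C) {E X : C} (e : E ⟶ X) : Prop where
  mem : 𝒯 E
  isRadicalHom : IsRadicalHom e
  exists_factor : ∀ {T : C} (t : T ⟶ X), 𝒯 T → IsRadicalHom t → ∃ s, s ≫ e = t

variable {k : Type w} [Field k] [Linear k C] {S : C ⥤ C} {𝒯 : ObjectProperty C} {X : C}

/-- A functional on `End X` that kills the radical but not the identity is represented by a map `h :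
X ⟶ S (S X)`. The triangle on `h` is an Auslander-Reiten triangle, ending in a right almost split
map `m : M ⟶ X`; composing with a right approximation of `M` moves it into `𝒯`. -/
lemma SerreTrace.exists_sink (τ : SerreTrace k S)
    (htri : ∀ {A D : C} (δ : D ⟶ S.obj A), ∃ (B : C) (j : A ⟶ B) (q : B ⟶ D),
      IsExactTriangle S j q δ)
    (happ : ∀ X : C, ∃ (M : C) (f : M ⟶ X), 𝒯 M ∧ ∀ (N : C) (h : N ⟶ X), 𝒯 N → ∃ g, g ≫ f = h)
    (hX : IsLocalObject k X) : ∃ (E : C) (e : E ⟶ X), IsSink 𝒯 e := by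
  obtain ⟨ρ, hρ₁, hρ₀⟩ := Submodule.exists_functional (radicalSubmodule k X X)
    (x := 𝟙 X) hX.not_isRadicalHom_id
  obtain ⟨h, hh⟩ := τ.exists_repr ρ
  obtain ⟨M, _, m, hm⟩ := htri (A := S.obj X) h
  obtain ⟨E, f, hE, hf⟩ := happ M
  refine ⟨E, f ≫ m, hE, ?_, fun {T} t hT ht => ?_⟩
  · by_contra hr
    obtain ⟨s, hs⟩ := hX.exists_section _ hr
    have : h = 0 := by
      rw [← Category.id_comp h, ← hs]
      simp [hm.comp_right]
    have h1 := hh (𝟙 X)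
    rw [this, comp_zero, map_zero, hρ₁] at h1
    exact zero_ne_one h1
  · have : t ≫ h = 0 := τ.eq_zero_right _ fun s => by
      rw [← Category.assoc, hh]
      exact hρ₀ _ (ht.comp_left s)
    obtain ⟨g, rfl⟩ := hm.exact_right t this
    obtain ⟨g', rfl⟩ := hf T g hT
    exact ⟨g', by simp⟩

/-- Without loops, a copy of `X` in `E` contributes nothing to the sink map that the complement does
not already give, so it can be discarded. -/
lemma IsSink.exists_free [IsIdempotentComplete C] [∀ X Y : C, FiniteDimensional k (X ⟶ Y)]
    [HasBinaryBiproducts C] (h𝒯 : IsAdditiveClass 𝒯) (hX : IsLocalObject k X)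
    (hloop : ∀ f : X ⟶ X, IsRadicalHom f → IsRadicalSqIn 𝒯 f) {E : C} (e : E ⟶ X)
    (he : IsSink 𝒯 e) :
    ∃ (E' : C) (e' : E' ⟶ X), IsSink 𝒯 e' ∧ ∀ f : X ⟶ E', IsRadicalHom f := by
  induction hn : Module.finrank k (E ⟶ E) using Nat.strong_induction_on generalizing E with
  | _ n ih =>
  subst hn
  by_cases hfree : ∀ f : X ⟶ E, IsRadicalHom f
  · exact ⟨E, e, he, hfree⟩
  push Not at hfree
  obtain ⟨a, ha⟩ := hfree
  obtain ⟨s, hs⟩ := hX.exists_retraction a ha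
  obtain ⟨Y, i, p, h₁, h₂, hlt⟩ := hX.exists_complement a s hs
  have hsplit : ∀ {T : C} (t : T ⟶ E), t ≫ e = (t ≫ s) ≫ a ≫ e + (t ≫ p) ≫ i ≫ e := by
    intro T t
    conv_lhs => rw [← Category.id_comp e, ← h₂]
    simp
  -- The radical map `a ≫ e` is `g ≫ c ≫ e` with `g` radical. Its part through `X` is `(g ≫ c ≫ s) ≫
  -- a ≫ e`, which is absorbed on the left by inverting `1 - g ≫ c ≫ s`.
  obtain ⟨d, hd⟩ : ∃ d, d ≫ i ≫ e = a ≫ e := by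
    obtain ⟨T, g, l, hT, hg, hl, hgl⟩ := hloop _ (he.isRadicalHom.comp_left a)
    obtain ⟨c, rfl⟩ := he.exists_factor l hT hl
    have := (hg.comp_right (c ≫ s)) (𝟙 X)
    rw [Category.comp_id] at this
    refine ⟨inv (𝟙 X - g ≫ c ≫ s) ≫ g ≫ c ≫ p, ?_⟩
    rw [hsplit c] at hgl
    rw [Category.assoc, IsIso.inv_comp_eq, Preadditive.sub_comp, Category.id_comp,
      eq_sub_iff_add_eq]
    refine Eq.trans ?_ hgl
    simp [add_comm]
  refine ih _ hlt (i ≫ e) ⟨h𝒯.retract i p h₁ he.mem, he.isRadicalHom.comp_left i, ?_⟩ rfl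
  intro T t hT ht
  obtain ⟨t', rfl⟩ := he.exists_factor t hT ht
  refine ⟨t' ≫ s ≫ d + t' ≫ p, ?_⟩
  rw [hsplit t', Preadditive.add_comp, ← hd]
  simp

/-! ### The exchange triangles -/

/-- The exactness properties of a triangle `Z ⟶ E ⟶ X ⟶ S Z`. -/
structure IsFiberSequence (S : C ⥤ C) {Z E X : C} (ι : Z ⟶ E) (e : E ⟶ X) (γ : X ⟶ S.obj Z) :
    Prop where
  comp : ι ≫ e = 0
  comp' : e ≫ γ = 0
  exact_mid : ∀ {W : C} (f : W ⟶ E), f ≫ e = 0 → ∃ g, g ≫ ι = f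
  exact_right : ∀ {W : C} (f : W ⟶ X), f ≫ γ = 0 → ∃ g, g ≫ e = f
  exact_susp : ∀ {W : C} (f : W ⟶ S.obj Z), f ≫ S.map ι = 0 → ∃ g, g ≫ γ = f
  coexact_left : ∀ {W : C} (f : Z ⟶ W), γ ≫ S.map f = 0 → ∃ g, ι ≫ g = f

/-- Triangles are available only on maps into an object `S A`; replacing `X` by `S` of a preimage
and rotating once completes a given `e : E ⟶ X` instead. -/
lemma exists_isFiberSequence [S.IsEquivalence] [S.Additive]
    (htri : ∀ {A D : C} (δ : D ⟶ S.obj A), ∃ (B : C) (j : A ⟶ B) (q : B ⟶ D),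
      IsExactTriangle S j q δ) {E X : C} (e : E ⟶ X) :
    ∃ (Z : C) (ι : Z ⟶ E) (γ : X ⟶ S.obj Z), IsFiberSequence S ι e γ := by
  let φ := S.objObjPreimageIso X
  obtain ⟨Z, j, ι, h⟩ := htri (A := S.objPreimage X) (e ≫ φ.inv)
  refine ⟨Z, ι, φ.inv ≫ S.map j, ?_, ?_, ?_, ?_, ?_, ?_⟩
  · rw [← cancel_mono φ.inv, Category.assoc, h.comp_right, zero_comp]
  · simpa using h.comp_susp
  · intro W f hf
    exact h.exact_right f (by rw [reassoc_of% hf, zero_comp])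
  · intro W f hf
    obtain ⟨g, hg⟩ := h.exact_susp (f ≫ φ.inv) (by simpa using hf)
    exact ⟨g, by simpa [← cancel_mono φ.inv] using hg⟩
  · intro W f hf
    let ψ := S.objObjPreimageIso W
    obtain ⟨f', hf'⟩ := S.map_surjective (ψ.hom ≫ f)
    obtain ⟨g, hg⟩ := h.exact_mid f' (S.map_injective (by
      rw [S.map_comp, hf', Category.assoc, hf, comp_zero, S.map_zero]))
    refine ⟨ψ.inv ≫ S.map g ≫ φ.hom, ?_⟩
    rw [Category.assoc, Category.assoc, Iso.hom_inv_id_assoc, ← S.map_comp, hg, hf',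
      Iso.inv_hom_id_assoc]
  · intro W f hf
    refine h.coexact_mid f (S.map_injective ?_)
    rw [← cancel_epi φ.inv, S.map_comp, S.map_zero, comp_zero, ← hf, Category.assoc]

/-- Let `Z ⟶ E ⟶ X ⟶ S Z` be a triangle on a sink map of `𝒯` such that `X` is not a summand of
`E`. Then all maps `X ⟶ Z` factor through radical maps to objects of `𝒯`. -/
lemma IsSink.exists_radical_factor [S.IsEquivalence] [S.Additive]
    (τ : SerreTrace k S) (hct : IsClusterTiltingSubcategory S 𝒯)
    (htri : ∀ {A D : C} (δ : D ⟶ S.obj A), ∃ (B : C) (j : A ⟶ B) (q : B ⟶ D),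
      IsExactTriangle S j q δ)
    (hX : IsLocalObject k X) (hX𝒯 : 𝒯 X) {E Z : C} {ι : Z ⟶ E} {e : E ⟶ X} {γ : X ⟶ S.obj Z}
    (he : IsSink 𝒯 e) (hfree : ∀ f : X ⟶ E, IsRadicalHom f) (hZ : IsFiberSequence S ι e γ)
    (x : X ⟶ Z) : ∃ (B : C) (x₁ : X ⟶ B) (x₂ : B ⟶ Z), 𝒯 B ∧ IsRadicalHom x₁ ∧ x₁ ≫ x₂ = x := by
  have hγ0 : γ ≠ 0 := by
    rintro rfl
    obtain ⟨g, hg⟩ := hZ.exact_right (𝟙 X) comp_zero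
    exact hX.not_isRadicalHom_id (hg ▸ he.isRadicalHom.comp_left g)
  -- Together with `hrad` this makes `Hom(T, S Z)` a quotient of `Hom(T, X)` modulo radical maps; in
  -- particular `Hom(X, S Z)` is the line spanned by `γ`.
  have hγ : ∀ {T : C}, 𝒯 T → ∀ f : T ⟶ S.obj Z, ∃ t, t ≫ γ = f := fun hT f =>
    hZ.exact_susp f (hct.rigid hT he.mem _)
  have hrad : ∀ {T : C}, 𝒯 T → ∀ t : T ⟶ X, IsRadicalHom t → t ≫ γ = 0 := by
    intro T hT t ht
    obtain ⟨s, rfl⟩ := he.exists_factor t hT ht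
    rw [Category.assoc, hZ.comp', comp_zero]
  -- the object `Z` is rigid
  have hZZ : ∀ z : Z ⟶ S.obj Z, z = 0 := by
    intro z
    -- By duality it is enough to test against `S (S y₂)` with `y₂ : Z ⟶ X`. Such `y₂` extends to
    -- `E`, radically since `X` is no summand of `E`, hence passes through `e`; cyclicity then
    -- produces `e ≫ γ = 0`.
    have h0 : γ ≫ S.map z = 0 := τ.eq_zero_left _ fun y => by
      obtain ⟨y₁, rfl⟩ := S.map_surjective y
      obtain ⟨y₂, rfl⟩ := S.map_surjective y₁
      obtain ⟨t, rfl⟩ := hZ.coexact_left y₂ (hct.rigid hX𝒯 hX𝒯 _)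
      obtain ⟨t', rfl⟩ := he.exists_factor t he.mem (hX.isRadicalHom_from hfree t)
      have := τ.cyc e (γ ≫ S.map z ≫ S.map (S.map (ι ≫ t')))
      rw [reassoc_of% hZ.comp', zero_comp, map_zero] at this
      rw [this]
      simp
    obtain ⟨g, rfl⟩ := hZ.coexact_left z h0
    obtain ⟨t, rfl⟩ := hγ he.mem g
    rw [hrad he.mem t (hX.isRadicalHom_from hfree t), comp_zero]
  -- a nonzero map `Z ⟶ S X`
  obtain ⟨β, hβ⟩ : ∃ β : Z ⟶ S.obj X, τ.τ X (γ ≫ S.map β) ≠ 0 := by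
    by_contra! hβ
    apply hγ0
    refine τ.eq_zero_left _ fun h => ?_
    obtain ⟨β, rfl⟩ := S.map_surjective h
    exact hβ β
  -- `Hom(Z, S X)` is dual to the line `Hom(X, S Z)`, so `β` spans it.
  have hβ' : ∀ y : Z ⟶ S.obj X, ∃ c : k, y = β ≫ S.map (c • 𝟙 X) := by
    intro y
    refine ⟨τ.τ X (γ ≫ S.map y) / τ.τ X (γ ≫ S.map β), ?_⟩
    set c := τ.τ X (γ ≫ S.map y) / τ.τ X (γ ≫ S.map β) with hc
    rw [← sub_eq_zero]
    apply S.map_injective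
    rw [S.map_zero]
    refine τ.eq_zero_right _ fun f => ?_
    obtain ⟨t, rfl⟩ := hγ hX𝒯 f
    obtain ⟨d, hd⟩ := hX.exists_isRadicalHom_sub t
    have h1 := hrad hX𝒯 _ hd
    rw [Preadditive.sub_comp, sub_eq_zero, Linear.smul_comp, Category.id_comp] at h1
    have h2 : τ.τ X (γ ≫ S.map (β ≫ S.map (c • 𝟙 X))) = c * τ.τ X (γ ≫ S.map β) := by
      have := τ.cyc (c • 𝟙 X) (γ ≫ S.map β)
      rw [Linear.smul_comp, Category.id_comp, map_smul, smul_eq_mul] at this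
      rw [this]
      simp
    rw [h1, Linear.smul_comp, map_smul, S.map_sub, Preadditive.comp_sub, map_sub, h2, hc,
      div_mul_cancel₀ _ hβ, sub_self, smul_zero]
  -- This is the second exchange triangle `X ⟶ B ⟶ Z ⟶ S X`. If a map from `𝒯` to `S Z` coming from
  -- `S B` were a non-radical multiple of `γ`, then `γ ≫ S β` would vanish, against the choice of
  -- `β`.
  obtain ⟨B, j, q, hB⟩ := htri β
  have hB𝒯 : 𝒯 B := by
    refine hct.maximal B fun T hT f => ?_
    obtain ⟨t, ht⟩ := hγ hT (f ≫ S.map q)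
    have h0 : f ≫ S.map q = 0 := by
      rw [← ht]
      refine hrad hT t ?_
      by_contra hr
      obtain ⟨s, hs⟩ := hX.exists_section t hr
      apply hβ
      have : γ ≫ S.map β = 0 := by
        rw [← Category.id_comp γ, ← hs, Category.assoc, Category.assoc, reassoc_of% ht,
          ← S.map_comp, hB.comp_right, S.map_zero, comp_zero, comp_zero]
      rw [this, map_zero]
    let ψ := S.objObjPreimageIso T
    obtain ⟨f', hf'⟩ := S.map_surjective (ψ.hom ≫ f)
    obtain ⟨g, hg⟩ := hB.exact_mid f' (S.map_injective (by
      rw [S.map_comp, hf', Category.assoc, h0, comp_zero, S.map_zero]))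
    have hg0 := hct.rigid hT hX𝒯 (ψ.inv ≫ S.map g)
    rw [← cancel_epi ψ.hom, ← hf', ← hg, S.map_comp, ← Iso.hom_inv_id_assoc ψ (S.map g), hg0]
    simp
  -- Rigidity of `Z` brings `y` back to `Hom(Z, S X)`, which is spanned by `β`, and `β ≫ S j = 0`.
  have hZB : ∀ y : Z ⟶ S.obj B, y = 0 := by
    intro y
    let ψ := S.objObjPreimageIso Z
    obtain ⟨y', hy'⟩ := S.map_surjective (ψ.hom ≫ y)
    obtain ⟨g, hg⟩ := hB.exact_mid y' (S.map_injective (by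
      rw [S.map_comp, hy', Category.assoc, hZZ (y ≫ S.map q), comp_zero, S.map_zero]))
    obtain ⟨c, hc⟩ := hβ' (ψ.inv ≫ S.map g)
    rw [← cancel_epi ψ.hom, ← hy', ← hg, S.map_comp, ← Iso.hom_inv_id_assoc ψ (S.map g), hc,
      Category.assoc, Category.assoc, ← S.map_comp]
    have : (c • 𝟙 X) ≫ j = j ≫ (c • 𝟙 B) := by simp
    rw [this, S.map_comp, reassoc_of% hB.comp_susp]
    simp
  have hBZ : ∀ y : B ⟶ S.obj Z, y = 0 := fun y => τ.eq_zero_left _ fun h => by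
    obtain ⟨h, rfl⟩ := S.map_surjective h
    rw [hZB h, S.map_zero, comp_zero, map_zero]
  obtain ⟨x', rfl⟩ := hB.exact_right x (hct.rigid hX𝒯 hX𝒯 _)
  refine ⟨B, x', q, hB𝒯, ?_, rfl⟩
  -- Otherwise `X` is a summand of `B`, so `Hom(B, S Z) = 0` forces `γ = 0`.
  by_contra hr
  obtain ⟨p, hp⟩ := hX.exists_retraction x' hr
  apply hγ0
  rw [← Category.id_comp γ, ← hp, Category.assoc, hBZ (p ≫ γ), comp_zero]

end TwoCalabiYau

/-! ### The cyclic functionals attached to a two-cycle -/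

section TwoCycles

variable {C : Type u} [Category.{v} C] [Preadditive C] {k : Type w} [Field k] [Linear k C]
  {𝒯 : ObjectProperty C} {X Y : C}

/-- Frames with respect to a single object. -/
abbrev SingleFrame (𝒯 : ObjectProperty C) (Y Q : C) :=
  Frame (isFreeOf 𝒯 fun _ : Unit => Y) (fun _ : Unit => Y) Q

/-- The value of the cyclic functional `α ⊗ β` on the path `X ⟶ Q ⟶ X`. -/
def SingleFrame.bracket (α : (X ⟶ Y) →ₗ[k] k) (β : (Y ⟶ X) →ₗ[k] k) {Q : C}
    (F : SingleFrame 𝒯 Y Q) (f : X ⟶ Q) (g : Q ⟶ X) : k :=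
  ∑ j, α (f ≫ F.v j) * β (F.u j ≫ g)

/-- The bracket is balanced over maps `Q ⟶ Q'`. -/
lemma SingleFrame.bracket_comp (hY : IsLocalObject k Y) (hY𝒯 : 𝒯 Y) {α : (X ⟶ Y) →ₗ[k] k}
    {β : (Y ⟶ X) →ₗ[k] k} (hα : ∀ f, IsRadicalSqIn 𝒯 f → α f = 0)
    (hβ : ∀ f, IsRadicalSqIn 𝒯 f → β f = 0) {Q Q' : C} (F : SingleFrame 𝒯 Y Q)
    (F' : SingleFrame 𝒯 Y Q') (f : X ⟶ Q) (q : Q ⟶ Q') (g : Q' ⟶ X) (hf : IsRadicalHom f)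
    (hg : IsRadicalHom g) : F'.bracket α β (f ≫ q) g = F.bracket α β f (q ≫ g) := by
  -- The entries of `q` between copies of `Y` are scalars `c j j'` modulo the radical, and `α` and
  -- `β` see only these scalars. Both brackets equal `∑ α(f v_j) c j j' β(u'_j' g)`.
  choose c hc using fun j j' => hY.exists_isRadicalHom_sub (F.u j ≫ q ≫ F'.v j')
  have h₁ : ∀ j', α ((f ≫ q) ≫ F'.v j') = ∑ j, c j j' * α (f ≫ F.v j) := by
    intro j'
    have hnull : α ((f ≫ F.p) ≫ F.i ≫ q ≫ F'.v j') = 0 :=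
      hα _ ⟨F.W, _, _, F.hW.1, hf.comp_right _, hY.isRadicalHom_from (F.hW.2 ()) _, rfl⟩
    have := F.map_comp_eq α.toAddMonoidHom f (q ≫ F'.v j') hnull
    rw [Category.assoc]
    refine this.trans (Finset.sum_congr rfl fun j _ => ?_)
    have h0 := hα _ ⟨Y, f ≫ F.v j, _, hY𝒯, hf.comp_right _, hc j j', rfl⟩
    rw [Preadditive.comp_sub, Linear.comp_smul, Category.comp_id, map_sub, map_smul,
      sub_eq_zero] at h0
    exact h0
  have h₂ : ∀ j, β (F.u j ≫ q ≫ g) = ∑ j', c j j' * β (F'.u j' ≫ g) := by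
    intro j
    have hnull : β (((F.u j ≫ q) ≫ F'.p) ≫ F'.i ≫ g) = 0 :=
      hβ _ ⟨F'.W, _, _, F'.hW.1, F'.hW.2 () _, hg.comp_left _, rfl⟩
    have := F'.map_comp_eq β.toAddMonoidHom (F.u j ≫ q) g hnull
    rw [← Category.assoc]
    refine this.trans (Finset.sum_congr rfl fun j' _ => ?_)
    have h0 := hβ _ ⟨Y, _, F'.u j' ≫ g, hY𝒯, hc j j', hg.comp_left _, rfl⟩
    rw [Preadditive.sub_comp, Linear.smul_comp, Category.id_comp, map_sub, map_smul,
      sub_eq_zero] at h0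
    simp only [Category.assoc] at h0 ⊢
    exact h0
  unfold bracket
  simp only [h₁, h₂, Finset.sum_mul, Finset.mul_sum]
  rw [Finset.sum_comm]
  exact Finset.sum_congr rfl fun _ _ => Finset.sum_congr rfl fun _ _ => by ring

/-- The bracket comes from a functional on the endomorphism ring of `X`. -/
lemma IsSink.exists_functional {E : C} {e : E ⟶ X} (he : IsSink 𝒯 e)
    (hfac : ∀ w : X ⟶ E, w ≫ e = 0 → ∃ (B : C) (x₁ : X ⟶ B) (x₂ : B ⟶ E),
      𝒯 B ∧ IsRadicalHom x₁ ∧ x₁ ≫ x₂ = w ∧ x₂ ≫ e = 0)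
    (hframe : ∀ Q, 𝒯 Q → Nonempty (SingleFrame 𝒯 Y Q))
    (hY : IsLocalObject k Y) (hY𝒯 : 𝒯 Y) {α : (X ⟶ Y) →ₗ[k] k}
    {β : (Y ⟶ X) →ₗ[k] k} (hα : ∀ f, IsRadicalSqIn 𝒯 f → α f = 0)
    (hβ : ∀ f, IsRadicalSqIn 𝒯 f → β f = 0) :
    ∃ μ : (X ⟶ X) →ₗ[k] k, ∀ {Q : C} (F : SingleFrame 𝒯 Y Q) (f : X ⟶ Q) (g : Q ⟶ X), 𝒯 Q →
      IsRadicalHom f → IsRadicalHom g → μ (f ≫ g) = F.bracket α β f g := by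
  obtain ⟨F⟩ := hframe E he.mem
  let θ : (X ⟶ E) →ₗ[k] k := ∑ j, β (F.u j ≫ e) • (α ∘ₗ Linear.rightComp k X (F.v j))
  have hθ : ∀ w, θ w = F.bracket α β w e := by
    intro w
    simp only [θ, LinearMap.sum_apply, LinearMap.smul_apply, LinearMap.comp_apply, smul_eq_mul,
      SingleFrame.bracket]
    exact Finset.sum_congr rfl fun j _ => mul_comm _ _
  -- By balancedness the bracket of `x₁ ≫ x₂` with `e` is that of `x₁` with `x₂ ≫ e = 0`. Therefore
  -- `θ` descends along composition with `e` to a functional `μ` on `End X`.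
  have hker : θ ∈ (Linear.rightComp k X e).ker.dualAnnihilator := by
    rw [Submodule.mem_dualAnnihilator]
    intro w hw
    obtain ⟨B, x₁, x₂, hB, hx₁, rfl, hx₂⟩ := hfac w hw
    obtain ⟨F'⟩ := hframe B hB
    rw [hθ, SingleFrame.bracket_comp hY hY𝒯 hα hβ F' F x₁ x₂ e hx₁ he.isRadicalHom, hx₂]
    simp [SingleFrame.bracket]
  rw [← LinearMap.range_dualMap_eq_dualAnnihilator_ker] at hker
  obtain ⟨μ, hμ⟩ := hker
  refine ⟨μ, fun {Q} F' f g hQ hf hg => ?_⟩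
  obtain ⟨g', rfl⟩ := he.exists_factor g hQ hg
  rw [← SingleFrame.bracket_comp hY hY𝒯 hα hβ F' F f g' e hf he.isRadicalHom, ← hθ, ← hμ,
    LinearMap.dualMap_apply, ← Category.assoc]
  rfl

lemma IsLocalObject.isIso_of_not_isRadicalHom (hX : IsLocalObject k X) (hY : IsLocalObject k Y)
    (f : X ⟶ Y) (hf : ¬ IsRadicalHom f) : IsIso f := by
  obtain ⟨s, hs⟩ := hX.exists_retraction f hf
  rcases hY.isIso_or_isNilpotent (s ≫ f) with h | h
  · have h₁ : IsSplitEpi f := ⟨⟨inv (s ≫ f) ≫ s, by rw [Category.assoc, IsIso.inv_hom_id]⟩⟩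
    have h₂ : IsSplitMono f := ⟨⟨s, hs⟩⟩
    exact isIso_of_epi_of_isSplitMono f
  · have h₁ := (hY.isRadicalHom_iff_isNilpotent _).2 h
    refine absurd ?_ hX.not_isRadicalHom_id
    have h₂ : f ≫ (s ≫ f) ≫ s = 𝟙 X := by simp [hs]
    exact h₂ ▸ (h₁.comp_right s).comp_left f

variable {S : C ⥤ C} [IsIdempotentComplete C] [∀ X Y : C, FiniteDimensional k (X ⟶ Y)]
  [HasBinaryBiproducts C] [S.IsEquivalence] [S.Additive]

/-- A sink map without summand `X` exists because there are no loops; the exchange triangles supply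
the factorization required by `IsSink.exists_functional`. -/
lemma exists_cycle_functional (τ : SerreTrace k S) (hct : IsClusterTiltingSubcategory S 𝒯)
    (htri : ∀ {A D : C} (δ : D ⟶ S.obj A), ∃ (B : C) (j : A ⟶ B) (q : B ⟶ D),
      IsExactTriangle S j q δ)
    (hk : TracesKillNilpotents k 𝒯)
    (hX : IsLocalObject k X) (hX𝒯 : 𝒯 X) (hY : IsLocalObject k Y) (hY𝒯 : 𝒯 Y)
    {α : (X ⟶ Y) →ₗ[k] k} {β : (Y ⟶ X) →ₗ[k] k} (hα : ∀ f, IsRadicalSqIn 𝒯 f → α f = 0)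
    (hβ : ∀ f, IsRadicalSqIn 𝒯 f → β f = 0) :
    ∃ μ : (X ⟶ X) →ₗ[k] k, ∀ {Q : C} (F : SingleFrame 𝒯 Y Q) (f : X ⟶ Q) (g : Q ⟶ X), 𝒯 Q →
      IsRadicalHom f → IsRadicalHom g → μ (f ≫ g) = F.bracket α β f g := by
  obtain ⟨E₀, e₀, he₀⟩ := τ.exists_sink htri hct.functoriallyFinite.1 hX
  obtain ⟨E, e, he, hfree⟩ := he₀.exists_free hct.isAdditiveClass hX
    (isRadicalSqIn_of_endo hct.isAdditiveClass hk hX𝒯 hX)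
  obtain ⟨Z, ι, γ, hZ⟩ := exists_isFiberSequence htri e
  refine he.exists_functional (fun w hw => ?_)
    (exists_frame hct.isAdditiveClass fun _ => hY) hY hY𝒯 hα hβ
  obtain ⟨x, rfl⟩ := hZ.exact_mid w hw
  obtain ⟨B, x₁, x₂, hB, hx₁, rfl⟩ :=
    he.exists_radical_factor τ hct htri hX hX𝒯 hfree hZ x
  exact ⟨B, x₁, x₂ ≫ ι, hB, hx₁, by simp, by simp [hZ.comp]⟩

/-- The quiver of a cluster-tilting subcategory `𝒯` all of whose traces kill nilpotent
endomorphisms has no two-cycles. -/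
theorem isRadicalSqIn_or_of_two_cycle [HasZeroObject C] (τ : SerreTrace k S)
    (hct : IsClusterTiltingSubcategory S 𝒯)
    (htri : ∀ {A D : C} (δ : D ⟶ S.obj A), ∃ (B : C) (j : A ⟶ B) (q : B ⟶ D),
      IsExactTriangle S j q δ)
    (hk : TracesKillNilpotents k 𝒯)
    (hX : IsLocalObject k X) (hX𝒯 : 𝒯 X) (hY : IsLocalObject k Y) (hY𝒯 : 𝒯 Y)
    {b : X ⟶ Y} {a : Y ⟶ X} (hb : IsRadicalHom b) :
    IsRadicalSqIn 𝒯 b ∨ IsRadicalSqIn 𝒯 a := by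
  have hadd := hct.isAdditiveClass
  by_contra! hba
  obtain ⟨hb', ha'⟩ := hba
  -- A non-radical map would identify `X` with `Y`, and `b` would become a loop.
  have hniso : ∀ f : X ⟶ Y, IsRadicalHom f := by
    by_contra! h
    obtain ⟨f, hf⟩ := h
    have := hX.isIso_of_not_isRadicalHom hY f hf
    obtain ⟨Z, g, h, hZ, hg, hh, hgh⟩ := isRadicalSqIn_of_endo hadd hk hX𝒯 hX (b ≫ inv f)
      (hb.comp_right _)
    refine hb' ⟨Z, g, h ≫ f, hZ, hg, hh.comp_right f, ?_⟩
    rw [reassoc_of% hgh]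
    simp
  have hniso' : ∀ f : Y ⟶ X, IsRadicalHom f := hX.isRadicalHom_from hniso
  obtain ⟨α, hα₁, hα⟩ := (radicalSqSubmodule k hadd hX𝒯 Y).exists_functional hb'
  obtain ⟨β, hβ₁, hβ⟩ := (radicalSqSubmodule k hadd hY𝒯 X).exists_functional ha'
  obtain ⟨μ, hμ⟩ := exists_cycle_functional τ hct htri hk hX hX𝒯 hY hY𝒯 hα hβ
  obtain ⟨ν, hν⟩ := exists_cycle_functional τ hct htri hk hY hY𝒯 hX hX𝒯 hβ hα
  -- frames of objects without the relevant summand, and of the objects themselves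
  obtain ⟨O, hO0⟩ := HasZeroObject.zero (C := C)
  have hO : ∀ Z : C, isFreeOf 𝒯 (fun _ : Unit => Z) O := fun Z =>
    ⟨hadd.retract (0 : O ⟶ X) 0 (hO0.eq_of_src _ _) hX𝒯, fun _ f => by
      rw [hO0.eq_zero_of_tgt f]
      exact .zero⟩
  let Ffree : ∀ {Z Q : C}, isFreeOf 𝒯 (fun _ : Unit => Z) Q → SingleFrame 𝒯 Z Q := fun {Z Q} h =>
    ⟨0, Fin.elim0, fun j => j.elim0, fun j => j.elim0, Q, h, 𝟙 Q, 𝟙 Q, by simp⟩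
  let Fself : ∀ Z : C, SingleFrame 𝒯 Z Z := fun Z =>
    ⟨1, fun _ => (), fun _ => 𝟙 Z, fun _ => 𝟙 Z, O, hO Z, 0, 0, by simp⟩
  have hμ0 : ∀ {Q : C}, isFreeOf 𝒯 (fun _ : Unit => Y) Q → ∀ (f : X ⟶ Q) (g : Q ⟶ X),
      IsRadicalHom f → IsRadicalHom g → μ (f ≫ g) = 0 := fun {Q} hQ f g hf hg => by
    rw [hμ (Ffree hQ) f g hQ.1 hf hg]
    exact Finset.sum_empty
  have hν0 : ∀ {Q : C}, isFreeOf 𝒯 (fun _ : Unit => X) Q → ∀ (f : Y ⟶ Q) (g : Q ⟶ Y),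
      IsRadicalHom f → IsRadicalHom g → ν (f ≫ g) = 0 := fun {Q} hQ f g hf hg => by
    rw [hν (Ffree hQ) f g hQ.1 hf hg]
    exact Finset.sum_empty
  have hμ1 : ∀ (f : X ⟶ Y) (g : Y ⟶ X), μ (f ≫ g) = α f * β g := fun f g => by
    rw [hμ (Fself Y) f g hY𝒯 (hniso f) (hniso' g)]
    simp [SingleFrame.bracket, Fself]
  have hν1 : ∀ (f : Y ⟶ X) (g : X ⟶ Y), ν (f ≫ g) = β f * α g := fun f g => by
    rw [hν (Fself X) f g hX𝒯 (hniso' f) (hniso g)]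
    simp [SingleFrame.bracket, Fself]
  have hself : ∀ {Z : C} (_ : IsLocalObject k Z) (φ : (Z ⟶ Z) →ₗ[k] k)
      (_ : ∀ f g : Z ⟶ Z, IsRadicalHom f → IsRadicalHom g → φ (f ≫ g) = 0) (f g : Z ⟶ Z),
      φ (f ≫ g) = φ (g ≫ f) := by
    intro Z hZ φ hφ f g
    obtain ⟨c, hc⟩ := hZ.exists_isRadicalHom_sub f
    obtain ⟨d, hd⟩ := hZ.exists_isRadicalHom_sub g
    have h₁ := hφ _ _ hc hd
    have h₂ := hφ _ _ hd hc
    simp only [Preadditive.sub_comp, Preadditive.comp_sub, Linear.smul_comp, Linear.comp_smul,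
      Category.id_comp, Category.comp_id, map_sub, map_smul, smul_eq_mul] at h₁ h₂
    linear_combination h₁ - h₂
  let G : Bool → C := fun i => match i with
    | true => X
    | false => Y
  have hG : ∀ i, IsLocalObject k (G i) := by
    rintro (_ | _)
    · exact hY
    · exact hX
  let φ : ∀ i, (G i ⟶ G i) →+ k := fun i => match i with
    | true => μ.toAddMonoidHom
    | false => ν.toAddMonoidHom
  -- On mixed pairs cyclicity is the symmetry of `α f * β g`. On each of `X` and `Y` it holds
  -- because the functional kills products of two radical endomorphisms.
  obtain ⟨t, ht⟩ := exists_trace_of_frames (P := 𝒯) (exists_frame (k := k) hadd hG) φ (by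
    rintro (_ | _) (_ | _) f g
    · exact hself hY ν (hν0 ⟨hY𝒯, fun _ => hniso⟩) f g
    · exact (hν1 f g).trans ((mul_comm _ _).trans (hμ1 g f).symm)
    · exact (hμ1 f g).trans ((mul_comm _ _).trans (hν1 g f).symm)
    · exact hself hX μ (hμ0 ⟨hX𝒯, fun _ => hniso'⟩) f g) (by
    rintro (_ | _) W ⟨hW, hW'⟩ f g
    · exact hν0 ⟨hW, fun _ => hW' true⟩ f g (hW' false f) (hY.isRadicalHom_from (hW' false) g)
    · exact hμ0 ⟨hW, fun _ => hW' false⟩ f g (hW' true f) (hX.isRadicalHom_from (hW' true) g))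
  have h₁ := hk t X hX𝒯 (b ≫ a)
    ((hX.isRadicalHom_iff_isNilpotent _).1 (hb.comp_right a))
  have h₂ : t.tr X hX𝒯 (b ≫ a) = μ (b ≫ a) := ht true hX𝒯 (b ≫ a)
  rw [h₂, hμ1, hα₁, hβ₁, one_mul] at h₁
  exact one_ne_zero h₁

end TwoCycles

/-! ## Gorenstein projective approximations -/

section ExtVanishing

open Abelian

variable {R : Type u} [Ring R]

/-- The short complex in `ModuleCat R` given by an exact pair of linear maps. -/
def linearShortComplex {A B C : Type u} [AddCommGroup A] [AddCommGroup B] [AddCommGroup C]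
    [Module R A] [Module R B] [Module R C] (f : A →ₗ[R] B) (g : B →ₗ[R] C)
    (h : Function.Exact f g) : ShortComplex (ModuleCat.{u} R) :=
  ShortComplex.mk (ModuleCat.ofHom f) (ModuleCat.ofHom g)
    (by rw [← ModuleCat.ofHom_comp, h.linearMap_comp_eq_zero]; rfl)

lemma linearShortComplex_shortExact {A B C : Type u} [AddCommGroup A] [AddCommGroup B]
    [AddCommGroup C] [Module R A] [Module R B] [Module R C] {f : A →ₗ[R] B} {g : B →ₗ[R] C}
    (h : Function.Exact f g) (hf : Function.Injective f) (hg : Function.Surjective g) :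
    (linearShortComplex f g h).ShortExact :=
  ModuleCat.shortComplex_shortExact _ h hf hg

/-- All `Ext` groups in positive degrees vanish. -/
def ExtVanishing (X Y : ModuleCat.{u} R) : Prop := ∀ i : ℕ, 0 < i → Subsingleton (Ext X Y i)

lemma ExtVanishing.of_projective {X Y : ModuleCat.{u} R} [Projective X] : ExtVanishing X Y := by
  intro i hi
  obtain ⟨i, rfl⟩ := Nat.exists_eq_succ_of_ne_zero hi.ne'
  exact subsingleton_of_forall_eq 0 fun e => Ext.eq_zero_of_projective e

lemma ExtVanishing.of_retract {X Y Y' : ModuleCat.{u} R} (s : Y ⟶ Y') (p : Y' ⟶ Y)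
    (h : s ≫ p = 𝟙 Y) (hY : ExtVanishing X Y') : ExtVanishing X Y := by
  intro i hi
  have := hY i hi
  refine subsingleton_of_forall_eq 0 fun e => ?_
  have h1 : (e.comp (Ext.mk₀ s) (add_zero i)).comp (Ext.mk₀ p) (add_zero i) = e := by
    rw [Ext.comp_assoc_of_second_deg_zero, Ext.mk₀_comp_mk₀, h, Ext.comp_mk₀_id]
  rw [← h1, Subsingleton.elim (e.comp (Ext.mk₀ s) (add_zero i)) 0, Ext.zero_comp]

lemma ExtVanishing.middle {X : ModuleCat.{u} R} {S : ShortComplex (ModuleCat.{u} R)}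
    (hS : S.ShortExact) (h₁ : ExtVanishing X S.X₁) (h₃ : ExtVanishing X S.X₃) :
    ExtVanishing X S.X₂ := by
  intro i hi
  have := h₁ i hi
  have := h₃ i hi
  refine subsingleton_of_forall_eq 0 fun e => ?_
  obtain ⟨e', rfl⟩ := Ext.covariant_sequence_exact₂ X hS e (Subsingleton.elim _ _)
  rw [Subsingleton.elim e' 0, Ext.zero_comp]

lemma ExtVanishing.right {X : ModuleCat.{u} R} {S : ShortComplex (ModuleCat.{u} R)}
    (hS : S.ShortExact) (h₁ : ExtVanishing X S.X₁) (h₂ : ExtVanishing X S.X₂) :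
    ExtVanishing X S.X₃ := by
  intro i hi
  have := h₁ (i + 1) i.succ_pos
  have := h₂ i hi
  refine subsingleton_of_forall_eq 0 fun e => ?_
  obtain ⟨e', rfl⟩ := Ext.covariant_sequence_exact₃ X hS e rfl (Subsingleton.elim _ _)
  rw [Subsingleton.elim e' 0, Ext.zero_comp]

/-- If `Ext¹(X, S.X₁) = 0` then maps from `X` lift along `S.g`. -/
lemma ExtVanishing.exists_lift {X : ModuleCat.{u} R} {S : ShortComplex (ModuleCat.{u} R)}
    (hS : S.ShortExact) (h₁ : ExtVanishing X S.X₁) (f : X ⟶ S.X₃) : ∃ g, g ≫ S.g = f := by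
  have := h₁ 1 one_pos
  obtain ⟨e, he⟩ := Ext.covariant_sequence_exact₃ X hS (Ext.mk₀ f) (zero_add 1)
    (Subsingleton.elim _ _)
  obtain ⟨g, rfl⟩ := Ext.homEquiv₀.symm.surjective e
  refine ⟨g, ?_⟩
  rw [Ext.homEquiv₀_symm_apply, Ext.mk₀_comp_mk₀] at he
  exact Ext.homEquiv₀.symm.injective he

/-- The cokernel of a map along which all maps to `Y` extend inherits the vanishing. -/
lemma ExtVanishing.of_cokernel {Y : ModuleCat.{u} R} {S : ShortComplex (ModuleCat.{u} R)}
    (hS : S.ShortExact) (h₁ : ExtVanishing S.X₁ Y) (h₂ : ExtVanishing S.X₂ Y)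
    (hext : ∀ f : S.X₁ ⟶ Y, ∃ g, S.f ≫ g = f) : ExtVanishing S.X₃ Y := by
  intro i hi
  have := h₂ i hi
  refine subsingleton_of_forall_eq 0 fun e => ?_
  obtain ⟨i, rfl⟩ := Nat.exists_eq_succ_of_ne_zero hi.ne'
  obtain ⟨e', rfl⟩ := Ext.contravariant_sequence_exact₃ hS Y e (Subsingleton.elim _ _)
    (add_comm 1 i)
  -- In degree one the class is the connecting image of a map `S.X₁ ⟶ Y`; this map extends to
  -- `S.X₂`, so its image is zero.
  rcases Nat.eq_zero_or_pos i with rfl | hi'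
  · obtain ⟨f, rfl⟩ := Ext.homEquiv₀.symm.surjective e'
    obtain ⟨g, rfl⟩ := hext f
    rw [Ext.homEquiv₀_symm_apply, ← Ext.mk₀_comp_mk₀, ← Ext.comp_assoc _ _ _ _ (add_zero 0) (by lia),
      hS.extClass_comp, Ext.zero_comp]
    rfl
  · have := h₁ i hi'
    rw [Subsingleton.elim e' 0, Ext.comp_zero]

lemma ExtVanishing.free {X : ModuleCat.{u} R} (hX : ExtVanishing X (ModuleCat.of R R)) (m : ℕ) :
    ExtVanishing X (ModuleCat.of R (Fin m → R)) := by
  induction m with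
  | zero =>
    refine ExtVanishing.of_retract (Y' := ModuleCat.of R R) 0 0 ?_ hX
    exact ModuleCat.hom_ext (LinearMap.ext fun x => Subsingleton.elim (α := Fin 0 → R) _ _)
  | succ m ih =>
    have hex : Function.Exact (LinearMap.single R (fun _ : Fin (m + 1) => R) 0)
        (LinearMap.funLeft R R (Fin.succ : Fin m → Fin (m + 1))) := by
      intro x
      constructor
      · intro hx
        refine ⟨x 0, ?_⟩
        ext j
        refine Fin.cases ?_ (fun j => ?_) j
        · simp
        · have := congrFun hx j
          simp only [LinearMap.funLeft_apply, Pi.zero_apply] at this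
          simp [this]
      · rintro ⟨y, rfl⟩
        ext j
        simp [LinearMap.funLeft_apply]
    exact ExtVanishing.middle (linearShortComplex_shortExact hex
      (Pi.single_injective (M := fun _ : Fin (m + 1) => R) 0)
      (LinearMap.funLeft_surjective_of_injective _ _ _ (Fin.succ_injective m))) hX ih

/-- Induction on the dimension: a projective is a summand of a finite free module, and the inductive
step uses the kernel of a finite free cover. -/
lemma ExtVanishing.of_projectiveDimension [IsNoetherianRing R] {X : ModuleCat.{u} R}
    (hX : ExtVanishing X (ModuleCat.of R R)) (n : ℕ) (Y : Type u) [AddCommGroup Y] [Module R Y]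
    [Module.Finite R Y] (hY : HasProjectiveDimensionLT (ModuleCat.of R Y) (n + 1)) :
    ExtVanishing X (ModuleCat.of R Y) := by
  induction n generalizing Y with
  | zero =>
    have : Projective (ModuleCat.of R Y) := inferInstance
    have : Module.Projective R Y := (IsProjective.iff_projective Y).2 this
    obtain ⟨m, p, hp⟩ := Module.Finite.exists_fin' R Y
    obtain ⟨s, hs⟩ := Module.projective_lifting_property p LinearMap.id hp
    refine ExtVanishing.of_retract (ModuleCat.ofHom s) (ModuleCat.ofHom p) ?_ (hX.free m)
    rw [← ModuleCat.ofHom_comp, hs]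
    rfl
  | succ n ih =>
    obtain ⟨m, p, hp⟩ := Module.Finite.exists_fin' R Y
    have hS := linearShortComplex_shortExact (LinearMap.exact_subtype_ker_map p)
      (Submodule.subtype_injective _) hp
    have hproj : Projective (ModuleCat.of R (Fin m → R)) :=
      ModuleCat.projective_of_free (Pi.basisFun R (Fin m))
    have h := hS.hasProjectiveDimensionLT_X₁ (n + 1)
      (inferInstanceAs (HasProjectiveDimensionLT (ModuleCat.of R (Fin m → R)) (n + 1))) hY
    exact ExtVanishing.right hS (ih _ h) (hX.free m)

end ExtVanishing

/-! ### Duality with right modules -/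

section RightDual

open MulOpposite

variable (k R : Type u) [Field k] [Ring R] [Algebra k R]

/-- The `k`-dual of a right `R`-module, a left `R`-module. -/
def RightDual (M : Type u) [AddCommGroup M] [Module k M] : Type u := M →ₗ[k] k

/-- The `k`-dual of the left module `R`, a right `R`-module. -/
def RingDual : Type u := R →ₗ[k] k

namespace RightDual

section

variable (M : Type u) [AddCommGroup M] [Module k M]

instance : AddCommGroup (RightDual k M) := inferInstanceAs (AddCommGroup (M →ₗ[k] k))

instance : Module k (RightDual k M) := inferInstanceAs (Module k (M →ₗ[k] k))

instance [FiniteDimensional k M] : FiniteDimensional k (RightDual k M) :=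
  inferInstanceAs (FiniteDimensional k (M →ₗ[k] k))

instance : FunLike (RightDual k M) M k := inferInstanceAs (FunLike (M →ₗ[k] k) M k)

instance : LinearMapClass (RightDual k M) k M k :=
  inferInstanceAs (LinearMapClass (M →ₗ[k] k) k M k)

variable {k M}

@[ext] lemma ext {φ ψ : RightDual k M} (h : ∀ m, φ m = ψ m) : φ = ψ := DFunLike.ext _ _ h

@[simp] lemma add_apply (φ ψ : RightDual k M) (m : M) : (φ + ψ) m = φ m + ψ m := rfl

@[simp] lemma zero_apply (m : M) : (0 : RightDual k M) m = 0 := rfl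

@[simp] lemma k_smul_apply (c : k) (φ : RightDual k M) (m : M) : (c • φ) m = c * φ m := rfl

/-- A linear form as an element of the dual. -/
def of (φ : M →ₗ[k] k) : RightDual k M := φ

@[simp] lemma of_apply (φ : M →ₗ[k] k) (m : M) : of φ m = φ m := rfl

/-- An element of the dual as a linear form. -/
def toLinearMap (φ : RightDual k M) : M →ₗ[k] k := φ

@[simp] lemma toLinearMap_apply (φ : RightDual k M) (m : M) : φ.toLinearMap m = φ m := rfl

end

variable (M : Type u) [AddCommGroup M] [Module k M] [Module Rᵐᵒᵖ M] [IsScalarTower k Rᵐᵒᵖ M]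

instance : SMul R (RightDual k M) where
  smul r φ := of (φ.toLinearMap ∘ₗ (Algebra.lsmul k k M (op r)))

variable {k R M}

@[simp] lemma smul_apply (r : R) (φ : RightDual k M) (m : M) : (r • φ) m = φ (op r • m) := rfl

variable (k R M)

instance : Module R (RightDual k M) where
  one_smul φ := by ext; simp
  mul_smul r s φ := by ext; simp [mul_smul]
  smul_zero r := by ext; simp
  smul_add r φ ψ := by ext; simp
  add_smul r s φ := by ext; simp [add_smul]
  zero_smul φ := by ext; simp

instance : IsScalarTower k R (RightDual k M) where
  smul_assoc c r φ := by ext m; simp [smul_assoc]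

instance [FiniteDimensional k M] : Module.Finite R (RightDual k M) :=
  Module.Finite.of_restrictScalars_finite k R _

variable {k R M} {N L : Type u} [AddCommGroup N] [Module k N] [Module Rᵐᵒᵖ N]
  [IsScalarTower k Rᵐᵒᵖ N] [AddCommGroup L] [Module k L] [Module Rᵐᵒᵖ L] [IsScalarTower k Rᵐᵒᵖ L]

variable (k) in
/-- The dual of a map of right modules. -/
def map (f : M →ₗ[Rᵐᵒᵖ] N) : RightDual k N →ₗ[R] RightDual k M where
  toFun φ := of (φ.toLinearMap ∘ₗ f.restrictScalars k)
  map_add' φ ψ := rfl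
  map_smul' r φ := by ext m; simp

@[simp] lemma map_apply (f : M →ₗ[Rᵐᵒᵖ] N) (φ : RightDual k N) (m : M) :
    map k f φ m = φ (f m) := rfl

lemma map_surjective {f : M →ₗ[Rᵐᵒᵖ] N} (hf : Function.Injective f) :
    Function.Surjective (map k f) := fun φ => by
  obtain ⟨g, hg⟩ := LinearMap.exists_leftInverse_of_injective (f.restrictScalars k)
    (LinearMap.ker_eq_bot.2 hf)
  refine ⟨of (φ.toLinearMap ∘ₗ g), ?_⟩
  ext m
  exact congrArg φ (LinearMap.congr_fun hg m)

lemma map_injective {f : M →ₗ[Rᵐᵒᵖ] N} (hf : Function.Surjective f) :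
    Function.Injective (map k f) := fun φ ψ h => by
  ext n
  obtain ⟨m, rfl⟩ := hf n
  exact DFunLike.congr_fun h m

lemma map_exact {f : M →ₗ[Rᵐᵒᵖ] N} {g : N →ₗ[Rᵐᵒᵖ] L} (h : Function.Exact f g)
    (hg : Function.Surjective g) : Function.Exact (map k g) (map k f) := by
  intro φ
  constructor
  · intro hφ
    have hker : LinearMap.ker (g.restrictScalars k) ≤ LinearMap.ker φ.toLinearMap := by
      intro n hn
      obtain ⟨m, rfl⟩ := (h n).1 hn
      exact DFunLike.congr_fun hφ m
    obtain ⟨s, hs⟩ := LinearMap.exists_rightInverse_of_surjective (g.restrictScalars k)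
      (LinearMap.range_eq_top.2 hg)
    refine ⟨of (φ.toLinearMap ∘ₗ s), ?_⟩
    ext n
    have : s (g n) - n ∈ LinearMap.ker (g.restrictScalars k) := by
      rw [LinearMap.mem_ker, map_sub, sub_eq_zero]
      exact LinearMap.congr_fun hs (g n)
    have := hker this
    rw [LinearMap.mem_ker, map_sub, sub_eq_zero] at this
    exact this
  · rintro ⟨ψ, rfl⟩
    ext m
    simp [h.apply_apply_eq_zero m]

end RightDual

namespace RingDual

instance : AddCommGroup (RingDual k R) := inferInstanceAs (AddCommGroup (R →ₗ[k] k))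

instance : Module k (RingDual k R) := inferInstanceAs (Module k (R →ₗ[k] k))

instance [FiniteDimensional k R] : FiniteDimensional k (RingDual k R) :=
  inferInstanceAs (FiniteDimensional k (R →ₗ[k] k))

instance : FunLike (RingDual k R) R k := inferInstanceAs (FunLike (R →ₗ[k] k) R k)

instance : LinearMapClass (RingDual k R) k R k :=
  inferInstanceAs (LinearMapClass (R →ₗ[k] k) k R k)

variable {k R}

@[ext] lemma ext {φ ψ : RingDual k R} (h : ∀ m, φ m = ψ m) : φ = ψ := DFunLike.ext _ _ h

@[simp] lemma add_apply (φ ψ : RingDual k R) (m : R) : (φ + ψ) m = φ m + ψ m := rfl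

@[simp] lemma zero_apply (m : R) : (0 : RingDual k R) m = 0 := rfl

@[simp] lemma k_smul_apply (c : k) (φ : RingDual k R) (m : R) : (c • φ) m = c * φ m := rfl

/-- A linear form as an element of the dual. -/
def of (φ : R →ₗ[k] k) : RingDual k R := φ

@[simp] lemma of_apply (φ : R →ₗ[k] k) (m : R) : of φ m = φ m := rfl

/-- An element of the dual as a linear form. -/
def toLinearMap (φ : RingDual k R) : R →ₗ[k] k := φ

@[simp] lemma toLinearMap_apply (φ : RingDual k R) (m : R) : φ.toLinearMap m = φ m := rfl

variable (k R)

instance : SMul Rᵐᵒᵖ (RingDual k R) where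
  smul r φ := of (φ.toLinearMap ∘ₗ LinearMap.mulLeft k r.unop)

variable {k R}

@[simp] lemma smul_apply (r : Rᵐᵒᵖ) (φ : RingDual k R) (s : R) : (r • φ) s = φ (r.unop * s) := rfl

variable (k R)

instance : Module Rᵐᵒᵖ (RingDual k R) where
  one_smul φ := by ext; simp
  mul_smul r s φ := by ext; simp [mul_assoc]
  smul_zero r := by ext; simp
  smul_add r φ ψ := by ext; simp
  add_smul r s φ := by ext; simp [add_mul]
  zero_smul φ := by ext; simp

instance : IsScalarTower k Rᵐᵒᵖ (RingDual k R) where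
  smul_assoc c r φ := by ext m; simp

/-- Right linear maps from `Y` to the dual of `R` correspond to `k`-linear forms on `Y` by
evaluation at `1`, and forms extend from subspaces. -/
instance : Module.Injective Rᵐᵒᵖ (RingDual k R) where
  out X Y _ _ _ _ f hf g := by
    let _ := Module.restrictScalars k Rᵐᵒᵖ X
    have := IsScalarTower.restrictScalars k Rᵐᵒᵖ X
    let _ := Module.restrictScalars k Rᵐᵒᵖ Y
    have := IsScalarTower.restrictScalars k Rᵐᵒᵖ Y
    let ξ : X →ₗ[k] k :=
      { toFun := fun x => g x 1
        map_add' := fun x y => by simp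
        map_smul' := fun c x => by
          have : g (c • x) = c • g x := (g.restrictScalars k).map_smul c x
          simp [this] }
    obtain ⟨p, hp⟩ := LinearMap.exists_leftInverse_of_injective (f.restrictScalars k)
      (LinearMap.ker_eq_bot.2 hf)
    refine ⟨{ toFun := fun y => of
                ((ξ ∘ₗ p) ∘ₗ
                  { toFun := fun s : R => op s • y
                    map_add' := fun s t => by simp [add_smul]
                    map_smul' := fun c s => by simp [smul_assoc] })
              map_add' := fun x y => by ext s; simp
              map_smul' := fun r y => by ext s; simp [mul_smul] }, fun x => ?_⟩
    ext s
    have h1 : p (op s • f x) = op s • x := by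
      rw [← f.map_smul]
      exact LinearMap.congr_fun hp (op s • x)
    change ξ (p (op s • f x)) = g x s
    rw [h1]
    change g (op s • x) 1 = g x s
    simp

/-- The evaluation map from a free left module to the dual of a power of the dual of `R`. -/
def eval (m : ℕ) : (Fin m → R) →ₗ[R] RightDual k (Fin m → RingDual k R) where
  toFun r := RightDual.of
    { toFun := fun φ => ∑ j, φ j (r j)
      map_add' := fun φ ψ => by simp [Finset.sum_add_distrib]
      map_smul' := fun c φ => by simp [Finset.mul_sum] }
  map_add' r s := RightDual.ext fun φ => by
    change ∑ j, φ j (r j + s j) = ∑ j, φ j (r j) + ∑ j, φ j (s j)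
    simp [Finset.sum_add_distrib]
  map_smul' r s := RightDual.ext fun φ => by
    change ∑ j, φ j (r * s j) = ∑ j, (op r • φ) j (s j)
    simp

lemma eval_apply (m : ℕ) (r : Fin m → R) (φ : Fin m → RingDual k R) :
    eval k R m r φ = ∑ j, φ j (r j) := rfl

/-- This is biduality for `R`; it makes the dual of a power of the injective module `RingDual k R`
free, which lets duality convert injective into projective resolutions. -/
lemma eval_bijective [FiniteDimensional k R] (m : ℕ) : Function.Bijective (eval k R m) := by
  constructor
  · rw [injective_iff_map_eq_zero]
    intro r hr
    ext j
    by_contra h0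
    obtain ⟨φ, hφ⟩ := Module.Projective.exists_dual_ne_zero k (show r j ≠ 0 from h0)
    apply hφ
    have := DFunLike.congr_fun hr (Pi.single j (of φ))
    rw [eval_apply, Finset.sum_eq_single j] at this
    · simpa using this
    · intro i _ hij
      rw [Pi.single_eq_of_ne hij, zero_apply]
    · simp
  · intro Ψ
    choose r hr using fun j : Fin m => (Module.evalEquiv k R).surjective
      (Ψ.toLinearMap ∘ₗ LinearMap.single k (fun _ : Fin m => RingDual k R) j)
    refine ⟨r, ?_⟩
    ext φ
    rw [eval_apply]
    have h : φ = ∑ j, Pi.single j (φ j) := (Finset.univ_sum_single φ).symm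
    conv_rhs => rw [h]
    rw [map_sum]
    exact Finset.sum_congr rfl fun j _ => LinearMap.congr_fun (hr j) (φ j).toLinearMap

instance [FiniteDimensional k R] (m : ℕ) : Module.Projective R (RightDual k (Fin m → RingDual k R)) :=
  Module.Projective.of_equiv (LinearEquiv.ofBijective (eval k R m) (eval_bijective k R m))

variable (M : Type u) [AddCommGroup M] [Module k M] [Module Rᵐᵒᵖ M] [IsScalarTower k Rᵐᵒᵖ M]

/-- Every finite-dimensional right module embeds into a power of the dual of `R`. -/
lemma exists_embedding [FiniteDimensional k M] :
    ∃ (m : ℕ) (f : M →ₗ[Rᵐᵒᵖ] (Fin m → RingDual k R)), Function.Injective f := by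
  let b := Module.finBasis k M
  -- The `j`-th component sends `x` to the form `s ↦ b_j(x s)`; at `s = 1` it recovers the
  -- coordinate of `x`.
  refine ⟨_, { toFun := fun x j => of (b.coord j ∘ₗ
                { toFun := fun s : R => op s • x
                  map_add' := fun s t => by simp [add_smul]
                  map_smul' := fun c s => by simp [smul_assoc] })
               map_add' := fun x y => by ext j s; simp
               map_smul' := fun r x => by ext j s; simp [mul_smul] }, ?_⟩
  rw [injective_iff_map_eq_zero]
  intro x hx
  refine b.ext_elem fun j => ?_
  have := DFunLike.congr_fun (congrFun hx j) (1 : R)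
  simpa using this

end RingDual

/-- The dual of a right module of injective dimension at most `n` has projective dimension at
most `n`. -/
lemma RightDual.hasProjectiveDimensionLT [FiniteDimensional k R] (n : ℕ) (M : Type u)
    [AddCommGroup M] [Module k M] [Module Rᵐᵒᵖ M] [IsScalarTower k Rᵐᵒᵖ M] [FiniteDimensional k M]
    (hM : HasInjectiveDimensionLT (ModuleCat.of Rᵐᵒᵖ M) (n + 1)) :
    HasProjectiveDimensionLT (ModuleCat.of R (RightDual k M)) (n + 1) := by
  induction n generalizing M with
  | zero =>
    have hinj : Injective (ModuleCat.of Rᵐᵒᵖ M) := inferInstance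
    obtain ⟨m, f, hf⟩ := RingDual.exists_embedding k R M
    have : Mono (ModuleCat.ofHom f) := (ModuleCat.mono_iff_injective _).2 hf
    obtain ⟨p, hp⟩ := hinj.factors (𝟙 _) (ModuleCat.ofHom f)
    have hp' : ∀ x, p.hom (f x) = x := fun x =>
      LinearMap.congr_fun (congrArg ModuleCat.Hom.hom hp) x
    have : Module.Projective R (RightDual k M) := by
      refine Module.Projective.of_split (map k p.hom) (map k f) ?_
      ext φ x
      simp [hp']
    have := (IsProjective.iff_projective (R := R) (RightDual k M)).1 this
    infer_instance
  | succ n ih =>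
    obtain ⟨m, f, hf⟩ := RingDual.exists_embedding k R M
    have hex : Function.Exact f (LinearMap.range f).mkQ := LinearMap.exact_map_mkQ_range f
    have hS := linearShortComplex_shortExact hex hf (Submodule.mkQ_surjective _)
    have hJ : Injective (ModuleCat.of Rᵐᵒᵖ (Fin m → RingDual k R)) :=
      Module.injective_object_of_injective_module _ _
    have hN := ih _ (hS.hasInjectiveDimensionLT_X₃ (n + 1)
      (inferInstanceAs (HasInjectiveDimensionLT (ModuleCat.of Rᵐᵒᵖ (Fin m → RingDual k R)) (n + 1)))
      hM)
    have hS' := linearShortComplex_shortExact (map_exact (k := k) hex (Submodule.mkQ_surjective _))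
      (map_injective (Submodule.mkQ_surjective _)) (map_surjective hf)
    have hP : Projective (ModuleCat.of R (RightDual k (Fin m → RingDual k R))) :=
      (IsProjective.iff_projective (R := R) _).1 inferInstance
    exact hS'.hasProjectiveDimensionLT_X₃ (n + 1) hN
      (inferInstanceAs (HasProjectiveDimensionLT
        (ModuleCat.of R (RightDual k (Fin m → RingDual k R))) (n + 1 + 1)))

end RightDual

/-! ### Gorenstein projective modules are torsionless -/

section Approximation

open Abelian MulOpposite

variable {R : Type u} [Ring R]

/-- The dual of the right module `R` cogenerates left modules, and it has finite projective
dimension because `R` has finite right injective dimension. For a finite free cover of it the kernel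
has no `Ext¹` from `X`, so a map `φ` from `X` with `φ x ≠ 0` lifts to the free module, and some
coordinate of the lift is nonzero at `x`. -/
lemma IsGorensteinRing.exists_linearMap_ne_zero (hR : IsGorensteinRing R) (k : Type u) [Field k]
    [Algebra k R] [FiniteDimensional k R] {X : Type u} [AddCommGroup X] [Module R X]
    (hX : ExtVanishing (ModuleCat.of R X) (ModuleCat.of R R)) {x : X} (hx : x ≠ 0) :
    ∃ f : X →ₗ[R] R, f x ≠ 0 := by
  have := hR.noetherian_left
  obtain ⟨n, hn⟩ := hR.injdim_right
  have : FiniteDimensional k Rᵐᵒᵖ := Module.Finite.equiv (MulOpposite.opLinearEquiv k)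
  let _ := Module.restrictScalars k R X
  have := IsScalarTower.restrictScalars k R X
  obtain ⟨ξ, hξ⟩ := Module.Projective.exists_dual_ne_zero k hx
  let φ : X →ₗ[R] RightDual k Rᵐᵒᵖ :=
    { toFun := fun y => RightDual.of
        { toFun := fun s => ξ (s.unop • y)
          map_add' := fun s t => by simp [add_smul]
          map_smul' := fun c s => by simp [smul_assoc] }
      map_add' := fun y z => RightDual.ext fun s => by
        change ξ (s.unop • (y + z)) = ξ (s.unop • y) + ξ (s.unop • z)
        simp
      map_smul' := fun r y => RightDual.ext fun s => by
        change ξ (s.unop • r • y) = ξ ((op r • s).unop • y)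
        simp [mul_smul] }
  have hφ : φ x ≠ 0 := fun h => hξ (by
    have := DFunLike.congr_fun h (1 : Rᵐᵒᵖ)
    change ξ ((1 : R) • x) = 0 at this
    rwa [one_smul] at this)
  have hpd := RightDual.hasProjectiveDimensionLT k R n Rᵐᵒᵖ hn
  obtain ⟨m, p, hp⟩ := Module.Finite.exists_fin' R (RightDual k Rᵐᵒᵖ)
  have hS := linearShortComplex_shortExact (LinearMap.exact_subtype_ker_map p)
    (Submodule.subtype_injective _) hp
  have hproj : Projective (ModuleCat.of R (Fin m → R)) :=
    ModuleCat.projective_of_free (Pi.basisFun R (Fin m))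
  have hker : ExtVanishing (ModuleCat.of R X) (ModuleCat.of R (LinearMap.ker p)) :=
    hX.of_projectiveDimension n _ (hS.hasProjectiveDimensionLT_X₁ (n + 1)
      (hasProjectiveDimensionLT_of_ge (ModuleCat.of R (Fin m → R)) 1 (n + 1) (by lia))
      (hasProjectiveDimensionLT_of_ge (ModuleCat.of R (RightDual k Rᵐᵒᵖ)) (n + 1) (n + 2) (by lia)))
  obtain ⟨g, hg⟩ := hker.exists_lift hS (ModuleCat.ofHom φ)
  have hgx : p (g.hom x) = φ x := LinearMap.congr_fun (congrArg ModuleCat.Hom.hom hg) x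
  have hne : g.hom x ≠ 0 := fun h => hφ (by rw [← hgx, h]; exact map_zero p)
  obtain ⟨j, hj⟩ := Function.ne_iff.1 hne
  exact ⟨LinearMap.proj j ∘ₗ g.hom, hj⟩

/-- A Gorenstein projective module has an embedding into a free module along which all maps to `R`
extend. -/
lemma IsGorensteinRing.exists_free_hull (hR : IsGorensteinRing R) (k : Type u) [Field k]
    [Algebra k R] [FiniteDimensional k R] {X : Type u} [AddCommGroup X] [Module R X]
    [Module.Finite R X] (hX : ExtVanishing (ModuleCat.of R X) (ModuleCat.of R R)) :
    ∃ (m : ℕ) (j : X →ₗ[R] (Fin m → R)), Function.Injective j ∧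
      ∀ f : X →ₗ[R] R, ∃ g : (Fin m → R) →ₗ[R] R, g ∘ₗ j = f := by
  let _ := Module.restrictScalars k R X
  have := IsScalarTower.restrictScalars k R X
  have : Module.Finite k X := Module.Finite.trans R X
  let ρ : (X →ₗ[R] R) →ₗ[k] (X →ₗ[k] R) :=
    { toFun := fun f => f.restrictScalars k
      map_add' := fun f g => rfl
      map_smul' := fun c f => rfl }
  have : FiniteDimensional k (X →ₗ[R] R) :=
    FiniteDimensional.of_injective ρ fun f g h => LinearMap.ext fun x => LinearMap.congr_fun h x
  let b := Module.finBasis k (X →ₗ[R] R)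
  have hext : ∀ f : X →ₗ[R] R, (∑ i, b.repr f i • LinearMap.proj i) ∘ₗ LinearMap.pi b = f := by
    intro f
    ext x
    have h := LinearMap.congr_fun (b.sum_repr f) x
    rw [LinearMap.sum_apply] at h
    simpa using h
  -- The components of the embedding are a `k`-basis of `Hom(X, R)`, so every map to `R` extends;
  -- injectivity follows because maps to `R` separate points.
  refine ⟨_, LinearMap.pi b, ?_, fun f => ⟨_, hext f⟩⟩
  rw [injective_iff_map_eq_zero]
  intro x hx
  by_contra h0
  obtain ⟨f, hf⟩ := hR.exists_linearMap_ne_zero k hX h0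
  apply hf
  rw [← hext f, LinearMap.comp_apply, hx, map_zero]

lemma hasProjectiveDimensionLT_of_subsingleton (X : Type u) [AddCommGroup X] [Module R X]
    [Subsingleton X] : HasProjectiveDimensionLT (ModuleCat.of R X) 1 := by
  have : Projective (ModuleCat.of R X) := ModuleCat.projective_of_free (Module.Basis.empty X : Module.Basis Empty R X)
  infer_instance

/-- Every module with `Ext^i(M, R) = 0` for large `i` is the quotient of a Gorenstein projective
module by a module of finite projective dimension. -/
lemma IsGorensteinRing.exists_approximation (hR : IsGorensteinRing R) (k : Type u) [Field k]
    [Algebra k R] [FiniteDimensional k R] (n : ℕ) (M : Type u) [AddCommGroup M] [Module R M]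
    [Module.Finite R M]
    (hM : ∀ i, n < i → Subsingleton (Ext (ModuleCat.of R M) (ModuleCat.of R R) i)) :
    ∃ (W : ModuleCat.{u} R) (π : W →ₗ[R] M), Function.Surjective π ∧ isGorensteinProjective R W ∧
      ∃ d, HasProjectiveDimensionLT (ModuleCat.of R (LinearMap.ker π)) (d + 1) := by
  have := hR.noetherian_left
  induction n generalizing M with
  | zero =>
    refine ⟨ModuleCat.of R M, LinearMap.id, Function.surjective_id, ⟨inferInstance, hM⟩, 0, ?_⟩
    have : Subsingleton (LinearMap.ker (LinearMap.id : M →ₗ[R] M)) := by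
      rw [LinearMap.ker_id]
      infer_instance
    exact hasProjectiveDimensionLT_of_subsingleton _
  | succ n ih =>
    obtain ⟨m, p, hp⟩ := Module.Finite.exists_fin' R M
    have hS := linearShortComplex_shortExact (LinearMap.exact_subtype_ker_map p)
      (Submodule.subtype_injective _) hp
    have hproj : Projective (ModuleCat.of R (Fin m → R)) :=
      ModuleCat.projective_of_free (Pi.basisFun R (Fin m))
    obtain ⟨G, π, hπ, ⟨hG, hG'⟩, d, hd⟩ := ih (LinearMap.ker p) (by
      intro i hi
      have h1 := hM (i + 1) (by lia)
      have h2 := ExtVanishing.of_projective (X := ModuleCat.of R (Fin m → R))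
        (Y := ModuleCat.of R R) i (by lia)
      refine subsingleton_of_forall_eq 0 fun e => ?_
      obtain ⟨e', rfl⟩ := Ext.contravariant_sequence_exact₁ hS _ e (add_comm 1 i) (h1.elim _ _)
      rw [h2.elim e' 0]
      exact Ext.comp_zero (Ext.mk₀ (linearShortComplex _ _ (LinearMap.exact_subtype_ker_map p)).f)
        (ModuleCat.of R R) i i (zero_add i))
    obtain ⟨q, j, hj, hext⟩ := hR.exists_free_hull k hG'
    -- The approximation `G` of the syzygy maps to the free cover of `M` and, through its free hull
    -- `j`, to a second free module. The cokernel of the pair is the approximation of `M`; it is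
    -- Gorenstein projective because maps from `G` to `R` already extend along `j`.
    let φ : G →ₗ[R] (Fin m → R) × (Fin q → R) := ((LinearMap.ker p).subtype ∘ₗ π).prod j
    have hφ : Function.Injective φ := fun x y h => hj (congrArg Prod.snd h)
    let ψ : ((Fin m → R) × (Fin q → R)) ⧸ LinearMap.range φ →ₗ[R] M :=
      (LinearMap.range φ).liftQ (p ∘ₗ LinearMap.fst _ _ _) (by
        rintro _ ⟨g, rfl⟩
        exact (π g).2)
    refine ⟨ModuleCat.of R (((Fin m → R) × (Fin q → R)) ⧸ LinearMap.range φ), ψ, ?_,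
      ⟨inferInstanceAs (Module.Finite R (_ ⧸ LinearMap.range φ)), ?_⟩, d + 1, ?_⟩
    · intro y
      obtain ⟨x, rfl⟩ := hp y
      exact ⟨Submodule.Quotient.mk (x, 0), rfl⟩
    · have hS' := linearShortComplex_shortExact (LinearMap.exact_map_mkQ_range φ) hφ
        (Submodule.mkQ_surjective _)
      have hPQ : Projective (ModuleCat.of R ((Fin m → R) × (Fin q → R))) :=
        (IsProjective.iff_projective (R := R) _).1 inferInstance
      refine ExtVanishing.of_cokernel hS' hG' (ExtVanishing.of_projective (X := ModuleCat.of R ((Fin m → R) × (Fin q → R)))) fun f => ?_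
      obtain ⟨g, hg⟩ := hext f.hom
      refine ⟨ModuleCat.ofHom (g ∘ₗ LinearMap.snd _ _ _), ModuleCat.hom_ext ?_⟩
      exact hg
    -- The kernel of `ψ` is the cokernel of `ker π` in the second free module, so its projective
    -- dimension exceeds that of `ker π` by at most one.
    · let a : LinearMap.ker π →ₗ[R] (Fin q → R) := j ∘ₗ (LinearMap.ker π).subtype
      let b : (Fin q → R) →ₗ[R] LinearMap.ker ψ :=
        ((LinearMap.range φ).mkQ ∘ₗ LinearMap.inr R (Fin m → R) (Fin q → R)).codRestrict _
          fun y => by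
            change p 0 = 0
            exact map_zero p
      have hab : Function.Exact a b := by
        intro y
        have h0 : b y = 0 ↔ ((0, y) : (Fin m → R) × (Fin q → R)) ∈ LinearMap.range φ := by
          rw [← Submodule.Quotient.mk_eq_zero]
          exact Subtype.ext_iff
        rw [h0]
        constructor
        · rintro ⟨g, hg⟩
          exact ⟨⟨g, Subtype.ext (congrArg Prod.fst hg)⟩, congrArg Prod.snd hg⟩
        · rintro ⟨⟨g, hg⟩, rfl⟩
          exact ⟨g, Prod.ext (congrArg Subtype.val hg) rfl⟩
      have hb : Function.Surjective b := by
        rintro ⟨z, hz⟩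
        obtain ⟨⟨x, y⟩, rfl⟩ := Submodule.Quotient.mk_surjective _ z
        obtain ⟨g, hg⟩ := hπ ⟨x, hz⟩
        refine ⟨y - j g, Subtype.ext ((Submodule.Quotient.eq _).2 ⟨-g, ?_⟩)⟩
        refine Prod.ext ?_ ?_
        · change ((π (-g) : LinearMap.ker p) : Fin m → R) = 0 - x
          rw [map_neg, hg, zero_sub]
          rfl
        · change j (-g) = y - j g - y
          rw [map_neg]
          abel
      have hproj' : Projective (ModuleCat.of R (Fin q → R)) :=
        ModuleCat.projective_of_free (Pi.basisFun R (Fin q))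
      exact (linearShortComplex_shortExact hab (hj.comp (Submodule.subtype_injective _))
        hb).hasProjectiveDimensionLT_X₃ (d + 1) hd
        (hasProjectiveDimensionLT_of_ge (ModuleCat.of R (Fin q → R)) 1 (d + 1 + 1) (by lia))

end Approximation

/-! ### Traces on Gorenstein projective modules -/

section GorensteinTrace

variable {R : Type u} [Ring R]

variable (R) in
/-- The modules with a relatively exact resolution of length at most `n` by Gorenstein projective
modules. -/
def resolutionClass : ℕ → ObjectProperty (ModuleCat.{u} R)
  | 0 => isGorensteinProjective R
  | n + 1 => isPresented (isGorensteinProjective R) (resolutionClass n)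

lemma resolutionClass_le_succ (n : ℕ) : resolutionClass R n ≤ resolutionClass R (n + 1) := by
  induction n with
  | zero =>
    intro M hM
    have h0 : IsZero (ModuleCat.of R PUnit.{u + 1}) := ModuleCat.isZero_of_subsingleton _
    exact ⟨{ K := _, T := M, i := 0, p := 𝟙 M, hK := isGorensteinProjective_zero, hT := hM
             zero := zero_comp
             mono := ⟨fun _ _ _ => h0.eq_of_tgt _ _⟩
             exact := fun f hf => ⟨0, by rw [← Category.comp_id f, hf, zero_comp]⟩
             lift := fun _ f => ⟨f, Category.comp_id f⟩ }⟩
  | succ n ih =>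
    rintro M ⟨P⟩
    exact ⟨{ P with hK := ih _ P.hK }⟩

lemma resolutionClass_mono : Monotone (resolutionClass R) :=
  monotone_nat_of_le_succ resolutionClass_le_succ

lemma ObjectTrace.exists_resolution_extension {A : Type w} [AddCommGroup A]
    (t : ObjectTrace (isGorensteinProjective R) A) (n : ℕ) :
    ∃ t' : ObjectTrace (resolutionClass R n) A, ∀ (M : ModuleCat.{u} R)
      (hM : isGorensteinProjective R M) (f : M ⟶ M),
        t'.tr M (resolutionClass_mono n.zero_le M hM) f = t.tr M hM f := by
  induction n with
  | zero => exact ⟨t, fun _ _ _ => rfl⟩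
  | succ n ih =>
    obtain ⟨t₁, h₁⟩ := ih
    obtain ⟨t₂, h₂⟩ := ObjectTrace.exists_extension (resolutionClass_mono n.zero_le) t₁
    exact ⟨t₂, fun M hM f => (h₂ M _ hM f).trans (h₁ M hM f)⟩

/-- The presentation is relatively exact since `Ext¹` from a Gorenstein projective to a finitely
generated module of finite projective dimension vanishes. -/
lemma isPresented_of_surjective [IsNoetherianRing R] {P : ObjectProperty (ModuleCat.{u} R)}
    {W M : Type u} [AddCommGroup W] [Module R W] [AddCommGroup M] [Module R M] (π : W →ₗ[R] M)
    (hπ : Function.Surjective π) (hW : isGorensteinProjective R (ModuleCat.of R W)) (d : ℕ)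
    (hd : HasProjectiveDimensionLT (ModuleCat.of R (LinearMap.ker π)) (d + 1))
    (hP : P (ModuleCat.of R (LinearMap.ker π))) :
    isPresented (isGorensteinProjective R) P (ModuleCat.of R M) := by
  have := hW.1
  have hS := linearShortComplex_shortExact (LinearMap.exact_subtype_ker_map π)
    (Submodule.subtype_injective _) hπ
  refine ⟨{ K := ModuleCat.of R (LinearMap.ker π), T := ModuleCat.of R W
            i := ModuleCat.ofHom (LinearMap.ker π).subtype, p := ModuleCat.ofHom π
            hK := hP, hT := hW
            zero := (linearShortComplex _ _ (LinearMap.exact_subtype_ker_map π)).zero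
            mono := hS.mono_f
            exact := fun f hf => ⟨ModuleCat.ofHom (f.hom.codRestrict _ fun x =>
              LinearMap.congr_fun (congrArg ModuleCat.Hom.hom hf) x), rfl⟩
            lift := fun {T'} hT' f => ExtVanishing.exists_lift hS ?_ f }⟩
  have : Module.Finite R W := hW.1
  exact ExtVanishing.of_projectiveDimension (X := T') hT'.2 d (LinearMap.ker π) hd

lemma resolutionClass_of_projectiveDimension [IsNoetherianRing R] (d : ℕ) (M : Type u)
    [AddCommGroup M] [Module R M] [Module.Finite R M]
    (hM : HasProjectiveDimensionLT (ModuleCat.of R M) (d + 1)) :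
    resolutionClass R d (ModuleCat.of R M) := by
  induction d generalizing M with
  | zero =>
    have : Projective (ModuleCat.of R M) := inferInstance
    exact ⟨inferInstance, ExtVanishing.of_projective⟩
  | succ d ih =>
    obtain ⟨m, p, hp⟩ := Module.Finite.exists_fin' R M
    have hS := linearShortComplex_shortExact (LinearMap.exact_subtype_ker_map p)
      (Submodule.subtype_injective _) hp
    have hproj : Projective (ModuleCat.of R (Fin m → R)) :=
      ModuleCat.projective_of_free (Pi.basisFun R (Fin m))
    have h := hS.hasProjectiveDimensionLT_X₁ (d + 1)
      (hasProjectiveDimensionLT_of_ge (ModuleCat.of R (Fin m → R)) 1 (d + 1) (by lia)) hM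
    exact isPresented_of_surjective p hp ⟨inferInstance, ExtVanishing.of_projective⟩ d h (ih _ h)

lemma IsGorensteinRing.exists_resolutionClass (hR : IsGorensteinRing R) (k : Type u) [Field k]
    [Algebra k R] [FiniteDimensional k R] (M : Type u) [AddCommGroup M] [Module R M]
    [Module.Finite R M] : ∃ n, resolutionClass R n (ModuleCat.of R M) := by
  have := hR.noetherian_left
  obtain ⟨n, hn⟩ := hR.injdim_left
  obtain ⟨W, π, hπ, hW, d, hd⟩ := hR.exists_approximation k n M fun i hi =>
    subsingleton_of_forall_eq 0 fun e =>
      e.eq_zero_of_hasInjectiveDimensionLT (n + 1) (by lia)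
  have := hW.1
  exact ⟨d + 1, isPresented_of_surjective π hπ hW d hd
    (resolutionClass_of_projectiveDimension d _ hd)⟩

/-- With `K i = ker f^i`, the map `f` on `K (i+1)` and on `K i` are the two composites of `f : K
(i+1) ⟶ K i` with the inclusion, so they have the same trace. The kernels need not be Gorenstein
projective, hence the extension of the trace. -/
lemma IsGorensteinRing.trace_eq_zero (hR : IsGorensteinRing R) (k : Type u) [Field k]
    [Algebra k R] [FiniteDimensional k R] {A : Type w} [AddCommGroup A]
    (t : ObjectTrace (isGorensteinProjective R) A) (X : ModuleCat.{u} R)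
    (hX : isGorensteinProjective R X) (f : X →ₗ[R] X) (N : ℕ) (hf : f ^ N = 0) :
    t.tr X hX (ModuleCat.ofHom f) = 0 := by
  have := hR.noetherian_left
  have := hX.1
  let K : ℕ → Submodule R X := fun i => LinearMap.ker (f ^ i)
  have hK : ∀ i, ∀ x ∈ K (i + 1), f x ∈ K i := fun i x hx => by
    rw [LinearMap.mem_ker] at hx ⊢
    rwa [pow_succ] at hx
  have hle : ∀ i, K i ≤ K (i + 1) := fun i x hx => by
    rw [LinearMap.mem_ker] at hx ⊢
    rw [pow_succ', Module.End.mul_apply, hx, map_zero]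
  choose n hn using fun i => hR.exists_resolutionClass k (K i)
  -- A common bound for the resolution lengths puts all the kernels into the domain of one extended
  -- trace.
  let m := (Finset.range (N + 1)).sup n
  have hm : ∀ i, i ≤ N → resolutionClass R m (ModuleCat.of R (K i)) := fun i hi =>
    resolutionClass_mono (Finset.le_sup (f := n) (Finset.mem_range.2 (by lia))) _ (hn i)
  obtain ⟨t', ht'⟩ := t.exists_resolution_extension m
  rw [← ht']
  let r : ∀ i, K i →ₗ[R] K i := fun i => (f ∘ₗ (K i).subtype).codRestrict _ fun x =>
    hK i x (hle i x.2)
  have key : ∀ i (hi : i ≤ N), t'.tr _ (hm i hi) (ModuleCat.ofHom (r i)) = 0 := by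
    intro i
    induction i with
    | zero =>
      intro hi
      have : r 0 = 0 := by
        refine LinearMap.ext fun x => Subtype.ext ?_
        have hx : (x : X) = 0 := x.2
        exact (congrArg f hx).trans (map_zero f)
      rw [this]
      exact t'.map_zero _ _
    | succ i ih =>
      intro hi
      rw [← ih (by lia)]
      exact t'.comm _ _ (hm (i + 1) hi) (hm i (by lia))
        (ModuleCat.ofHom ((f ∘ₗ (K (i + 1)).subtype).codRestrict (K i) fun x => hK i x x.2))
        (ModuleCat.ofHom (Submodule.inclusion (hle i)))
  rw [← key N le_rfl]
  exact t'.comm X (ModuleCat.of R (K N)) _ (hm N le_rfl)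
    (ModuleCat.ofHom (f.codRestrict (K N) fun x => by simp [K, hf]))
    (ModuleCat.ofHom (K N).subtype)

lemma IsGorensteinRing.tracesKillNilpotents (hR : IsGorensteinRing R) (k : Type w) [Field k]
    [Algebra k R] [FiniteDimensional k R] :
    TracesKillNilpotents k (isGorensteinProjective R) := by
  rintro t X hX f ⟨N, hN⟩
  have hpow : ∀ n : ℕ, (End.of f ^ n : End X) = ModuleCat.ofHom (f.hom ^ n) := by
    intro n
    induction n with
    | zero => rfl
    | succ n ih =>
      rw [pow_succ', ih, pow_succ']
      rfl
  have hf : f.hom ^ N = 0 := by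
    rw [hpow] at hN
    exact congrArg ModuleCat.Hom.hom hN
  rcases subsingleton_or_nontrivial R with h | h
  · have : Subsingleton X := Module.subsingleton R X
    have : f = 0 := ModuleCat.hom_ext (LinearMap.ext fun x => Subsingleton.elim _ _)
    rw [this, t.map_zero]
  -- The modules dual to right modules must live in the universe of `R`, so `k` is replaced by a
  -- copy there; this is possible as it embeds into the nonzero ring `R`. The values of the trace
  -- stay in `k`.
  · have : Small.{u} k := small_of_injective (algebraMap k R).injective
    let e : Shrink.{u} k ≃+* k := Shrink.ringEquiv k
    let _ : Algebra (Shrink.{u} k) R := Algebra.compHom R e.toRingHom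
    have : FiniteDimensional (Shrink.{u} k) R := by
      have : IsScalarTower k (Shrink.{u} k) R := ⟨fun c s r => by
        change e (c • s) • r = c • e s • r
        rw [← smul_assoc, show e (c • s) = c • e s from map_smul (Shrink.algEquiv k k) c s]⟩
      exact Module.Finite.of_restrictScalars_finite k _ R
    exact hR.trace_eq_zero (Shrink.{u} k) t X hX f.hom N hf

end GorensteinTrace

/-! ## The stable category is a Krull-Schmidt category -/

section FullSubcategory

variable {C : Type u} [Category.{v} C]

lemma CategoryTheory.ObjectProperty.isIdempotentComplete_fullSubcategory [IsIdempotentComplete C]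
    (𝒯 : ObjectProperty C) (h𝒯 : ∀ {X Y : C} (i : X ⟶ Y) (p : Y ⟶ X), i ≫ p = 𝟙 X → 𝒯 Y → 𝒯 X) :
    IsIdempotentComplete 𝒯.FullSubcategory where
  idempotents_split X p hp := by
    obtain ⟨Y, i, e, h₁, h₂⟩ := IsIdempotentComplete.idempotents_split X.obj p.hom
      (by rw [← ObjectProperty.FullSubcategory.comp_hom, hp])
    exact ⟨⟨Y, h𝒯 i e h₁ X.property⟩, ObjectProperty.homMk i, ObjectProperty.homMk e,
      ObjectProperty.hom_ext _ h₁, ObjectProperty.hom_ext _ h₂⟩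

end FullSubcategory

section Stable

variable {E : Type u} [Category.{v} E] [Preadditive E] [HasFiniteBiproducts E]
  (𝓕 : FrobeniusStructure E)

namespace FrobeniusStructure

instance [HasZeroObject E] : HasZeroObject 𝓕.Stable :=
  let ⟨Z, hZ⟩ := HasZeroObject.zero (C := E)
  ⟨𝓕.toStable.obj Z, 𝓕.toStable.map_isZero hZ⟩

instance [HasBinaryBiproducts E] : HasBinaryBiproducts 𝓕.Stable :=
  ⟨fun X Y => HasBinaryBiproduct.mk
    { bicone := 𝓕.toStable.mapBinaryBicone (BinaryBiproduct.bicone X.as Y.as)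
      isBilimit := isBinaryBilimitOfTotal _ (by
        have := congrArg 𝓕.toStable.map (biprod.total (X := X.as) (Y := Y.as))
        rwa [Functor.map_add, Functor.map_comp, Functor.map_comp, 𝓕.toStable.map_id] at this) }⟩

lemma hasFiniteBiproducts_stable [HasZeroObject E] [HasBinaryBiproducts E] :
    HasFiniteBiproducts 𝓕.Stable :=
  have : HasTerminal 𝓕.Stable := inferInstance
  have : HasFiniteProducts 𝓕.Stable := hasFiniteProducts_of_has_binary_and_terminal
  HasFiniteBiproducts.of_hasFiniteProducts

variable (k : Type w) [Field k] [Linear k E]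

instance [∀ X Y : E, FiniteDimensional k (X ⟶ Y)] (X Y : 𝓕.Stable) :
    FiniteDimensional k (X ⟶ Y) := by
  let ρ : (X.as ⟶ Y.as) →ₗ[k] (X ⟶ Y) :=
    { toFun := fun f => 𝓕.toStable.map f
      map_add' := fun _ _ => 𝓕.toStable.map_add
      map_smul' := fun c f => rfl }
  exact Module.Finite.of_surjective ρ (𝓕.toStable.map_surjective (X := X.as) (Y := Y.as))

/-- The ring homomorphism from honest to stable endomorphisms. -/
def toStableEnd (X : E) : End X →+* End (𝓕.toStable.obj X) where
  toFun f := 𝓕.toStable.map f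
  map_one' := 𝓕.toStable.map_id X
  map_mul' f g := 𝓕.toStable.map_comp g f
  map_zero' := 𝓕.toStable.map_zero X X
  map_add' _ _ := 𝓕.toStable.map_add

lemma isIdempotentComplete_stable [IsIdempotentComplete E]
    [∀ X Y : E, FiniteDimensional k (X ⟶ Y)] : IsIdempotentComplete 𝓕.Stable where
  idempotents_split X p hp := by
    obtain ⟨a, rfl⟩ := (𝓕.toStable.map_surjective (X := X.as) (Y := X.as)) p
    have : FiniteDimensional k (End X.as) := inferInstanceAs (FiniteDimensional k (X.as ⟶ X.as))
    obtain ⟨e, he, hea⟩ := exists_idempotent_lift k (𝓕.toStableEnd X.as) a hp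
    obtain ⟨Y, i, q, h₁, h₂⟩ := IsIdempotentComplete.idempotents_split X.as e he
    refine ⟨𝓕.toStable.obj Y, 𝓕.toStable.map i, 𝓕.toStable.map q, ?_, ?_⟩
    · exact (𝓕.toStable.map_comp i q).symm.trans ((congrArg _ h₁).trans (𝓕.toStable.map_id Y))
    · exact (𝓕.toStable.map_comp q i).symm.trans ((congrArg _ h₂).trans hea)

/-- A nilpotent stable endomorphism has a nilpotent representative, and a stable trace pulls back to
the exact category. -/
lemma tracesKillNilpotents_stable [∀ X Y : E, FiniteDimensional k (X ⟶ Y)]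
    {𝒯 : ObjectProperty 𝓕.Stable} (h : TracesKillNilpotents k (𝒯.inverseImage 𝓕.toStable)) :
    TracesKillNilpotents k 𝒯 := by
  intro t X hX f hf
  obtain ⟨a, rfl⟩ := (𝓕.toStable.map_surjective (X := X.as) (Y := X.as)) f
  have : FiniteDimensional k (End X.as) := inferInstanceAs (FiniteDimensional k (X.as ⟶ X.as))
  obtain ⟨e, he, hea⟩ := exists_nilpotent_lift k (𝓕.toStableEnd X.as) a hf
  have := h (t.comap 𝓕.toStable) X.as hX e he
  change t.tr X hX (𝓕.toStable.map e) = 0 at this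
  rwa [show 𝓕.toStable.map e = 𝓕.toStable.map a from hea] at this

variable {k}

/-- Every object has a presentation by objects of a cluster-tilting subcategory. -/
lemma isPresented_of_isClusterTilting [HasZeroObject E] [HasBinaryBiproducts E]
    {𝒯 : ObjectProperty 𝓕.Stable} (h𝒯 : IsClusterTiltingSubcategory 𝓕.suspension 𝒯) (X : E) :
    isPresented (𝒯.inverseImage 𝓕.toStable) (𝒯.inverseImage 𝓕.toStable) X := by
  obtain ⟨M, f, hM, happ⟩ := h𝒯.functoriallyFinite.1 (𝓕.toStable.obj X)
  obtain ⟨f, rfl⟩ := (𝓕.toStable.map_surjective (X := M.as) (Y := X)) f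
  obtain ⟨P, p, hP, hp⟩ := 𝓕.enough_proj X
  -- Adding the projective `P` makes the approximation a deflation and does not change the object
  -- stably.
  have hT : 𝒯 (𝓕.toStable.obj (M.as ⊞ P)) := by
    refine h𝒯.isAdditiveClass.retract (𝓕.toStable.map biprod.fst) (𝓕.toStable.map biprod.inl) ?_ hM
    rw [← Functor.map_comp, ← 𝓕.toStable.map_id, toStable_map_eq_iff]
    refine ⟨P, -biprod.snd, biprod.inr, hP, ?_⟩
    rw [Preadditive.neg_comp, neg_eq_iff_eq_neg, neg_sub, eq_sub_iff_add_eq, add_comm,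
      biprod.total]
  obtain ⟨K, i, h, hc⟩ := 𝓕.isDeflation_desc f hp
  obtain ⟨c, hc'⟩ := exists_connecting hc
  have hlift : ∀ {Y : 𝓕.Stable} (_ : 𝒯 Y) (g : Y ⟶ 𝓕.toStable.obj X),
      ∃ g' : Y ⟶ 𝓕.toStable.obj (M.as ⊞ P), g' ≫ 𝓕.toStable.map (biprod.desc f p) = g := by
    intro Y hY g
    obtain ⟨g', rfl⟩ := happ Y g hY
    refine ⟨g' ≫ 𝓕.toStable.map (biprod.inl : M.as ⟶ M.as ⊞ P), ?_⟩
    rw [Category.assoc]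
    refine congrArg (g' ≫ ·) ?_
    refine (𝓕.toStable.map_comp _ _).symm.trans ?_
    rw [biprod.inl_desc]
  -- A map from `Y` in `𝒯` to the suspension of `K` comes from a map to `X` by rigidity; that one
  -- lifts to the approximation, so the composite vanishes.
  have hK : 𝒯 (𝓕.toStable.obj K) := by
    refine h𝒯.maximal _ fun Y hY g => ?_
    obtain ⟨g', rfl⟩ := hc'.exact_susp g (h𝒯.rigid hY hT _)
    obtain ⟨g'', rfl⟩ := hlift hY g'
    exact (Category.assoc _ _ _).trans ((congrArg (g'' ≫ ·) hc'.comp_right).trans comp_zero)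
  exact ⟨{ K := K, T := M.as ⊞ P, i := i, p := biprod.desc f p, hK := hK, hT := hT
           zero := h
           mono := 𝓕.mono_of_conflation hc
           exact := fun g hg => 𝓕.exists_lift hc g hg
           lift := fun {T'} hT' g => by
             obtain ⟨g', hg'⟩ := hlift hT' (𝓕.toStable.map g)
             exact 𝓕.exists_lift_of_stable g (𝓕.isDeflation_desc f hp) g' hg' }⟩

end FrobeniusStructure

end Stable

/-! ### Idempotents, finiteness and traces in the category of Gorenstein projective modules -/

section GorensteinProjective

variable {R : Type u} [Ring R]

lemma isGorensteinProjective_of_retract {X Y : ModuleCat.{u} R} (i : X ⟶ Y) (p : Y ⟶ X)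
    (h : i ≫ p = 𝟙 X) (hY : isGorensteinProjective R Y) : isGorensteinProjective R X := by
  have := hY.1
  refine ⟨Module.Finite.of_surjective p.hom fun x =>
    ⟨i.hom x, LinearMap.congr_fun (congrArg ModuleCat.Hom.hom h) x⟩, fun j hj => ?_⟩
  have := hY.2 j hj
  refine subsingleton_of_forall_eq 0 fun e => ?_
  have h1 : (Abelian.Ext.mk₀ i).comp ((Abelian.Ext.mk₀ p).comp e (zero_add j)) (zero_add j) = e := by
    rw [Abelian.Ext.mk₀_comp_mk₀_assoc, h, Abelian.Ext.mk₀_id_comp]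
  rw [← h1, Subsingleton.elim ((Abelian.Ext.mk₀ p).comp e (zero_add j)) 0, Abelian.Ext.comp_zero]

instance : IsIdempotentComplete (GP R) :=
  (isGorensteinProjective R).isIdempotentComplete_fullSubcategory isGorensteinProjective_of_retract

open ModuleCat in
instance (k : Type w) [Field k] [Algebra k R] [FiniteDimensional k R] (X Y : GP R) :
    FiniteDimensional k (X ⟶ Y) := by
  have := X.property.1
  have := Y.property.1
  have : FiniteDimensional k X.obj := Module.Finite.trans R X.obj
  have : FiniteDimensional k Y.obj := Module.Finite.trans R Y.obj
  let ρ : (X ⟶ Y) →ₗ[k] (X.obj →ₗ[k] Y.obj) :=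
    { toFun := fun f => f.hom.hom.restrictScalars k
      map_add' := fun f g => rfl
      map_smul' := fun c f => rfl }
  refine FiniteDimensional.of_injective ρ fun f g h => ?_
  exact ObjectProperty.hom_ext _ (ModuleCat.hom_ext (LinearMap.ext fun x => LinearMap.congr_fun h x))

/-- One extension step carries a trace on `𝒰` to all Gorenstein projectives, where nilpotents are
known to have trace zero. -/
lemma IsGorensteinRing.tracesKillNilpotents_of_isPresented (hR : IsGorensteinRing R) (k : Type w)
    [Field k] [Algebra k R] [FiniteDimensional k R] {𝒰 : ObjectProperty (GP R)}
    (h : ∀ X, isPresented 𝒰 𝒰 X) : TracesKillNilpotents k 𝒰 := by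
  intro t X hX f hf
  obtain ⟨t', ht'⟩ := t.exists_extension le_rfl
  rw [← ht' X (h X) hX f]
  let s : ObjectTrace (isGorensteinProjective R) k :=
    { tr := fun Y hY g => t'.tr ⟨Y, hY⟩ (h _) (ObjectProperty.homMk g)
      map_add := fun Y hY g g' => t'.map_add _ _ _ _
      comm := fun Y Z hY hZ g g' => t'.comm ⟨Y, hY⟩ ⟨Z, hZ⟩ (h _) (h _)
        (ObjectProperty.homMk g) (ObjectProperty.homMk g') }
  obtain ⟨N, hN⟩ := hf
  refine hR.tracesKillNilpotents k s X.obj X.property f.hom ⟨N, ?_⟩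
  have hpow : ∀ n : ℕ, (End.of f.hom ^ n : End X.obj) = (End.of f ^ n : X ⟶ X).hom := by
    intro n
    induction n with
    | zero => rfl
    | succ n ih => rw [pow_succ', ih, pow_succ']; rfl
  rw [hpow, hN]
  rfl

end GorensteinProjective

/-! ## Quivers of full subcategories -/

section Quivers

variable {C : Type u} [Category.{v} C] [Preadditive C]

lemma IsRadicalSqHom.comp_right {X Y Z : C} {f : X ⟶ Y} (hf : IsRadicalSqHom f) (g : Y ⟶ Z) :
    IsRadicalSqHom (f ≫ g) := by
  obtain ⟨W, a, b, ha, hb, rfl⟩ := hf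
  exact ⟨W, a, b ≫ g, ha, hb.comp_right g, (Category.assoc _ _ _).symm⟩

lemma IsRadicalSqHom.comp_left {X Y Z : C} {g : Y ⟶ Z} (hg : IsRadicalSqHom g) (f : X ⟶ Y) :
    IsRadicalSqHom (f ≫ g) := by
  obtain ⟨W, a, b, ha, hb, rfl⟩ := hg
  exact ⟨W, f ≫ a, b, ha.comp_left f, hb, Category.assoc _ _ _⟩

lemma exists_iso_of_indecClass_eq {X Y : (isIndecomposable C).FullSubcategory}
    (h : (⟦X⟧ : IndecClass C) = ⟦Y⟧) : Nonempty (X.obj ≅ Y.obj) := by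
  obtain ⟨e⟩ := Quotient.exact h
  exact ⟨(isIndecomposable C).ι.mapIso e⟩

lemma categoryQuiver_noLoops (h : ∀ (X : C), isIndecomposable C X → ∀ f : X ⟶ X,
    IsRadicalHom f → IsRadicalSqHom f) : (categoryQuiver C).NoLoops := by
  rintro x ⟨X, Y, hX, hY, f, hf, hf'⟩
  -- An arrow is witnessed on two representatives of the class, so the map is transported to an
  -- endomorphism of one of them and back.
  obtain ⟨e⟩ := exists_iso_of_indecClass_eq (hX.trans hY.symm)
  apply hf'
  have := (h X.obj X.property (f ≫ e.inv) (hf.comp_right _)).comp_right e.hom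
  rwa [Category.assoc, e.inv_hom_id, Category.comp_id] at this

lemma categoryQuiver_noTwoCycles (h : ∀ X Y : C, isIndecomposable C X → isIndecomposable C Y →
    ∀ (b : X ⟶ Y) (a : Y ⟶ X), IsRadicalHom b → IsRadicalSqHom b ∨ IsRadicalSqHom a) :
    (categoryQuiver C).NoTwoCycles := by
  rintro x y ⟨⟨X, Y, hX, hY, b, hb, hb'⟩, ⟨Y', X', hY', hX', a, ha, ha'⟩⟩
  obtain ⟨e⟩ := exists_iso_of_indecClass_eq (hX.trans hX'.symm)
  obtain ⟨e'⟩ := exists_iso_of_indecClass_eq (hY.trans hY'.symm)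
  rcases h _ _ X.property Y.property b (e'.hom ≫ a ≫ e.inv) hb with h | h
  · exact hb' h
  · apply ha'
    have := (h.comp_left e'.inv).comp_right e.hom
    simpa using this

variable {𝒯 : ObjectProperty C}

/-- The radical of a full subcategory is the restriction of the ambient one. Its square is smaller
in general, as the middle object must lie in `𝒯`; `IsRadicalSqIn` records this. -/
lemma isRadicalHom_hom_iff {X Y : 𝒯.FullSubcategory} (f : X ⟶ Y) :
    IsRadicalHom f.hom ↔ IsRadicalHom f := by
  constructor
  · intro h g
    have : IsIso (𝒯.ι.map (𝟙 X - f ≫ g)) := h g.hom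
    exact isIso_of_reflects_iso _ 𝒯.ι
  · intro h g
    have := h (ObjectProperty.homMk g)
    exact inferInstanceAs (IsIso (𝒯.ι.map (𝟙 X - f ≫ ObjectProperty.homMk g)))

lemma IsRadicalSqIn.isRadicalSqHom {X Y : 𝒯.FullSubcategory} {f : X ⟶ Y}
    (hf : IsRadicalSqIn 𝒯 f.hom) : IsRadicalSqHom f := by
  obtain ⟨Z, g, h, hZ, hg, hh, hgh⟩ := hf
  exact ⟨⟨Z, hZ⟩, ObjectProperty.homMk g, ObjectProperty.homMk h,
    (isRadicalHom_hom_iff (X := X) (Y := ⟨Z, hZ⟩) (ObjectProperty.homMk g)).1 hg,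
    (isRadicalHom_hom_iff (X := ⟨Z, hZ⟩) (Y := Y) (ObjectProperty.homMk h)).1 hh,
    ObjectProperty.hom_ext _ hgh⟩

variable (k : Type w) [Field k] [IsAlgClosed k] [Linear k C] [IsIdempotentComplete C]
  [∀ X Y : C, FiniteDimensional k (X ⟶ Y)]

lemma isIndecomposable.isLocalObject {X : C} (hX : isIndecomposable C X) : IsLocalObject k X :=
  isLocalObject_of_idempotents hX.1 (isIndecomposable_idempotent hX)

lemma isLocalObject_of_isIndecomposable_fullSubcategory [HasBinaryBiproducts C]
    (h𝒯 : IsAdditiveClass 𝒯) {X : 𝒯.FullSubcategory}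
    (hX : isIndecomposable 𝒯.FullSubcategory X) : IsLocalObject k X.obj := by
  have := 𝒯.isIdempotentComplete_fullSubcategory h𝒯.retract
  refine isLocalObject_of_idempotents (fun h => hX.1 ?_) fun e he => ?_
  · rw [IsZero.iff_id_eq_zero] at h ⊢
    exact ObjectProperty.hom_ext _ h
  · rcases isIndecomposable_idempotent hX (ObjectProperty.homMk e) (ObjectProperty.hom_ext _ he)
      with h | h
    · exact Or.inl (congrArg 𝒯.ι.map h)
    · exact Or.inr (congrArg 𝒯.ι.map h)

lemma subcategoryQuiver_noLoops [HasBinaryBiproducts C] (h𝒯 : IsAdditiveClass 𝒯)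
    (hk : TracesKillNilpotents k 𝒯) : (subcategoryQuiver 𝒯).NoLoops :=
  categoryQuiver_noLoops fun X hX f hf => IsRadicalSqIn.isRadicalSqHom <|
    isRadicalSqIn_of_endo h𝒯 hk X.property
      (isLocalObject_of_isIndecomposable_fullSubcategory k h𝒯 hX) f.hom
      ((isRadicalHom_hom_iff f).2 hf)

lemma categoryQuiver_noLoops_of_traces [HasBinaryBiproducts C]
    (hk : TracesKillNilpotents k (⊤ : ObjectProperty C)) : (categoryQuiver C).NoLoops :=
  categoryQuiver_noLoops fun X hX f hf => by
    obtain ⟨Z, g, h, -, hg, hh, hgh⟩ := isRadicalSqIn_of_endo (𝒯 := ⊤)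
      ⟨fun _ _ => trivial, fun _ _ _ _ => trivial⟩ hk trivial (hX.isLocalObject k) f hf
    exact ⟨Z, g, h, hg, hh, hgh⟩

end Quivers

/-! ### Cluster-tilting objects -/

section ClusterTiltingObject

variable {C : Type u} [Category.{v} C] [Preadditive C]

lemma addClosure.hom_eq_zero {S : C ⥤ C} [S.Additive] {M X Y : C} (hX : addClosure M X)
    (hY : addClosure M Y) (hM : ∀ f : M ⟶ S.obj M, f = 0) (f : X ⟶ S.obj Y) : f = 0 := by
  obtain ⟨n, b, ⟨hb⟩, ⟨r⟩⟩ := hX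
  obtain ⟨n', b', ⟨hb'⟩, ⟨r'⟩⟩ := hY
  have key : ∀ g : b.pt ⟶ S.obj b'.pt, g = 0 := by
    intro g
    rw [← Category.id_comp g, ← Category.comp_id g, ← S.map_id, ← IsBilimit.total hb, ← IsBilimit.total hb', S.map_sum,
      Preadditive.comp_sum, Preadditive.sum_comp]
    refine Finset.sum_eq_zero fun j _ => ?_
    rw [Preadditive.comp_sum]
    refine Finset.sum_eq_zero fun l _ => ?_
    have := hM (b.ι j ≫ g ≫ S.map (b'.π l))
    rw [S.map_comp, Category.assoc, ← Category.assoc g, ← Category.assoc (b.ι j), this]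
    simp
  have h1 : f = r.i ≫ (r.r ≫ f ≫ S.map r'.i) ≫ S.map r'.r := by
    simp [← S.map_comp]
  rw [h1, key (r.r ≫ f ≫ S.map r'.i)]
  simp

lemma addClosure_self (M : C) : addClosure M M :=
  ⟨1, biproduct.bicone _, ⟨biproduct.isBilimit _⟩,
    ⟨{ i := biproduct.ι (fun _ : Fin 1 => M) 0, r := biproduct.π (fun _ : Fin 1 => M) 0 }⟩⟩

variable [HasFiniteBiproducts C]

lemma addClosure_biproduct (M : C) (n : ℕ) : addClosure M (⨁ fun _ : Fin n => M) :=
  ⟨n, biproduct.bicone _, ⟨biproduct.isBilimit _⟩, ⟨Retract.refl _⟩⟩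

/-- Hom-finiteness gives approximations: a basis of `Hom(M, X)`, respectively `Hom(X, M)`, assembles
into a map from, respectively to, a finite sum of copies of `M`. -/
lemma isFunctoriallyFinite_addClosure (k : Type w) [Field k] [Linear k C]
    [∀ X Y : C, FiniteDimensional k (X ⟶ Y)] (M : C) : IsFunctoriallyFinite (addClosure M) := by
  constructor
  · intro X
    let β := Module.finBasis k (M ⟶ X)
    refine ⟨_, biproduct.desc β, addClosure_biproduct M _, ?_⟩
    rintro N h ⟨n, b, ⟨hb⟩, ⟨r⟩⟩
    refine ⟨r.i ≫ ∑ j, b.π j ≫ biproduct.lift fun l => β.repr (b.ι j ≫ r.r ≫ h) l • 𝟙 M, ?_⟩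
    have h1 : ∀ j, (biproduct.lift fun l => β.repr (b.ι j ≫ r.r ≫ h) l • 𝟙 M) ≫
        biproduct.desc β = b.ι j ≫ r.r ≫ h := by
      intro j
      rw [biproduct.lift_desc]
      simp only [Linear.smul_comp, Category.id_comp]
      exact β.sum_repr _
    simp only [Category.assoc, Preadditive.sum_comp, h1]
    simp only [← Category.assoc (b.π _), ← Preadditive.sum_comp, IsBilimit.total hb]
    simp
  · intro X
    let β := Module.finBasis k (X ⟶ M)
    refine ⟨_, biproduct.lift β, addClosure_biproduct M _, ?_⟩
    rintro N h ⟨n, b, ⟨hb⟩, ⟨r⟩⟩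
    refine ⟨(∑ j, (biproduct.desc fun l => β.repr (h ≫ r.i ≫ b.π j) l • 𝟙 M) ≫ b.ι j) ≫ r.r, ?_⟩
    have h1 : ∀ j, biproduct.lift β ≫ (biproduct.desc fun l => β.repr (h ≫ r.i ≫ b.π j) l • 𝟙 M) =
        h ≫ r.i ≫ b.π j := by
      intro j
      rw [biproduct.lift_desc]
      simp only [Linear.comp_smul, Category.comp_id]
      exact β.sum_repr _
    have h2 : ∀ j, biproduct.lift β ≫ (biproduct.desc fun l => β.repr (h ≫ r.i ≫ b.π j) l • 𝟙 M) ≫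
        b.ι j = (h ≫ r.i) ≫ b.π j ≫ b.ι j := by
      intro j
      rw [← Category.assoc, h1]
      simp
    rw [← Category.assoc, Preadditive.comp_sum, Finset.sum_congr rfl fun j _ => h2 j,
      ← Preadditive.comp_sum, IsBilimit.total hb]
    simp

lemma IsClusterTiltingObject.isClusterTiltingSubcategory (k : Type w) [Field k] [Linear k C]
    [∀ X Y : C, FiniteDimensional k (X ⟶ Y)] {S : C ⥤ C} [S.Additive] {M : C}
    (hM : IsClusterTiltingObject S M) : IsClusterTiltingSubcategory S (addClosure M) where
  rigid _ _ hX hY f := addClosure.hom_eq_zero hX hY hM.rigid f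
  maximal X h := hM.maximal X (h M (addClosure_self M))
  functoriallyFinite := isFunctoriallyFinite_addClosure k M

end ClusterTiltingObject

/-! ### The stable category of Gorenstein projective modules -/

section StableGorensteinProjective

variable {k : Type w} [Field k] [IsAlgClosed k] {R : Type u} [Ring R] [Algebra k R]
  [FiniteDimensional k R] (𝓕 : FrobeniusStructure (GP R))

lemma IsGorensteinRing.categoryQuiver_stable_noLoops (hR : IsGorensteinRing R)
    (k : Type w) [Field k] [IsAlgClosed k] [Algebra k R] [FiniteDimensional k R] :
    (categoryQuiver 𝓕.Stable).NoLoops := by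
  have := 𝓕.isIdempotentComplete_stable k
  refine categoryQuiver_noLoops_of_traces k (𝓕.tracesKillNilpotents_stable k
    (hR.tracesKillNilpotents_of_isPresented k fun X => ?_))
  obtain ⟨Z, hZ⟩ := HasZeroObject.zero (C := GP R)
  -- For the whole stable category every object presents itself, with kernel zero.
  exact ⟨{ K := Z, T := X, i := 0, p := 𝟙 X, hK := trivial, hT := trivial
           zero := zero_comp
           mono := ⟨fun _ _ _ => hZ.eq_of_tgt _ _⟩
           exact := fun f hf => ⟨0, by rw [← Category.comp_id f, hf, zero_comp]⟩
           lift := fun _ f => ⟨f, Category.comp_id f⟩ }⟩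

variable {𝓕}

/-- Cluster-tilting presentations give the vanishing of traces on nilpotents, which excludes loops;
the Serre trace and the triangles then exclude two-cycles. -/
lemma IsClusterTiltingSubcategory.noLoops_and_noTwoCycles (hR : IsGorensteinRing R)
    (hcy : IsTwoCalabiYau k 𝓕.suspension) {𝒯 : ObjectProperty 𝓕.Stable}
    (h𝒯 : IsClusterTiltingSubcategory 𝓕.suspension 𝒯) :
    (subcategoryQuiver 𝒯).NoLoops ∧ (subcategoryQuiver 𝒯).NoTwoCycles := by
  have := 𝓕.isIdempotentComplete_stable k
  have hk : TracesKillNilpotents k 𝒯 := 𝓕.tracesKillNilpotents_stable k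
    (hR.tracesKillNilpotents_of_isPresented k (𝓕.isPresented_of_isClusterTilting h𝒯))
  refine ⟨subcategoryQuiver_noLoops k h𝒯.isAdditiveClass hk,
    categoryQuiver_noTwoCycles fun X Y hX hY b a hb => ?_⟩
  obtain ⟨τ⟩ := hcy.exists_serreTrace
  have := hcy.1
  have := 𝓕.suspension.isEquivalence_of_isEquivalence_comp_self
  exact (isRadicalSqIn_or_of_two_cycle τ h𝒯 (fun δ => 𝓕.exists_isExactTriangle δ) hk
    (isLocalObject_of_isIndecomposable_fullSubcategory k h𝒯.isAdditiveClass hX) X.property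
    (isLocalObject_of_isIndecomposable_fullSubcategory k h𝒯.isAdditiveClass hY) Y.property
    (a := a.hom) ((isRadicalHom_hom_iff b).2 hb)).imp
    IsRadicalSqIn.isRadicalSqHom IsRadicalSqIn.isRadicalSqHom

end StableGorensteinProjective

end

theorem theorem2p11 {k : Type w} [Field k] [IsAlgClosed k] {R : Type u} [Ring R] [Algebra k R]
    [FiniteDimensional k R] (hR : IsGorensteinRing R) (𝓕 : FrobeniusStructure (GP R)) :
    (categoryQuiver 𝓕.Stable).NoLoops ∧
    (IsTwoCalabiYau k 𝓕.suspension →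
      (∀ M : 𝓕.Stable, IsClusterTiltingObject 𝓕.suspension M →
        (objectQuiver M).NoLoops ∧ (objectQuiver M).NoTwoCycles) ∧
      (∀ 𝒯 : ObjectProperty 𝓕.Stable, IsClusterTiltingSubcategory 𝓕.suspension 𝒯 →
        (subcategoryQuiver 𝒯).NoLoops ∧ (subcategoryQuiver 𝒯).NoTwoCycles)) := by
  refine ⟨hR.categoryQuiver_stable_noLoops 𝓕 k, fun hcy => ⟨fun M hM => ?_, fun 𝒯 h𝒯 =>
    h𝒯.noLoops_and_noTwoCycles hR hcy⟩⟩
  have := 𝓕.hasFiniteBiproducts_stable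
  exact (hM.isClusterTiltingSubcategory k).noLoops_and_noTwoCycles hR hcy
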